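/- Write $\langle a\rangle=(1+a^2)^{1/2}$, let $\mathscr F$ be the Fourier transform on $\mathbb R^2$ in $(t,x)$, $\mathscr F u(\tau,\xi)=\int e^{-i(t\tau+x\xi)}u\,dt\,dx$, extended to tempered distributions, and put $\sigma(\tau,\xi)=\tau-\xi^3+\frac1\xi$, $$D=\{|\xi|\le \tfrac18,\ |\tau|\ge|\xi|^{-3}\},\quad A_j=\{2^j\le\langle\xi\rangle<2^{j+1}\},\quad B_k=\{2^k\le\langle\sigma\rangle<2^{k+1}\}\qquad(j,k\ge 0).$$ For $u\in\mathscr S'(\mathbb R^2)$ whose Fourier transform is a function let $$\|u\|_X=\Big[\sum_{j\ge0}\Big(\sum_{k\ge0}\big\|\langle\xi\rangle^{-3/4}\langle\sigma\rangle^{1/2}\chi_{D^c}\mathscr Fu\big\|_{L^2(A_j\cap B_k)}\Big)^2\Big]^{1/2}+\big\|\langle\xi\rangle^{-3/4}\langle\sigma\rangle^{1/2}\chi_D\mathscr Fu\big\|_{L^2(\mathbb R^2)},$$ $$\|u\|_Y=\big\|\langle\xi\rangle^{-3/4}\mathscr Fu\big\|_{L^2_\xi L^1_\tau},$$ let both norms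 be $\infty$ if $\mathscr Fu$ is not a function, and let $X=\{u\in\mathscr S'(\mathbb R^2):\|u\|_X<\infty\}$. There is a constant $C$ such that for all $u,v\in X$ the product $uv$ is defined as a tempered distribution, in the sense that the convolution integral $\mathscr Fu*\mathscr Fv$ converges absolutely almost everywhere and $\mathscr F(uv)=(2\pi)^{-2}\,\mathscr Fu*\mathscr Fv$ is a function which defines a tempered distribution; moreover $\mathscr F[\partial_x(uv)]$ is a function, $\mathscr F^{-1}\big[\langle\sigma\rangle^{-1}\mathscr F[\partial_x(uv)]\big]$ is a tempered distribution, and $$\Big\|\mathscr F^{-1}\big[\langle\sigma\rangle^{-1}\mathscr F[\partial_x(uv)]\big]\Big\|_X+\Big\|\mathscr F^{-1}\big[\langle\sigma\rangle^{-1}\mathscr F[\partial_x(uv)]\big]\Big\|_Y\le C\,\|u\|_X\,\|v\|_X .$$ -/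

import Mathlib

open MeasureTheory
open scoped ENNReal NNReal FourierTransform SchwartzMap LineDeriv Convolution

noncomputable section

namespace Ostrovsky

/-- The space-time plane `ℝ²`; the coordinate `0` is the time `t` and the coordinate `1` is the
space variable `x`. -/
abbrev Plane : Type := EuclideanSpace ℝ (Fin 2)

/-- The Japanese bracket `⟨a⟩ = (1 + a²)^{1/2}`. -/
def jap (a : ℝ) : ℝ := Real.sqrt (1 + a ^ 2)

/-- The modulation `τ - ξ³ + 1/ξ` at the frequency `p = (τ, ξ)`. -/
def modulation (p : ℝ × ℝ) : ℝ := p.1 - p.2 ^ 3 + 1 / p.2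

/-- `D = {(τ, ξ) : |ξ| ≤ 1/8, |τ| ≥ |ξ|⁻³}`. -/
def regionD : Set (ℝ × ℝ) := {p | |p.2| ≤ 1 / 8 ∧ (|p.2| ^ 3)⁻¹ ≤ |p.1|}

/-- `A_j = {(τ, ξ) : 2^j ≤ ⟨ξ⟩ < 2^(j+1)}`. -/
def shellA (j : ℕ) : Set (ℝ × ℝ) := {p | 2 ^ j ≤ jap p.2 ∧ jap p.2 < 2 ^ (j + 1)}

/-- `B_k = {(τ, ξ) : 2^k ≤ ⟨τ - ξ³ + 1/ξ⟩ < 2^(k+1)}`. -/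
def shellB (k : ℕ) : Set (ℝ × ℝ) :=
  {p | 2 ^ k ≤ jap (modulation p) ∧ jap (modulation p) < 2 ^ (k + 1)}

/-- The function `⟨ξ⟩^s ⟨τ - ξ³ + 1/ξ⟩^b f(τ, ξ)`. -/
def weighted (s b : ℝ) (f : ℝ × ℝ → ℂ) (p : ℝ × ℝ) : ℂ :=
  ((jap p.2 ^ s * jap (modulation p) ^ b : ℝ) : ℂ) * f p

/-- The `X^{s,b}` norm, read on the Fourier side:
`‖⟨ξ⟩^s ⟨τ - ξ³ + 1/ξ⟩^b f‖_{L²(ℝ²)}`. -/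
def hatNormXsb (s b : ℝ) (f : ℝ × ℝ → ℂ) : ℝ≥0∞ :=
  eLpNorm (weighted s b f) 2 volume

/-- The `X^{s,b,1}` norm, read on the Fourier side: the `ℓ²_j(ℓ¹_k)` norm of
`‖⟨ξ⟩^s ⟨τ - ξ³ + 1/ξ⟩^b f‖_{L²(A_j ∩ B_k)}`. -/
def hatNormXsb1 (s b : ℝ) (f : ℝ × ℝ → ℂ) : ℝ≥0∞ :=
  (∑' j : ℕ, (∑' k : ℕ,
    eLpNorm (weighted s b f) 2 (volume.restrict (shellA j ∩ shellB k))) ^ (2 : ℝ)) ^ (1 / 2 : ℝ)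

/-- The `X` norm, read on the Fourier side. -/
def hatNormX (f : ℝ × ℝ → ℂ) : ℝ≥0∞ :=
  hatNormXsb1 (-3 / 4) (1 / 2) (regionDᶜ.indicator f)
    + hatNormXsb (-3 / 4) (1 / 2) (regionD.indicator f)

/-- The `Y` norm, read on the Fourier side: `‖⟨ξ⟩^{-3/4} f‖_{L²_ξ L¹_τ}`. -/
def hatNormY (f : ℝ × ℝ → ℂ) : ℝ≥0∞ :=
  (∫⁻ ξ : ℝ, (∫⁻ τ : ℝ, ‖((jap ξ ^ (-3 / 4 : ℝ) : ℝ) : ℂ) * f (τ, ξ)‖ₑ) ^ (2 : ℝ)) ^ (1 / 2 : ℝ)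

/-- The space-time Fourier transform of the tempered distribution `u`, in the convention
`∫ u(t, x) e^{-i (t τ + x ξ)} dt dx`, is the function `f` of `(τ, ξ)`.
Mathlib's transform `𝓕` uses the kernel `e^{-2 π i (t τ + x ξ)}`, hence the dilation by `2π`. -/
def HasFourierDensity (u : 𝓢'(Plane, ℂ)) (f : ℝ × ℝ → ℂ) : Prop :=
  AEStronglyMeasurable f volume ∧
  ∀ φ : 𝓢(Plane, ℂ),
    Integrable (fun y : Plane => f (2 * Real.pi * y 0, 2 * Real.pi * y 1) * φ y) volume ∧
    𝓕 u φ = ∫ y : Plane, f (2 * Real.pi * y 0, 2 * Real.pi * y 1) * φ y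

/-- `‖u‖_X`. It is `∞` if the Fourier transform of `u` is not a function; otherwise the density is
unique up to null sets, and the infimum is over functions with the same norm. -/
def normX (u : 𝓢'(Plane, ℂ)) : ℝ≥0∞ :=
  ⨅ (f : ℝ × ℝ → ℂ) (_ : HasFourierDensity u f), hatNormX f

/-- `‖u‖_Y`, with the same convention as `normX`. -/
def normY (u : 𝓢'(Plane, ℂ)) : ℝ≥0∞ :=
  ⨅ (f : ℝ × ℝ → ℂ) (_ : HasFourierDensity u f), hatNormY f

/-- The space `X` of tempered distributions with finite `X` norm. -/
def spaceX : Set 𝓢'(Plane, ℂ) := {u | normX u < ∞}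

/-- `p` is the product `u v` of the tempered distributions `u` and `v`: the Fourier transforms of
`u` and `v` are functions, their convolution integral converges absolutely almost everywhere, and
`F p = (2π)⁻² F u * F v`. -/
def IsProduct (u v p : 𝓢'(Plane, ℂ)) : Prop :=
  ∃ f g : ℝ × ℝ → ℂ, HasFourierDensity u f ∧ HasFourierDensity v g ∧
    (∀ᵐ z : ℝ × ℝ, ConvolutionExistsAt f g z (ContinuousLinearMap.mul ℝ ℂ) volume) ∧
    HasFourierDensity p
      (fun z => ((2 * Real.pi : ℝ) : ℂ)⁻¹ ^ 2 *
        convolution f g (ContinuousLinearMap.mul ℝ ℂ) volume z)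

/-- The distributional derivative `∂_x`. -/
def dx (p : 𝓢'(Plane, ℂ)) : 𝓢'(Plane, ℂ) :=
  ∂_{(EuclideanSpace.single (1 : Fin 2) (1 : ℝ) : Plane)} p

/-- `w = F⁻¹[⟨τ - ξ³ + 1/ξ⟩⁻¹ F h]`, where `F h` is a function. -/
def IsInverseModulation (h w : 𝓢'(Plane, ℂ)) : Prop :=
  ∃ q : ℝ × ℝ → ℂ, HasFourierDensity h q ∧
    HasFourierDensity w (fun z => ((jap (modulation z) : ℝ) : ℂ)⁻¹ * q z)

end Ostrovsky

end

noncomputable section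

namespace Ostrovsky

/-! On the Fourier side put F = ⟨ξ⟩^(-3/4) ⟨σ⟩^(1/2) |û| and let G be the same for v. The weighted
output is then dominated by `bil multK F G`, where the square of `multK` is `freqW` divided by the
three modulation weights. The theorem becomes a bound of this operator in the norm `XYn`
(`XYn_bil_multK_le`). Three facts carry it.

Resonance: for ξ = ξ₁ + ξ₂ one has σ - σ₁ - σ₂ = -(3q + e/q) with q = ξ ξ₁ ξ₂ and e = ξ₁² + ξ₁ξ₂ +
ξ₂² ≥ 0. The two terms do not cancel, so the largest modulation is at least |q|, |ξ₁| and |ξ₂|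
(`resonance`).

Frozen integrals: by Cauchy–Schwarz a bilinear operator is bounded on L² as soon as its squared
kernel has a uniformly bounded integral with one of the two inputs or the output frozen. The model
kernel `kr` combines the transversality weight `dd`, the Jacobian of the resonance function, with
bumps of bounded mass placed where `dd` degenerates (`lintegral_kr_le`, `nl2_bil_KV_le`). Where no
power may be lost, `KD` replaces it on a pair of modulation shells (`nl2_bil_KD_le`).

Localization: an L² bound does not control the ℓ¹ sum over modulations in X, nor the L¹ norm in τ in
Y. The pointwise bounds therefore carry an extra factor `rho`, a small power gain away from a
reference modulation, and this gain makes both sums converge (`XYn_le_of_localized`).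

It remains to compare the multiplier with the model kernels regime by regime. `generic_bound` covers
everything except two borderline regions, `IsHighHigh` and `IsLowHigh`. There the structure of X is
used: the ℓ¹ sum over the modulations of a low frequency outside D, the ℓ¹ sums of two comparable
high frequencies, orthogonality between frequency shells, and the fact that D only asks for an L²
norm. The result is the majorant `maj` (`multK_le_majK`, `XYn_maj_le`).

The derivative makes the multiplier vanish at ξ = 0, so this estimate does not give the convergence
of the convolution near ξ = 0. A separate bound with weight |ξ|^(3/4) does (`lintegral_low_lt_top`),
and the product is then a tempered distribution. -/

/-- The `L²` norm of an extended nonnegative function. -/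
def nl2 {α : Type*} {_ : MeasurableSpace α} (F : α → ℝ≥0∞) (μ : Measure α) : ℝ≥0∞ :=
  (∫⁻ x, F x ^ (2 : ℝ) ∂μ) ^ (1 / 2 : ℝ)

/-! ### `L²` norms: duality, Minkowski, Cauchy–Schwarz. -/

section L2

variable {α : Type*} [MeasurableSpace α] {μ : Measure α}

lemma nl2_sq (F : α → ℝ≥0∞) : nl2 F μ ^ (2 : ℝ) = ∫⁻ x, F x ^ (2 : ℝ) ∂μ := by
  rw [nl2, ← ENNReal.rpow_mul]; norm_num

lemma nl2_mono {F G : α → ℝ≥0∞} (h : ∀ x, F x ≤ G x) : nl2 F μ ≤ nl2 G μ := by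
  unfold nl2; gcongr; exact h _

lemma nl2_mono_ae {F G : α → ℝ≥0∞} (h : ∀ᵐ x ∂μ, F x ≤ G x) : nl2 F μ ≤ nl2 G μ := by
  unfold nl2
  refine ENNReal.rpow_le_rpow (lintegral_mono_ae ?_) (by norm_num)
  filter_upwards [h] with x hx
  gcongr

lemma nl2_const_mul {F : α → ℝ≥0∞} (hF : Measurable F) (c : ℝ≥0∞) :
    nl2 (fun x => c * F x) μ = c * nl2 F μ := by
  unfold nl2
  simp_rw [ENNReal.mul_rpow_of_nonneg _ _ (show (0 : ℝ) ≤ 2 by norm_num)]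
  rw [lintegral_const_mul _ (by fun_prop), ENNReal.mul_rpow_of_nonneg _ _ (by norm_num),
    ← ENNReal.rpow_mul]
  norm_num

lemma nl2_restrict {F : α → ℝ≥0∞} {s : Set α} (hs : MeasurableSet s) :
    nl2 F (μ.restrict s) = nl2 (s.indicator F) μ := by
  unfold nl2
  congr 1
  rw [← lintegral_indicator hs]
  congr 1; ext x
  by_cases hx : x ∈ s <;> simp [hx]

lemma lintegral_mul_le_nl2 {F G : α → ℝ≥0∞} (hF : AEMeasurable F μ) (hG : AEMeasurable G μ) :
    ∫⁻ x, F x * G x ∂μ ≤ nl2 F μ * nl2 G μ :=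
  ENNReal.lintegral_mul_le_Lp_mul_Lq μ Real.HolderConjugate.two_two hF hG

lemma le_of_rpow_two_le_mul {x A : ℝ≥0∞} (hx : x ≠ ∞) (h : x ^ (2 : ℝ) ≤ A * x) : x ≤ A := by
  rcases eq_or_ne x 0 with rfl | h0
  · simp
  · rw [ENNReal.rpow_two, sq] at h
    exact (ENNReal.mul_le_mul_iff_left h0 hx).1 h

/-- Duality for the `L²` norm. -/
lemma nl2_le_of_dual [SigmaFinite μ] {F : α → ℝ≥0∞} (hF : Measurable F) {A : ℝ≥0∞}
    (h : ∀ H : α → ℝ≥0∞, Measurable H → ∫⁻ x, F x * H x ∂μ ≤ A * nl2 H μ) : nl2 F μ ≤ A := by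
  -- Truncation in space and height makes the norm finite, so that testing against the truncated
  -- function and cancelling one factor is allowed; monotone convergence removes it.
  set S := spanningSets μ
  let Fn : ℕ → α → ℝ≥0∞ := fun n => (S n).indicator (fun x => min (F x) n)
  have hFm : ∀ n, Measurable (Fn n) := fun n =>
    (hF.min measurable_const).indicator (measurableSet_spanningSets μ n)
  have hle : ∀ n x, Fn n x ≤ F x := fun n x => by
    by_cases hx : x ∈ S n <;> simp [Fn, hx]
  have hn : ∀ n, nl2 (Fn n) μ ≤ A := by
    intro n
    apply le_of_rpow_two_le_mul
    · have : ∫⁻ x, Fn n x ^ (2 : ℝ) ∂μ < ∞ := by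
        calc ∫⁻ x, Fn n x ^ (2 : ℝ) ∂μ
            ≤ ∫⁻ x, (S n).indicator (fun _ => (n : ℝ≥0∞) ^ (2 : ℝ)) x ∂μ := by
              apply lintegral_mono; intro x
              by_cases hx : x ∈ S n
              · simp only [Fn, hx, Set.indicator_of_mem]
                exact ENNReal.rpow_le_rpow (min_le_right _ _) (by norm_num)
              · simp [Fn, hx]
          _ = (n : ℝ≥0∞) ^ (2 : ℝ) * μ (S n) := by
              rw [lintegral_indicator (measurableSet_spanningSets μ n)]; simp [S]
          _ < ∞ := ENNReal.mul_lt_top (by simp) (measure_spanningSets_lt_top μ n)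
      unfold nl2
      exact (ENNReal.rpow_lt_top_of_nonneg (by norm_num) this.ne).ne
    · rw [nl2_sq]
      refine le_trans (lintegral_mono fun x => ?_) (h _ (hFm n))
      rw [ENNReal.rpow_two, sq]
      gcongr
      exact hle n x
  have hmono : Monotone Fn := by
    intro m n hmn x
    by_cases hx : x ∈ S m
    · have hx' : x ∈ S n := monotone_spanningSets μ hmn hx
      simp only [Fn, hx, hx', Set.indicator_of_mem]
      gcongr
    · simp [Fn, hx]
  have hsup : ∀ x, ⨆ n, Fn n x = F x := by
    intro x
    apply le_antisymm (iSup_le fun n => hle n x)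
    obtain ⟨m, hm⟩ : ∃ m, x ∈ S m := by
      have := iUnion_spanningSets μ
      have hx : x ∈ ⋃ i, S i := by rw [this]; trivial
      simpa using hx
    have key : ∀ n : ℕ, min (F x) n ≤ ⨆ n, Fn n x := by
      intro n
      refine le_trans ?_ (le_iSup _ (max m n))
      have hx' : x ∈ S (max m n) := monotone_spanningSets μ (le_max_left _ _) hm
      simp only [Fn, hx', Set.indicator_of_mem]
      gcongr
      exact le_max_right _ _
    have h1 : ⨆ n : ℕ, min (F x) (n : ℝ≥0∞) = F x := by
      have := inf_iSup_eq (F x) (fun n : ℕ => (n : ℝ≥0∞))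
      rw [ENNReal.iSup_natCast] at this
      simpa using this.symm
    rw [← h1]; exact iSup_le key
  have : ∫⁻ x, F x ^ (2 : ℝ) ∂μ ≤ A ^ (2 : ℝ) := by
    have e : ∀ x, F x ^ (2 : ℝ) = ⨆ n, Fn n x ^ (2 : ℝ) := by
      intro x
      rw [← hsup x]
      exact (ENNReal.orderIsoRpow 2 (by norm_num)).map_iSup _
    simp_rw [e]
    rw [lintegral_iSup (fun n => (hFm n).pow_const _)
      (fun m n hmn x => ENNReal.rpow_le_rpow (hmono hmn x) (by norm_num))]
    refine iSup_le fun n => ?_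
    rw [← nl2_sq]
    exact ENNReal.rpow_le_rpow (hn n) (by norm_num)
  unfold nl2
  calc _ ≤ (A ^ (2 : ℝ)) ^ (1 / 2 : ℝ) := ENNReal.rpow_le_rpow this (by norm_num)
    _ = A := by rw [← ENNReal.rpow_mul]; norm_num

/-- Countable Minkowski by duality: against a test function the sum leaves the integral, and each
term is a Cauchy–Schwarz. -/
lemma nl2_tsum_le [SigmaFinite μ] {ι : Type*} [Countable ι] {F : ι → α → ℝ≥0∞}
    (hF : ∀ i, Measurable (F i)) : nl2 (fun x => ∑' i, F i x) μ ≤ ∑' i, nl2 (F i) μ := by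
  apply nl2_le_of_dual (Measurable.tsum hF)
  intro H hH
  simp_rw [← ENNReal.tsum_mul_right]
  rw [lintegral_tsum fun i => (show Measurable fun x => F i x * H x by have := hF i; fun_prop).aemeasurable]
  exact ENNReal.tsum_le_tsum fun i => lintegral_mul_le_nl2 (hF i).aemeasurable hH.aemeasurable

lemma nl2_add_le [SigmaFinite μ] {F G : α → ℝ≥0∞} (hF : Measurable F) (hG : Measurable G) :
    nl2 (fun x => F x + G x) μ ≤ nl2 F μ + nl2 G μ := by
  have := nl2_tsum_le (μ := μ) (F := fun b : Bool => if b then F else G)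
    (by intro b; cases b <;> simpa)
  simpa [tsum_fintype] using this

lemma ell2_tsum_le {ι : Type*} [Countable ι] (a : ι → ℕ → ℝ≥0∞) :
    (∑' j, (∑' i, a i j) ^ (2 : ℝ)) ^ (1 / 2 : ℝ) ≤
      ∑' i, (∑' j, a i j ^ (2 : ℝ)) ^ (1 / 2 : ℝ) := by
  have := nl2_tsum_le (μ := (Measure.count : Measure ℕ)) (F := a) (fun i => measurable_of_countable _)
  simpa [nl2, lintegral_count] using this

lemma tsum_mul_le_ell2 (a b : ℕ → ℝ≥0∞) :
    ∑' j, a j * b j ≤ (∑' j, a j ^ (2 : ℝ)) ^ (1 / 2 : ℝ) * (∑' j, b j ^ (2 : ℝ)) ^ (1 / 2 : ℝ) := by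
  have := lintegral_mul_le_nl2 (μ := (Measure.count : Measure ℕ)) (F := a) (G := b)
    (measurable_of_countable _).aemeasurable (measurable_of_countable _).aemeasurable
  simpa [nl2, lintegral_count] using this

end L2

/-! ### Bilinear operators bounded by freezing one variable. -/

section Bilinear

/-- The bilinear operator with kernel `k`. -/
def bil (k : ℝ × ℝ → ℝ × ℝ → ℝ≥0∞) (F G : ℝ × ℝ → ℝ≥0∞) (z : ℝ × ℝ) : ℝ≥0∞ :=
  ∫⁻ z₁, k z₁ (z - z₁) * F z₁ * G (z - z₁)

variable {k : ℝ × ℝ → ℝ × ℝ → ℝ≥0∞} {F G : ℝ × ℝ → ℝ≥0∞}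

lemma measurable_bil (hk : Measurable (Function.uncurry k)) (hF : Measurable F)
    (hG : Measurable G) : Measurable (bil k F G) := by
  unfold bil
  apply Measurable.lintegral_prod_right'
    (f := fun w : (ℝ × ℝ) × (ℝ × ℝ) => k w.2 (w.1 - w.2) * F w.2 * G (w.1 - w.2))
  have : Measurable fun w : (ℝ × ℝ) × (ℝ × ℝ) => k w.2 (w.1 - w.2) :=
    hk.comp (measurable_snd.prodMk (measurable_fst.sub measurable_snd))
  fun_prop

/-- Testing and substituting `z = z₁ + z₂` gives a trilinear form with `z₁` outermost, ready to be
frozen. -/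
lemma lintegral_bil_mul (hk : Measurable (Function.uncurry k)) (hF : Measurable F)
    (hG : Measurable G) {H : ℝ × ℝ → ℝ≥0∞} (hH : Measurable H) :
    ∫⁻ z, bil k F G z * H z = ∫⁻ z₁, F z₁ * ∫⁻ z₂, k z₁ z₂ * (G z₂ * H (z₁ + z₂)) := by
  have h1 : Measurable fun w : (ℝ × ℝ) × (ℝ × ℝ) => k w.2 (w.1 - w.2) :=
    hk.comp (measurable_snd.prodMk (measurable_fst.sub measurable_snd))
  have h2 : ∀ z₁, Measurable (k z₁) := fun z₁ => hk.comp (measurable_const.prodMk measurable_id)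
  unfold bil
  have : ∀ z, (∫⁻ z₁, k z₁ (z - z₁) * F z₁ * G (z - z₁)) * H z
      = ∫⁻ z₁, k z₁ (z - z₁) * F z₁ * G (z - z₁) * H z := by
    intro z
    rw [lintegral_mul_const]
    exact Measurable.of_uncurry_left (f := fun z z₁ => k z₁ (z - z₁) * F z₁ * G (z - z₁))
      (by simp only [Function.uncurry_def]; fun_prop)
  simp_rw [this]
  rw [lintegral_lintegral_swap (by simp only [Function.uncurry_def]; fun_prop)]
  congr 1; ext z₁
  rw [← lintegral_const_mul _ (by have := h2 z₁; fun_prop)]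
  rw [← lintegral_add_left_eq_self _ z₁]
  congr 1; ext z₂
  simp only [add_sub_cancel_left]
  ring

lemma rpow_half_two (x : ℝ≥0∞) : (x ^ (1 / 2 : ℝ)) ^ (2 : ℝ) = x := by
  rw [← ENNReal.rpow_mul]; norm_num

/-- Bound for a bilinear operator with a kernel that is uniformly square integrable in the
second input variable when the first one is frozen. -/
lemma nl2_bil_le_left (hk : Measurable (Function.uncurry k)) (hF : Measurable F)
    (hG : Measurable G) {A : ℝ≥0∞} (h : ∀ z₁, nl2 (k z₁) volume ≤ A) :
    nl2 (bil k F G) volume ≤ A * nl2 F volume * nl2 G volume := by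
  apply nl2_le_of_dual (measurable_bil hk hF hG)
  intro H hH
  rw [lintegral_bil_mul hk hF hG hH]
  have h2 : ∀ z₁, Measurable (k z₁) := fun z₁ => hk.comp (measurable_const.prodMk measurable_id)
  have hm : Measurable fun z₁ => nl2 (fun z₂ => G z₂ * H (z₁ + z₂)) volume := by
    unfold nl2
    refine Measurable.pow_const ?_ _
    exact Measurable.lintegral_prod_right'
      (f := fun w : (ℝ × ℝ) × (ℝ × ℝ) => (G w.2 * H (w.1 + w.2)) ^ (2 : ℝ)) (by fun_prop)
  calc ∫⁻ z₁, F z₁ * ∫⁻ z₂, k z₁ z₂ * (G z₂ * H (z₁ + z₂))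
      ≤ ∫⁻ z₁, A * (F z₁ * nl2 (fun z₂ => G z₂ * H (z₁ + z₂)) volume) := by
        apply lintegral_mono; intro z₁
        calc _ ≤ F z₁ * (A * nl2 (fun z₂ => G z₂ * H (z₁ + z₂)) volume) := by
              refine mul_le_mul_right ?_ _
              exact (lintegral_mul_le_nl2 (h2 z₁).aemeasurable
                (by fun_prop)).trans (mul_le_mul_left (h z₁) _)
          _ = _ := by ring
    _ = A * ∫⁻ z₁, F z₁ * nl2 (fun z₂ => G z₂ * H (z₁ + z₂)) volume := by
        rw [lintegral_const_mul _ (by fun_prop)]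
    _ ≤ A * (nl2 F volume * nl2 (fun z₁ => nl2 (fun z₂ => G z₂ * H (z₁ + z₂)) volume) volume) := by
        gcongr
        exact lintegral_mul_le_nl2 hF.aemeasurable hm.aemeasurable
    -- By Fubini and translation invariance the double integral of `(G z₂ * H (z₁ + z₂))²` factors.
    _ = A * (nl2 F volume * (nl2 G volume * nl2 H volume)) := by
        congr 2
        conv_lhs => unfold nl2
        simp_rw [rpow_half_two]
        unfold nl2
        rw [← ENNReal.mul_rpow_of_nonneg _ _ (by norm_num)]
        congr 1
        rw [lintegral_lintegral_swap (by fun_prop)]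
        rw [← lintegral_mul_const _ (by fun_prop)]
        congr 1; ext z₂
        simp_rw [ENNReal.mul_rpow_of_nonneg _ _ (show (0 : ℝ) ≤ 2 by norm_num)]
        rw [lintegral_const_mul _ (by fun_prop),
          lintegral_add_right_eq_self (fun z => H z ^ (2 : ℝ))]
    _ = _ := by ring

lemma bil_swap (z : ℝ × ℝ) : bil k F G z = bil (fun z₁ z₂ => k z₂ z₁) G F z := by
  unfold bil
  rw [← lintegral_sub_left_eq_self _ z]
  congr 1; ext z₁
  simp only [sub_sub_cancel]; ring

lemma nl2_bil_le_right (hk : Measurable (Function.uncurry k)) (hF : Measurable F)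
    (hG : Measurable G) {A : ℝ≥0∞} (h : ∀ z₂, nl2 (fun z₁ => k z₁ z₂) volume ≤ A) :
    nl2 (bil k F G) volume ≤ A * nl2 F volume * nl2 G volume := by
  rw [show bil k F G = bil (fun z₁ z₂ => k z₂ z₁) G F from funext bil_swap]
  have := nl2_bil_le_left (k := fun z₁ z₂ => k z₂ z₁) (hk.comp measurable_swap) hG hF h
  refine this.trans (le_of_eq (by ring))

/-- With the output frozen no duality is needed: Cauchy–Schwarz in `z₁` for each `z`, then Fubini.
-/
lemma nl2_bil_le_out (hk : Measurable (Function.uncurry k)) (hF : Measurable F)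
    (hG : Measurable G) {A : ℝ≥0∞} (h : ∀ z, nl2 (fun z₁ => k z₁ (z - z₁)) volume ≤ A) :
    nl2 (bil k F G) volume ≤ A * nl2 F volume * nl2 G volume := by
  have key : ∀ z, bil k F G z ≤ A * nl2 (fun z₁ => F z₁ * G (z - z₁)) volume := by
    intro z
    unfold bil
    simp_rw [mul_assoc]
    have h1 : Measurable fun z₁ => k z₁ (z - z₁) :=
      hk.comp (measurable_id.prodMk (measurable_const.sub measurable_id))
    exact (lintegral_mul_le_nl2 h1.aemeasurable (by fun_prop)).trans (mul_le_mul_left (h z) _)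
  have hm : Measurable fun z => nl2 (fun z₁ => F z₁ * G (z - z₁)) volume := by
    unfold nl2
    refine Measurable.pow_const ?_ _
    exact Measurable.lintegral_prod_right'
      (f := fun w : (ℝ × ℝ) × (ℝ × ℝ) => (F w.2 * G (w.1 - w.2)) ^ (2 : ℝ)) (by fun_prop)
  refine (nl2_mono key).trans ?_
  rw [nl2_const_mul hm, mul_assoc]
  gcongr
  apply le_of_eq
  conv_lhs => unfold nl2
  simp_rw [rpow_half_two]
  unfold nl2
  rw [← ENNReal.mul_rpow_of_nonneg _ _ (by norm_num)]
  congr 1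
  rw [lintegral_lintegral_swap (by fun_prop)]
  rw [← lintegral_mul_const _ (by fun_prop)]
  congr 1; ext z₂
  simp_rw [ENNReal.mul_rpow_of_nonneg _ _ (show (0 : ℝ) ≤ 2 by norm_num)]
  rw [lintegral_const_mul _ (by fun_prop), lintegral_sub_right_eq_self (fun z => G z ^ (2 : ℝ))]

end Bilinear

/-! ### The Japanese bracket and the modulation weight. -/

section Jap

lemma one_le_jap (a : ℝ) : 1 ≤ jap a := by
  unfold jap; rw [Real.one_le_sqrt]; nlinarith [sq_nonneg a]

lemma jap_pos (a : ℝ) : 0 < jap a := zero_lt_one.trans_le (one_le_jap a)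

lemma jap_sq (a : ℝ) : jap a ^ 2 = 1 + a ^ 2 := Real.sq_sqrt (by positivity)

lemma abs_le_jap (a : ℝ) : |a| ≤ jap a := by
  apply Real.abs_le_sqrt; linarith

lemma jap_neg (a : ℝ) : jap (-a) = jap a := by simp [jap]

lemma jap_le_one_add_abs (a : ℝ) : jap a ≤ 1 + |a| := by
  unfold jap
  rw [Real.sqrt_le_left (by positivity)]
  nlinarith [abs_nonneg a, sq_abs a]

lemma jap_le_jap {a b : ℝ} (h : |a| ≤ |b|) : jap a ≤ jap b := by
  unfold jap
  apply Real.sqrt_le_sqrt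
  have := sq_le_sq.2 h
  linarith

lemma jap_add_le (a b : ℝ) : jap (a + b) ≤ jap a + jap b := by
  have h1 : jap (a + b) ≤ jap a + |b| := by
    have := abs_le_jap a
    have h2 := jap_pos a
    have h3 := jap_sq a
    nth_rewrite 1 [jap]
    rw [Real.sqrt_le_left (by positivity)]
    have h4 : a * b ≤ jap a * |b| := by
      calc a * b ≤ |a * b| := le_abs_self _
        _ = |a| * |b| := abs_mul _ _
        _ ≤ _ := by gcongr
    nlinarith [sq_abs b]
  linarith [abs_le_jap b]

lemma jap_sub_le (a b : ℝ) : jap (a - b) ≤ jap a + jap b := by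
  have := jap_add_le a (-b); rwa [jap_neg, ← sub_eq_add_neg] at this

lemma continuous_jap : Continuous jap := by unfold jap; fun_prop

@[fun_prop]
lemma measurable_jap : Measurable jap := continuous_jap.measurable

@[fun_prop]
lemma measurable_modulation : Measurable modulation := by unfold modulation; fun_prop

/-- The modulation weight `⟨τ - ξ³ + 1/ξ⟩`. -/
def modW (z : ℝ × ℝ) : ℝ := jap (modulation z)

@[fun_prop]
lemma measurable_modW : Measurable modW := by unfold modW; fun_prop

lemma one_le_modW (z : ℝ × ℝ) : 1 ≤ modW z := one_le_jap _

lemma modW_pos (z : ℝ × ℝ) : 0 < modW z := jap_pos _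

lemma modW_neg (z : ℝ × ℝ) : modW (-z) = modW z := by
  unfold modW
  rw [← jap_neg]; congr 1; simp only [modulation, Prod.fst_neg, Prod.snd_neg]
  rw [one_div, one_div, inv_neg]; ring

end Jap

/-! ### An integrable decay in the modulation, and its convolution. -/

/-- The decay function `a ↦ a^{-17/16}`. -/
def dec (a : ℝ) : ℝ := a ^ (-(17 / 16) : ℝ)

@[fun_prop]
lemma measurable_dec : Measurable dec := by unfold dec; fun_prop

lemma dec_nonneg {a : ℝ} (h : 0 ≤ a) : 0 ≤ dec a := Real.rpow_nonneg h _

lemma dec_pos {a : ℝ} (h : 0 < a) : 0 < dec a := Real.rpow_pos_of_pos h _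

lemma dec_mul {a b : ℝ} (ha : 0 ≤ a) (hb : 0 ≤ b) : dec (a * b) = dec a * dec b :=
  Real.mul_rpow ha hb

lemma dec_anti {a b : ℝ} (ha : 0 < a) (h : a ≤ b) : dec b ≤ dec a :=
  Real.rpow_le_rpow_of_nonpos ha h (by norm_num)

lemma dec_half_le {a : ℝ} (ha : 0 < a) : dec (a / 2) ≤ 4 * dec a := by
  rw [div_eq_mul_inv, mul_comm, dec_mul (by norm_num) ha.le]
  gcongr
  · exact dec_nonneg ha.le
  unfold dec
  rw [Real.inv_rpow (by norm_num), ← Real.rpow_neg (by norm_num)]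
  calc (2 : ℝ) ^ (- -(17 / 16) : ℝ) ≤ 2 ^ (2 : ℝ) :=
        Real.rpow_le_rpow_of_exponent_le (by norm_num) (by norm_num)
    _ = 4 := by norm_num

/-- The integral of `⟨s⟩^{-17/16}`. -/
def decInt : ℝ≥0∞ := ∫⁻ s : ℝ, ENNReal.ofReal (dec (jap s))

lemma decInt_lt_top : decInt < ∞ := by
  have h := integrable_rpow_neg_one_add_norm_sq (E := ℝ) (μ := volume) (r := 17 / 16)
    (by norm_num)
  have : ∀ s : ℝ, dec (jap s) = (1 + ‖s‖ ^ 2) ^ (-(17 / 16) / 2 : ℝ) := by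
    intro s
    unfold dec jap
    rw [Real.sqrt_eq_rpow, ← Real.rpow_mul (by positivity)]
    simp only [Real.norm_eq_abs, sq_abs]
    norm_num
  unfold decInt
  simp_rw [this]
  exact h.lintegral_lt_top

/-- One of the two brackets is at least half of `jap (u - v)`: its decay gives the prefactor, and
the decay of the other is kept for integration. -/
lemma dec_jap_mul_le (u v : ℝ) :
    dec (jap u * jap v) ≤ 4 * dec (jap (u - v)) * (dec (jap u) + dec (jap v)) := by
  rw [dec_mul (jap_pos _).le (jap_pos _).le]
  have h := jap_sub_le u v
  have hu := dec_nonneg (jap_pos u).le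
  have hv := dec_nonneg (jap_pos v).le
  have hp := jap_pos (u - v)
  have hd := dec_half_le hp
  have h0 := dec_nonneg hp.le
  rcases le_total (jap u) (jap v) with h1 | h1
  · have h3 : dec (jap v) ≤ 4 * dec (jap (u - v)) :=
      (dec_anti (by positivity) (by linarith)).trans hd
    nlinarith
  · have h3 : dec (jap u) ≤ 4 * dec (jap (u - v)) :=
      (dec_anti (by positivity) (by linarith)).trans hd
    nlinarith

lemma lintegral_dec_shift (a : ℝ) :
    ∫⁻ s : ℝ, ENNReal.ofReal (dec (jap (s - a))) = decInt :=
  lintegral_sub_right_eq_self (fun s => ENNReal.ofReal (dec (jap s))) a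

lemma lintegral_dec_mul_le (a b : ℝ) :
    ∫⁻ s : ℝ, ENNReal.ofReal (dec (jap (s - a) * jap (s - b))) ≤
      8 * decInt * ENNReal.ofReal (dec (jap (a - b))) := by
  calc ∫⁻ s : ℝ, ENNReal.ofReal (dec (jap (s - a) * jap (s - b)))
      ≤ ∫⁻ s : ℝ, ENNReal.ofReal (4 * dec (jap (a - b))) *
          (ENNReal.ofReal (dec (jap (s - a))) + ENNReal.ofReal (dec (jap (s - b)))) := by
        apply lintegral_mono; intro s
        have h := dec_jap_mul_le (s - a) (s - b)
        dsimp only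
        rw [← ENNReal.ofReal_add (dec_nonneg (jap_pos _).le) (dec_nonneg (jap_pos _).le),
          ← ENNReal.ofReal_mul (by have := dec_nonneg (jap_pos (a - b)).le; positivity)]
        apply ENNReal.ofReal_le_ofReal
        rw [show s - a - (s - b) = -(a - b) by ring, jap_neg] at h
        exact h
    _ = _ := by
        rw [lintegral_const_mul _ (by fun_prop), lintegral_add_left (by fun_prop),
          lintegral_dec_shift, lintegral_dec_shift,
          ENNReal.ofReal_mul (by norm_num)]
        simp only [ENNReal.ofReal_ofNat]
        ring

/-! ### Changes of variables in the dispersion relation and the resonance function. -/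

section ChangeOfVariables

/-- The dispersion relation. -/
def phi (x : ℝ) : ℝ := x ^ 3 - 1 / x

/-- The transversality weight `|φ'(a) - φ'(b)|`. -/
def dd (a b : ℝ) : ℝ := |a ^ 2 - b ^ 2| * |3 - 1 / (a * b) ^ 2|

lemma dd_nonneg (a b : ℝ) : 0 ≤ dd a b := by unfold dd; positivity

lemma dd_comm (a b : ℝ) : dd a b = dd b a := by
  unfold dd; rw [abs_sub_comm, mul_comm a b]

lemma dd_neg_right (a b : ℝ) : dd a (-b) = dd a b := by
  unfold dd; simp

lemma modulation_eq (z : ℝ × ℝ) : modulation z = z.1 - phi z.2 := by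
  unfold modulation phi; ring

@[fun_prop]
lemma measurable_phi : Measurable phi := by unfold phi; fun_prop

lemma hasDerivAt_phi {x : ℝ} (hx : x ≠ 0) : HasDerivAt phi (3 * x ^ 2 + 1 / x ^ 2) x := by
  unfold phi
  have h1 : HasDerivAt (fun x : ℝ => x ^ 3) (3 * x ^ 2) x := by
    simpa using hasDerivAt_pow 3 x
  have h2 := hasDerivAt_inv hx
  have h3 := h1.sub h2
  simp only [one_div]
  exact h3.congr_deriv (by ring)

/-- On each half-line `phi` is injective with derivative at least `3 y²`; the two half-lines give
the factor 2. -/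
lemma lintegral_deriv_phi_mul_le (c : ℝ) (g : ℝ → ℝ≥0∞) :
    ∫⁻ y, ENNReal.ofReal (3 * (y + c) ^ 2) * g (phi (y + c)) ≤ 2 * ∫⁻ u, g u := by
  rw [lintegral_add_right_eq_self (fun y => ENNReal.ofReal (3 * y ^ 2) * g (phi y)) c]
  have key : ∀ s : Set ℝ, MeasurableSet s → (∀ y ∈ s, y ≠ 0) →
      (∀ y ∈ s, ∀ y' ∈ s, 0 < y * y') →
      ∫⁻ y in s, ENNReal.ofReal (3 * y ^ 2) * g (phi y) ≤ ∫⁻ u, g u := by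
    intro s hs h0 hpos
    have hinj : Set.InjOn phi s := by
      intro y hy y' hy' h
      have h1 := h0 y hy
      have h2 := h0 y' hy'
      have h3 := hpos y hy y' hy'
      by_contra hne
      have h4 : y - y' ≠ 0 := sub_ne_zero.2 hne
      unfold phi at h
      have : (y - y') * (y ^ 2 + y * y' + y' ^ 2 + 1 / (y * y')) = 0 := by
        field_simp at h ⊢
        linear_combination h
      rcases mul_eq_zero.1 this with h5 | h5
      · exact h4 h5
      · have : 0 < 1 / (y * y') := by positivity
        nlinarith [sq_nonneg (y), sq_nonneg y']
    have := lintegral_image_eq_lintegral_abs_deriv_mul hs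
      (fun y hy => (hasDerivAt_phi (h0 y hy)).hasDerivWithinAt) hinj g
    calc _ ≤ ∫⁻ y in s, ENNReal.ofReal |3 * y ^ 2 + 1 / y ^ 2| * g (phi y) := by
          apply lintegral_mono; intro y
          dsimp only
          gcongr
          refine le_trans ?_ (le_abs_self _)
          have : 0 ≤ 1 / y ^ 2 := by positivity
          linarith
      _ = ∫⁻ u in phi '' s, g u := this.symm
      _ ≤ _ := setLIntegral_le_lintegral _ _
  have hcov : (Set.univ : Set ℝ) = (Set.Ioi 0 ∪ Set.Iio 0) ∪ {0} := by
    ext y; rcases lt_trichotomy y 0 with h | h | h <;> simp [h, eq_or_ne]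
  rw [← setLIntegral_univ, hcov]
  refine (lintegral_union_le _ _ _).trans ?_
  rw [Measure.restrict_singleton]
  simp only [Real.volume_singleton, zero_smul, lintegral_zero_measure, add_zero]
  refine (lintegral_union_le _ _ _).trans ?_
  rw [two_mul]
  refine add_le_add (key _ measurableSet_Ioi ?_ ?_) (key _ measurableSet_Iio ?_ ?_)
  · intro y hy; exact (Set.mem_Ioi.1 hy).ne'
  · intro y hy y' hy'; exact mul_pos hy hy'
  · intro y hy; exact (Set.mem_Iio.1 hy).ne
  · intro y hy y' hy'; exact mul_pos_of_neg_of_neg hy hy'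

/-- Change of variables for the resonance function, with `8` cells of injectivity. -/
lemma lintegral_dd_mul_le (x : ℝ) (g : ℝ → ℝ≥0∞) :
    ∫⁻ y, ENNReal.ofReal (dd y (y + x)) * g (phi (y + x) - phi y) ≤ 8 * ∫⁻ u, g u := by
  rcases eq_or_ne x 0 with rfl | hx
  · simp [dd]
  set χ : ℝ → ℝ := fun y => phi (y + x) - phi y with hχ
  -- The resonance function depends on `y` only through `q = y (y + x)`, by way of `3 q + 1 / q`.
  -- Injectivity splits accordingly.
  have hformula : ∀ y, y * (y + x) ≠ 0 →
      χ y = x ^ 3 + x * (3 * (y * (y + x)) + 1 / (y * (y + x))) := by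
    intro y hy
    obtain ⟨h1, h2⟩ := mul_ne_zero_iff.1 hy
    simp only [hχ, phi]; field_simp; ring
  have key : ∀ s : Set ℝ, MeasurableSet s → (∀ y ∈ s, y * (y + x) ≠ 0) →
      (∀ y ∈ s, ∀ y' ∈ s, y + y' + x ≠ 0) →
      (∀ y ∈ s, ∀ y' ∈ s, 3 * ((y * (y + x)) * (y' * (y' + x))) ≠ 1) →
      ∫⁻ y in s, ENNReal.ofReal (dd y (y + x)) * g (χ y) ≤ ∫⁻ u, g u := by
    intro s hs h0 h1 h2
    have hinj : Set.InjOn χ s := by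
      intro y hy y' hy' h
      rw [hformula y (h0 y hy), hformula y' (h0 y' hy')] at h
      have e1 := h0 y hy
      have e2 := h0 y' hy'
      have e3 := h1 y hy y' hy'
      have e4 := h2 y hy y' hy'
      have h5 : 3 * (y * (y + x)) + 1 / (y * (y + x)) =
          3 * (y' * (y' + x)) + 1 / (y' * (y' + x)) := by
        have := add_left_cancel h
        exact mul_left_cancel₀ hx this
      have h6 : (y - y') * ((y + y' + x) *
          (3 * ((y * (y + x)) * (y' * (y' + x))) - 1)) = 0 := by
        set q := y * (y + x) with hq
        set q' := y' * (y' + x) with hq'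
        have h7 : (q - q') * (3 * (q * q') - 1) = 0 := by
          field_simp at h5; linear_combination h5
        have h8 : q - q' = (y - y') * (y + y' + x) := by rw [hq, hq']; ring
        rw [h8] at h7; linear_combination h7
      have h9 := (mul_eq_zero.1 h6).resolve_right
        (mul_ne_zero e3 (sub_ne_zero.2 e4))
      linarith
    have hder : ∀ y ∈ s, HasDerivWithinAt χ
        ((3 * (y + x) ^ 2 + 1 / (y + x) ^ 2) - (3 * y ^ 2 + 1 / y ^ 2)) s y := by
      intro y hy
      obtain ⟨e1, e2⟩ := mul_ne_zero_iff.1 (h0 y hy)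
      exact (((hasDerivAt_phi e2).comp_add_const y x).sub (hasDerivAt_phi e1)).hasDerivWithinAt
    have := lintegral_image_eq_lintegral_abs_deriv_mul hs hder hinj g
    calc _ = ∫⁻ y in s, ENNReal.ofReal
          |(3 * (y + x) ^ 2 + 1 / (y + x) ^ 2) - (3 * y ^ 2 + 1 / y ^ 2)| * g (χ y) := by
          apply setLIntegral_congr_fun hs; intro y hy
          obtain ⟨e1, e2⟩ := mul_ne_zero_iff.1 (h0 y hy)
          dsimp only
          congr 2
          unfold dd
          rw [← abs_mul, ← abs_neg]
          congr 1
          field_simp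
          ring
      _ = ∫⁻ u in χ '' s, g u := this.symm
      _ ≤ _ := setLIntegral_le_lintegral _ _
  -- The cells are given by the sign of `q' = 2 y + x`, the sign of `q`, and the side of the
  -- critical points `3 q² = 1`: eight in all.
  let q : ℝ → ℝ := fun y => y * (y + x)
  let P : Bool → Set ℝ := fun b => if b then {y | 0 < 2 * y + x} else {y | 2 * y + x < 0}
  let Q : Bool → Set ℝ := fun b => if b then {y | 0 < q y} else {y | q y < 0}
  let R : Bool → Set ℝ := fun b => if b then {y | 1 < 3 * q y ^ 2} else {y | 3 * q y ^ 2 < 1}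
  have hq : Measurable q := by fun_prop
  have hP : ∀ b, MeasurableSet (P b) := by
    rintro (_ | _)
    · exact measurableSet_lt (by fun_prop) (by fun_prop)
    · exact measurableSet_lt (by fun_prop) (by fun_prop)
  have hQ : ∀ b, MeasurableSet (Q b) := by
    rintro (_ | _)
    · exact measurableSet_lt (by fun_prop) (by fun_prop)
    · exact measurableSet_lt (by fun_prop) (by fun_prop)
  have hR : ∀ b, MeasurableSet (R b) := by
    rintro (_ | _)
    · exact measurableSet_lt (by fun_prop) (by fun_prop)
    · exact measurableSet_lt (by fun_prop) (by fun_prop)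
  have hmeas : ∀ b : Bool × Bool × Bool, MeasurableSet (P b.1 ∩ Q b.2.1 ∩ R b.2.2) :=
    fun b => ((hP _).inter (hQ _)).inter (hR _)
  -- Whatever the cells miss has weight zero or is one of the two poles.
  let Z : Set ℝ := {y | dd y (y + x) = 0}
  have hZ : MeasurableSet Z := by
    apply measurableSet_eq_fun _ measurable_const
    unfold dd; fun_prop
  have hcov : (Set.univ : Set ℝ) =
      (⋃ b : Bool × Bool × Bool, P b.1 ∩ Q b.2.1 ∩ R b.2.2) ∪ (Z ∪ ({0} ∪ {-x})) := by
    symm; rw [Set.eq_univ_iff_forall]; intro y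
    by_cases hn : y = 0 ∨ y = -x
    · right; right; simpa [or_comm] using hn
    obtain ⟨hy1, hy2⟩ := not_or.1 hn
    have hy0 : q y ≠ 0 := mul_ne_zero hy1 (fun h => hy2 (by linarith))
    by_cases hz : dd y (y + x) = 0
    · right; left; exact hz
    have hz1 : 2 * y + x ≠ 0 := by
      intro h; apply hz; unfold dd
      rw [show y ^ 2 - (y + x) ^ 2 = -x * (2 * y + x) by ring, h]; simp
    have hz2 : 3 * q y ^ 2 ≠ 1 := by
      intro h; apply hz; unfold dd
      have : 3 - 1 / (y * (y + x)) ^ 2 = 0 := by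
        have e : (y * (y + x)) ^ 2 = 1 / 3 := by
          have : q y ^ 2 = 1 / 3 := by linarith
          exact this
        rw [e]; norm_num
      rw [this]; simp
    left
    have h1 : ∃ b, y ∈ P b := by
      rcases lt_or_gt_of_ne hz1 with h | h
      · exact ⟨false, by simpa [P] using h⟩
      · exact ⟨true, by simpa [P] using h⟩
    have h2 : ∃ b, y ∈ Q b := by
      rcases lt_or_gt_of_ne hy0 with h | h
      · exact ⟨false, by simpa [Q] using h⟩
      · exact ⟨true, by simpa [Q] using h⟩
    have h3 : ∃ b, y ∈ R b := by
      rcases lt_or_gt_of_ne hz2 with h | h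
      · exact ⟨false, by simpa [R] using h⟩
      · exact ⟨true, by simpa [R] using h⟩
    obtain ⟨b1, h1⟩ := h1
    obtain ⟨b2, h2⟩ := h2
    obtain ⟨b3, h3⟩ := h3
    exact Set.mem_iUnion.2 ⟨(b1, b2, b3), ⟨h1, h2⟩, h3⟩
  have hcell : ∀ b : Bool × Bool × Bool, ∫⁻ y in P b.1 ∩ Q b.2.1 ∩ R b.2.2,
      ENNReal.ofReal (dd y (y + x)) * g (χ y) ≤ ∫⁻ u, g u := by
    intro b
    have hqpos : ∀ y ∈ P b.1 ∩ Q b.2.1 ∩ R b.2.2, ∀ y' ∈ P b.1 ∩ Q b.2.1 ∩ R b.2.2,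
        0 < q y * q y' := by
      rintro y ⟨⟨-, h⟩, -⟩ y' ⟨⟨-, h'⟩, -⟩
      rcases b with ⟨b1, b2 | b2, b3⟩
      · exact mul_pos_of_neg_of_neg (by simpa [Q] using h) (by simpa [Q] using h')
      · exact mul_pos (by simpa [Q] using h) (by simpa [Q] using h')
    apply key _ (hmeas b)
    · intro y hy h
      have h1 := hqpos y hy y hy
      have h2 : q y = 0 := h
      rw [h2] at h1; simp at h1
    · rintro y ⟨⟨h, -⟩, -⟩ y' ⟨⟨h', -⟩, -⟩
      rcases b with ⟨b1 | b1, b2, b3⟩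
      · simp [P] at h h'; intro; linarith
      · simp [P] at h h'; intro; linarith
    · intro y hy y' hy' h0
      have h1 := hqpos y hy y' hy'
      have h2 : 3 * (q y * q y') = 1 := h0
      have h := hy.2
      have h' := hy'.2
      rcases b with ⟨b1, b2, b3 | b3⟩
      · simp only [R, Bool.false_eq_true, if_false, Set.mem_ofPred_eq] at h h'
        nlinarith [sq_nonneg (q y - q y')]
      · simp only [R, if_true, Set.mem_ofPred_eq] at h h'
        have h4 : 1 < (3 * q y ^ 2) * (3 * q y' ^ 2) := by nlinarith
        have h5 : (3 * q y ^ 2) * (3 * q y' ^ 2) = (3 * (q y * q y')) ^ 2 := by ring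
        rw [h5, h2] at h4; norm_num at h4
  have hZ0 : ∫⁻ y in Z, ENNReal.ofReal (dd y (y + x)) * g (χ y) = 0 := by
    rw [setLIntegral_congr_fun hZ (g := fun _ => 0)]
    · simp
    · intro y hy
      have : dd y (y + x) = 0 := hy
      simp [this]
  rw [← setLIntegral_univ, hcov]
  refine (lintegral_union_le _ _ _).trans ?_
  have h2 : ∫⁻ y in Z ∪ ({0} ∪ {-x}), ENNReal.ofReal (dd y (y + x)) * g (χ y) ≤ 0 := by
    refine (lintegral_union_le _ _ _).trans ?_
    rw [hZ0, zero_add]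
    refine (lintegral_union_le _ _ _).trans ?_
    rw [Measure.restrict_singleton, Measure.restrict_singleton]
    simp
  refine (add_le_add (lintegral_iUnion_le _ _) h2).trans ?_
  rw [add_zero, tsum_fintype]
  refine (Finset.sum_le_sum fun b _ => hcell b).trans ?_
  simp

end ChangeOfVariables

/-! ### Integrals of the model kernels with one frequency frozen. -/

section FrozenIntegrals

@[fun_prop]
lemma measurable_dd : Measurable fun w : ℝ × ℝ => dd w.1 w.2 := by unfold dd; fun_prop

lemma modW_eq (z : ℝ × ℝ) : modW z = jap (z.1 - phi z.2) := by
  rw [modW, modulation_eq]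

lemma modW_add_eq (z w : ℝ × ℝ) : modW (z + w) = jap (z.1 - (phi (z.2 + w.2) - w.1)) := by
  rw [modW_eq]; congr 1; simp only [Prod.fst_add, Prod.snd_add]; ring

/-- The `τ`-integral leaves the decay in the distance between the two centres, which is the
resonance function up to the shift `z₀.1`. Then `dd` is the Jacobian for the integral in `y`. -/
lemma lintegral_dd_dec_le (z₀ : ℝ × ℝ) :
    ∫⁻ z : ℝ × ℝ, ENNReal.ofReal (dd z.2 (z.2 + z₀.2) * dec (modW z * modW (z + z₀))) ≤
      64 * decInt * decInt := by
  have hm : Measurable fun z : ℝ × ℝ => dd z.2 (z.2 + z₀.2) :=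
    measurable_dd.comp (measurable_snd.prodMk (measurable_snd.add_const _))
  rw [Measure.volume_eq_prod, lintegral_prod_symm' _ (by fun_prop)]
  calc _ ≤ ∫⁻ y, 8 * decInt * (ENNReal.ofReal (dd y (y + z₀.2)) *
          ENNReal.ofReal (dec (jap (z₀.1 - (phi (y + z₀.2) - phi y))))) := by
        apply lintegral_mono; intro y
        simp only [modW_add_eq]
        simp only [modW_eq]
        simp_rw [ENNReal.ofReal_mul (dd_nonneg _ _)]
        rw [lintegral_const_mul _ (by fun_prop)]
        have := lintegral_dec_mul_le (phi y) (phi (y + z₀.2) - z₀.1)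
        rw [show phi y - (phi (y + z₀.2) - z₀.1) = z₀.1 - (phi (y + z₀.2) - phi y) by ring] at this
        calc _ ≤ _ := mul_le_mul_right this _
          _ = _ := by ring
    _ = 8 * decInt * ∫⁻ y, (ENNReal.ofReal (dd y (y + z₀.2)) *
          ENNReal.ofReal (dec (jap (z₀.1 - (phi (y + z₀.2) - phi y))))) := by
        rw [lintegral_const_mul]
        have : Measurable fun y => dd y (y + z₀.2) :=
          measurable_dd.comp (measurable_id.prodMk (measurable_id.add_const _))
        fun_prop
    _ ≤ 8 * decInt * (8 * ∫⁻ u, ENNReal.ofReal (dec (jap (z₀.1 - u)))) := by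
        gcongr
        exact lintegral_dd_mul_le z₀.2 (fun u => ENNReal.ofReal (dec (jap (z₀.1 - u))))
    _ = _ := by
        rw [lintegral_sub_left_eq_self (fun s => ENNReal.ofReal (dec (jap s))) z₀.1, decInt]
        ring

lemma lintegral_mul_dec_modW (V : ℝ → ℝ) (hV : Measurable V) (hV0 : ∀ y, 0 ≤ V y)
    (z₀ : ℝ × ℝ) :
    ∫⁻ z : ℝ × ℝ, ENNReal.ofReal (V z.2 * dec (modW (z + z₀))) =
      decInt * ∫⁻ y, ENNReal.ofReal (V y) := by
  rw [Measure.volume_eq_prod, lintegral_prod_symm' _ (by fun_prop),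
    ← lintegral_const_mul _ (by fun_prop)]
  congr 1; ext y
  simp only [modW_add_eq]
  simp_rw [ENNReal.ofReal_mul (hV0 _)]
  rw [lintegral_const_mul _ (by fun_prop), lintegral_dec_shift, mul_comm]

/-- A bump of width `1 / β` and height `β` located at `|y| = y₀`. -/
def bump (β y₀ y : ℝ) : ℝ := β * dec (jap (β * (|y| - y₀)))

lemma bump_nonneg {β : ℝ} (hβ : 0 ≤ β) (y₀ y : ℝ) : 0 ≤ bump β y₀ y :=
  mul_nonneg hβ (dec_nonneg (jap_pos _).le)

/-- Rescaling by `β` makes the mass independent of `β`; the centres `y₀` and `-y₀` give the factor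
2. -/
lemma lintegral_bump_le {β : ℝ} (hβ : 0 ≤ β) (y₀ : ℝ) :
    ∫⁻ y, ENNReal.ofReal (bump β y₀ y) ≤ 2 * decInt := by
  have key : ∫⁻ y, ENNReal.ofReal (β * dec (jap (β * (y - y₀)))) ≤ decInt := by
    rcases hβ.eq_or_lt with rfl | hβ
    · simp
    have hder : ∀ y ∈ (Set.univ : Set ℝ), HasDerivWithinAt (fun y => β * (y - y₀)) β
        Set.univ y := by
      intro y _
      have := (((hasDerivAt_id y).sub_const y₀).const_mul β).hasDerivWithinAt (s := Set.univ)
      simpa using this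
    have hinj : Set.InjOn (fun y => β * (y - y₀)) Set.univ := by
      intro y _ y' _ h
      have := mul_left_cancel₀ hβ.ne' h
      linarith
    have := lintegral_image_eq_lintegral_abs_deriv_mul MeasurableSet.univ hder hinj
      (fun u => ENNReal.ofReal (dec (jap u)))
    rw [setLIntegral_univ] at this
    simp_rw [ENNReal.ofReal_mul hβ.le]
    rw [abs_of_pos hβ] at this
    rw [← this]
    exact setLIntegral_le_lintegral _ _
  calc ∫⁻ y, ENNReal.ofReal (bump β y₀ y)
      ≤ ∫⁻ y, (ENNReal.ofReal (β * dec (jap (β * (y - y₀)))) +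
          ENNReal.ofReal (β * dec (jap (β * (-y - y₀))))) := by
        apply lintegral_mono; intro y
        dsimp only [bump]
        rcases abs_choice y with h | h <;> rw [h]
        · exact le_self_add
        · exact le_add_self
    _ = _ := lintegral_add_left (by fun_prop) _
    _ ≤ decInt + decInt := by
        refine add_le_add key ?_
        rw [lintegral_neg_eq_self (fun y => ENNReal.ofReal (β * dec (jap (β * (y - y₀)))))]
        exact key
    _ = _ := (two_mul _).symm

/-- The comparison kernel: `x` is the frozen frequency, `y`, `w` are the other two frequencies and
`a`, `b` are their modulation weights. -/
def kr (V : ℝ → ℝ → ℝ) (x y w a b : ℝ) : ℝ :=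
  dd y w * dec (a * b) + (V x y + V x w) * (dec a + dec b)

/-- Transversality handles the `dd` term. In each of the four other products the `τ`-integral of a
single decay factor is `decInt`, and the bump has mass at most `B`. -/
lemma lintegral_kr_le {V : ℝ → ℝ → ℝ} (hV : Measurable (Function.uncurry V))
    (hV0 : ∀ x y, 0 ≤ V x y) {B : ℝ≥0∞} (hB : ∀ x, ∫⁻ y, ENNReal.ofReal (V x y) ≤ B)
    (z₀ : ℝ × ℝ) :
    ∫⁻ z : ℝ × ℝ, ENNReal.ofReal (kr V z₀.2 z.2 (z.2 + z₀.2) (modW z) (modW (z + z₀))) ≤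
      64 * decInt * decInt + 4 * decInt * B := by
  set x := z₀.2
  have hVx : Measurable (V x) := hV.comp (measurable_const.prodMk measurable_id)
  have hVx' : Measurable fun y => V x (y + x) := hVx.comp (measurable_id.add_const _)
  have hdd : Measurable fun z : ℝ × ℝ => dd z.2 (z.2 + x) :=
    measurable_dd.comp (measurable_snd.prodMk (measurable_snd.add_const _))
  have hB' : ∫⁻ y, ENNReal.ofReal (V x (y + x)) ≤ B := by
    rw [lintegral_add_right_eq_self (fun y => ENNReal.ofReal (V x y)) x]; exact hB x
  have d1 : ∀ z, 0 ≤ dec (modW z) := fun z => dec_nonneg (modW_pos z).le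
  have e : ∀ z : ℝ × ℝ, ENNReal.ofReal (kr V x z.2 (z.2 + x) (modW z) (modW (z + z₀))) =
      ENNReal.ofReal (dd z.2 (z.2 + x) * dec (modW z * modW (z + z₀))) +
      ((ENNReal.ofReal (V x z.2 * dec (modW (z + 0))) +
        ENNReal.ofReal (V x z.2 * dec (modW (z + z₀)))) +
       (ENNReal.ofReal (V x (z.2 + x) * dec (modW (z + 0))) +
        ENNReal.ofReal (V x (z.2 + x) * dec (modW (z + z₀))))) := by
    intro z
    have a1 := hV0 x z.2
    have a2 := hV0 x (z.2 + x)
    have a3 := d1 z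
    have a4 := d1 (z + z₀)
    have a5 : 0 ≤ dd z.2 (z.2 + x) * dec (modW z * modW (z + z₀)) :=
      mul_nonneg (dd_nonneg _ _) (dec_nonneg (mul_pos (modW_pos _) (modW_pos _)).le)
    rw [add_zero]
    rw [← ENNReal.ofReal_add (by positivity) (by positivity),
      ← ENNReal.ofReal_add (by positivity) (by positivity),
      ← ENNReal.ofReal_add (by positivity) (by positivity),
      ← ENNReal.ofReal_add a5 (by positivity)]
    congr 1
    unfold kr; ring
  simp_rw [e]
  rw [lintegral_add_left (by fun_prop), lintegral_add_left (by fun_prop),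
    lintegral_add_left (by fun_prop), lintegral_add_left (by fun_prop),
    lintegral_mul_dec_modW _ hVx (hV0 x), lintegral_mul_dec_modW _ hVx (hV0 x),
    lintegral_mul_dec_modW _ hVx' (fun y => hV0 x _),
    lintegral_mul_dec_modW _ hVx' (fun y => hV0 x _)]
  refine add_le_add (lintegral_dd_dec_le z₀) ?_
  calc _ ≤ (decInt * B + decInt * B) + (decInt * B + decInt * B) := by
        gcongr <;> exact hB x
    _ = _ := by ring

lemma measurableSet_shellB (k : ℕ) : MeasurableSet (shellB k) := by
  unfold shellB
  exact (measurableSet_le measurable_const measurable_modW).inter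
    (measurableSet_lt measurable_modW measurable_const)

lemma measurableSet_shellA (j : ℕ) : MeasurableSet (shellA j) := by
  unfold shellA
  have h : Measurable fun p : ℝ × ℝ => jap p.2 := by fun_prop
  exact (measurableSet_le measurable_const h).inter (measurableSet_lt h measurable_const)

/-- The lossless counterpart of `lintegral_dd_dec_le`. A `τ`-slice has length at most `2 min(r₁,
r₂)` and is empty unless the resonance function lies within `r₁ + r₂` of `z₀.1`; the product of
these two lengths is of order `r₁ r₂`, which the shell weights cancel. -/
lemma lintegral_dd_shell_le (z₀ : ℝ × ℝ) (k₁ k₂ : ℕ) :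
    ∫⁻ z : ℝ × ℝ, ENNReal.ofReal (dd z.2 (z.2 + z₀.2)) *
      (ENNReal.ofReal ((2 ^ k₁)⁻¹ * (2 ^ k₂)⁻¹) * ((shellB k₁).indicator 1 z *
        (shellB k₂).indicator 1 (z + z₀))) ≤ 256 := by
  have hdd : Measurable fun z : ℝ × ℝ => dd z.2 (z.2 + z₀.2) :=
    measurable_dd.comp (measurable_snd.prodMk (measurable_snd.add_const _))
  have hdd' : Measurable fun y : ℝ => dd y (y + z₀.2) :=
    measurable_dd.comp (measurable_id.prodMk (measurable_id.add_const _))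
  have hB : ∀ k, Measurable ((shellB k).indicator (1 : ℝ × ℝ → ℝ≥0∞)) := fun k =>
    measurable_one.indicator (measurableSet_shellB k)
  set r₁ : ℝ := 2 ^ (k₁ + 1) with hr₁
  set r₂ : ℝ := 2 ^ (k₂ + 1) with hr₂
  have h1 : 0 < r₁ := by positivity
  have h2 : 0 < r₂ := by positivity
  set c : ℝ≥0∞ := ENNReal.ofReal ((2 ^ k₁)⁻¹ * (2 ^ k₂)⁻¹) with hc
  let g : ℝ → ℝ≥0∞ := (Metric.closedBall z₀.1 (r₁ + r₂)).indicator 1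
  have hg : Measurable g := measurable_one.indicator Metric.isClosed_closedBall.measurableSet
  have hmem : ∀ (k : ℕ) (a τ y : ℝ) (w : ℝ × ℝ), jap (τ - a) = modW w → w ∈ shellB k →
      |τ - a| ≤ 2 ^ (k + 1) := by
    intro k a τ y w h hw
    exact (abs_le_jap _).trans (h ▸ hw.2.le)
  have hinner : ∀ y, ∫⁻ τ, (shellB k₁).indicator 1 (τ, y) *
      (shellB k₂).indicator (1 : ℝ × ℝ → ℝ≥0∞) ((τ, y) + z₀) ≤
      ENNReal.ofReal (2 * min r₁ r₂) * g (phi (y + z₀.2) - phi y) := by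
    intro y
    set a := phi y
    set b := phi (y + z₀.2) - z₀.1 with hb
    by_cases hab : |a - b| ≤ r₁ + r₂
    · have hg1 : g (phi (y + z₀.2) - phi y) = 1 := by
        apply Set.indicator_of_mem
        rw [Metric.mem_closedBall, Real.dist_eq]
        rw [show phi (y + z₀.2) - phi y - z₀.1 = -(a - b) by rw [hb]; ring, abs_neg]
        exact hab
      rw [hg1, mul_one, mul_min_of_nonneg _ _ (by norm_num), ENNReal.ofReal_min]
      apply le_min
      · calc _ ≤ ∫⁻ τ, (Metric.closedBall a r₁).indicator 1 τ := by
              apply lintegral_mono; intro τ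
              dsimp only
              by_cases hw : (τ, y) ∈ shellB k₁
              · have := hmem k₁ a τ y (τ, y) (by rw [modW_eq]) hw
                rw [Set.indicator_of_mem (s := Metric.closedBall a r₁)
                  (by rwa [Metric.mem_closedBall, Real.dist_eq])]
                have e1 : (shellB k₁).indicator (1 : ℝ × ℝ → ℝ≥0∞) (τ, y) ≤ 1 :=
                  Set.indicator_le_self' (by simp) _
                have e2 : (shellB k₂).indicator (1 : ℝ × ℝ → ℝ≥0∞) ((τ, y) + z₀) ≤ 1 :=
                  Set.indicator_le_self' (by simp) _
                exact (mul_le_mul' e1 e2).trans (by simp)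
              · simp [hw]
          _ = _ := by
              rw [lintegral_indicator_one Metric.isClosed_closedBall.measurableSet,
                Real.volume_closedBall]
      · calc _ ≤ ∫⁻ τ, (Metric.closedBall b r₂).indicator 1 τ := by
              apply lintegral_mono; intro τ
              dsimp only
              by_cases hw : (τ, y) + z₀ ∈ shellB k₂
              · have := hmem k₂ b τ y ((τ, y) + z₀) (by rw [modW_add_eq]) hw
                rw [Set.indicator_of_mem (s := Metric.closedBall b r₂)
                  (by rwa [Metric.mem_closedBall, Real.dist_eq])]
                have e1 : (shellB k₁).indicator (1 : ℝ × ℝ → ℝ≥0∞) (τ, y) ≤ 1 :=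
                  Set.indicator_le_self' (by simp) _
                have e2 : (shellB k₂).indicator (1 : ℝ × ℝ → ℝ≥0∞) ((τ, y) + z₀) ≤ 1 :=
                  Set.indicator_le_self' (by simp) _
                exact (mul_le_mul' e1 e2).trans (by simp)
              · simp only [Set.indicator_of_notMem hw, mul_zero]; exact zero_le
          _ = _ := by
              rw [lintegral_indicator_one Metric.isClosed_closedBall.measurableSet,
                Real.volume_closedBall]
    · have : ∀ τ, (shellB k₁).indicator 1 (τ, y) *
          (shellB k₂).indicator (1 : ℝ × ℝ → ℝ≥0∞) ((τ, y) + z₀) = 0 := by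
        intro τ
        by_contra hne
        have hne := mul_ne_zero_iff.1 hne
        have m1 := hmem k₁ a τ y (τ, y) (by rw [modW_eq]) (Set.mem_of_indicator_ne_zero hne.1)
        have m2 := hmem k₂ b τ y ((τ, y) + z₀) (by rw [modW_add_eq])
          (Set.mem_of_indicator_ne_zero hne.2)
        apply hab
        calc |a - b| = |(τ - b) - (τ - a)| := by congr 1; ring
          _ ≤ |τ - b| + |τ - a| := abs_sub _ _
          _ ≤ _ := by linarith
      simp [this]
  rw [Measure.volume_eq_prod, lintegral_prod_symm' _ (by have := hB k₁; have := hB k₂; fun_prop)]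
  calc _ ≤ ∫⁻ y, (c * ENNReal.ofReal (2 * min r₁ r₂)) *
        (ENNReal.ofReal (dd y (y + z₀.2)) * g (phi (y + z₀.2) - phi y)) := by
        apply lintegral_mono; intro y
        dsimp only
        have m1 : Measurable fun τ : ℝ => (shellB k₁).indicator (1 : ℝ × ℝ → ℝ≥0∞) (τ, y) :=
          (hB k₁).comp (measurable_id.prodMk measurable_const)
        have m2 : Measurable fun τ : ℝ =>
            (shellB k₂).indicator (1 : ℝ × ℝ → ℝ≥0∞) ((τ, y) + z₀) :=
          (hB k₂).comp ((measurable_id.prodMk measurable_const).add_const _)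
        rw [lintegral_const_mul _ (by fun_prop), lintegral_const_mul _ (by fun_prop)]
        calc _ ≤ ENNReal.ofReal (dd y (y + z₀.2)) * (c *
              (ENNReal.ofReal (2 * min r₁ r₂) * g (phi (y + z₀.2) - phi y))) := by
              gcongr; exact hinner y
          _ = _ := by ring
    _ = (c * ENNReal.ofReal (2 * min r₁ r₂)) *
        ∫⁻ y, (ENNReal.ofReal (dd y (y + z₀.2)) * g (phi (y + z₀.2) - phi y)) :=
        lintegral_const_mul _ (by fun_prop)
    _ ≤ (c * ENNReal.ofReal (2 * min r₁ r₂)) * (8 * ∫⁻ u, g u) := by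
        gcongr; exact lintegral_dd_mul_le z₀.2 g
    _ = ENNReal.ofReal ((2 ^ k₁)⁻¹ * (2 ^ k₂)⁻¹ * (2 * min r₁ r₂) * (8 * (2 * (r₁ + r₂)))) := by
        rw [lintegral_indicator_one Metric.isClosed_closedBall.measurableSet,
          Real.volume_closedBall,
          ENNReal.ofReal_mul (p := (2 ^ k₁)⁻¹ * (2 ^ k₂)⁻¹ * (2 * min r₁ r₂)) (by positivity),
          ENNReal.ofReal_mul (p := (2 ^ k₁)⁻¹ * (2 ^ k₂)⁻¹) (by positivity),
          ENNReal.ofReal_mul (p := 8) (by positivity), hc, ENNReal.ofReal_ofNat]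
    _ ≤ ENNReal.ofReal 256 := by
        apply ENNReal.ofReal_le_ofReal
        have e1 : (2 ^ k₁ : ℝ)⁻¹ = 2 / r₁ := by rw [hr₁, pow_succ]; field_simp
        have e2 : (2 ^ k₂ : ℝ)⁻¹ = 2 / r₂ := by rw [hr₂, pow_succ]; field_simp
        rw [e1, e2]
        have e3 : min r₁ r₂ * (r₁ + r₂) ≤ 2 * (r₁ * r₂) := by
          rcases le_total r₁ r₂ with h | h
          · rw [min_eq_left h]; nlinarith
          · rw [min_eq_right h]; nlinarith
        have : 2 / r₁ * (2 / r₂) * (2 * min r₁ r₂) * (8 * (2 * (r₁ + r₂))) =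
            128 * (min r₁ r₂ * (r₁ + r₂)) / (r₁ * r₂) := by field_simp; ring
        rw [this, div_le_iff₀ (by positivity)]
        linarith
    _ = 256 := by simp

/-- Here the frequency is integrated first, at fixed `τ`, with `3 y²` bounded by the derivative of
`phi`. This serves the low output frequencies, where the output weight depends on `τ` alone. -/
lemma lintegral_sq_dec_le (z₀ : ℝ × ℝ) (x : ℝ) :
    ∫⁻ z : ℝ × ℝ, ENNReal.ofReal (3 * (z.2 + x) ^ 2 * dec (modW (z + (0, x))) *
      dec (jap (z.1 + z₀.1))) ≤ 2 * decInt * decInt := by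
  rw [Measure.volume_eq_prod, lintegral_prod _ (by fun_prop)]
  calc _ ≤ ∫⁻ τ, ENNReal.ofReal (dec (jap (τ + z₀.1))) * (2 * decInt) := by
        apply lintegral_mono; intro τ
        have e : ∀ y, ENNReal.ofReal (3 * (y + x) ^ 2 * dec (modW ((τ, y) + (0, x))) *
            dec (jap (τ + z₀.1))) = ENNReal.ofReal (dec (jap (τ + z₀.1))) *
            (ENNReal.ofReal (3 * (y + x) ^ 2) * ENNReal.ofReal (dec (jap (τ - phi (y + x))))) := by
          intro y
          rw [modW_add_eq, ENNReal.ofReal_mul (mul_nonneg (by positivity)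
            (dec_nonneg (jap_pos _).le)), ENNReal.ofReal_mul (by positivity)]
          simp only [sub_zero]
          ring
        simp only [e]
        rw [lintegral_const_mul _ (by fun_prop)]
        gcongr
        have := lintegral_deriv_phi_mul_le x (fun u => ENNReal.ofReal (dec (jap (τ - u))))
        rwa [lintegral_sub_left_eq_self (fun s => ENNReal.ofReal (dec (jap s))) τ] at this
    _ = _ := by
        rw [lintegral_mul_const _ (by fun_prop),
          lintegral_add_right_eq_self (fun τ => ENNReal.ofReal (dec (jap τ)))]
        rw [decInt]; ring

end FrozenIntegrals

/-! ### Trading powers between modulations. -/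

section Powers

lemma rpow_mul_rpow_le {a b c : ℝ} (hb : 1 ≤ b) (hc : 1 ≤ c) (hba : b ≤ a) (hca : c ≤ a)
    {s t u : ℝ} (hs : 0 ≤ s) (ht : 0 ≤ t) (hu : s + t ≤ u) : b ^ s * c ^ t ≤ a ^ u := by
  have ha : 1 ≤ a := hb.trans hba
  calc b ^ s * c ^ t ≤ a ^ s * a ^ t := by gcongr
    _ = a ^ (s + t) := (Real.rpow_add (by linarith) _ _).symm
    _ ≤ a ^ u := Real.rpow_le_rpow_of_exponent_le ha hu

/-- The largest modulation can spare `15/16 - 3/4 = 3/16`. Giving `1/16` to each of the other two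
brings them to the integrable exponent `-17/16`. -/
lemma modulation_bound_out {a a₁ a₂ : ℝ} (h₁ : 1 ≤ a₁) (h₂ : 1 ≤ a₂) (h₁a : a₁ ≤ a)
    (h₂a : a₂ ≤ a) :
    a ^ (-(15 / 16) : ℝ) * a₁⁻¹ * a₂⁻¹ ≤ a ^ (-(3 / 4) : ℝ) * dec (a₁ * a₂) := by
  have p : 0 < a := by linarith
  have p₁ : 0 < a₁ := by linarith
  have p₂ : 0 < a₂ := by linarith
  have key := rpow_mul_rpow_le h₁ h₂ h₁a h₂a (s := 1 / 16) (t := 1 / 16) (u := 3 / 16)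
    (by norm_num) (by norm_num) (by norm_num)
  have e1 : a ^ (-(3 / 4) : ℝ) = a ^ (-(15 / 16) : ℝ) * a ^ (3 / 16 : ℝ) := by
    rw [← Real.rpow_add p]; norm_num
  have e2 : ∀ {b : ℝ}, 0 < b → b⁻¹ = dec b * b ^ (1 / 16 : ℝ) := by
    intro b hb; unfold dec; rw [← Real.rpow_add hb, ← Real.rpow_neg_one]; norm_num
  rw [e1, e2 p₁, e2 p₂, dec_mul p₁.le p₂.le]
  have d1 := dec_pos p₁
  have d2 := dec_pos p₂
  have d3 : 0 < a ^ (-(15 / 16) : ℝ) := Real.rpow_pos_of_pos p _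
  calc _ = a ^ (-(15 / 16) : ℝ) * (dec a₁ * dec a₂) * (a₁ ^ (1 / 16 : ℝ) * a₂ ^ (1 / 16 : ℝ)) := by
        ring
    _ ≤ a ^ (-(15 / 16) : ℝ) * (dec a₁ * dec a₂) * a ^ (3 / 16 : ℝ) := by gcongr
    _ = _ := by ring

/-- With the largest modulation on an input, its spare power `1/4` raises `a` from `15/16`, and `a₂`
from `1`, to `17/16`. -/
lemma modulation_bound_in {a a₁ a₂ : ℝ} (h : 1 ≤ a) (h₂ : 1 ≤ a₂) (ha₁ : a ≤ a₁)
    (h₂₁ : a₂ ≤ a₁) :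
    a ^ (-(15 / 16) : ℝ) * a₁⁻¹ * a₂⁻¹ ≤ a₁ ^ (-(3 / 4) : ℝ) * dec (a₂ * a) := by
  have p : 0 < a := by linarith
  have p₁ : 0 < a₁ := by linarith
  have p₂ : 0 < a₂ := by linarith
  have key := rpow_mul_rpow_le h h₂ ha₁ h₂₁ (s := 1 / 8) (t := 1 / 16) (u := 1 / 4)
    (by norm_num) (by norm_num) (by norm_num)
  have e1 : a₁ ^ (-(3 / 4) : ℝ) = a₁⁻¹ * a₁ ^ (1 / 4 : ℝ) := by
    rw [← Real.rpow_neg_one, ← Real.rpow_add p₁]; norm_num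
  have e2 : a₂⁻¹ = dec a₂ * a₂ ^ (1 / 16 : ℝ) := by
    unfold dec; rw [← Real.rpow_add p₂, ← Real.rpow_neg_one]; norm_num
  have e3 : a ^ (-(15 / 16) : ℝ) = dec a * a ^ (1 / 8 : ℝ) := by
    unfold dec; rw [← Real.rpow_add p]; norm_num
  rw [e1, e2, e3, dec_mul p₂.le p.le]
  have d1 := dec_pos p
  have d2 := dec_pos p₂
  calc _ = a₁⁻¹ * (dec a₂ * dec a) * (a ^ (1 / 8 : ℝ) * a₂ ^ (1 / 16 : ℝ)) := by ring
    _ ≤ a₁⁻¹ * (dec a₂ * dec a) * a₁ ^ (1 / 4 : ℝ) := by gcongr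
    _ = _ := by ring

/-- The largest modulation keeps its full power, and the others are left with the non-integrable
exponent `-15/16`, to be repaired by `dichotomy` or `rpow_le_dec_add`. -/
lemma modulation_bound_in_sharp {a a₁ a₂ : ℝ} (h : 1 ≤ a) (h₁ : 1 ≤ a₁) (h₂ : 1 ≤ a₂) :
    a ^ (-(15 / 16) : ℝ) * a₁⁻¹ * a₂⁻¹ ≤ a₁⁻¹ * (a₂ * a) ^ (-(15 / 16) : ℝ) := by
  have p : 0 < a := by linarith
  have p₁ : 0 < a₁ := by linarith
  have p₂ : 0 < a₂ := by linarith
  rw [Real.mul_rpow p₂.le p.le]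
  have : a₂⁻¹ ≤ a₂ ^ (-(15 / 16) : ℝ) := by
    rw [← Real.rpow_neg_one]
    exact Real.rpow_le_rpow_of_exponent_le h₂ (by norm_num)
  calc _ = a₁⁻¹ * (a₂⁻¹ * a ^ (-(15 / 16) : ℝ)) := by ring
    _ ≤ _ := by gcongr

lemma inv_mul_le_rpow {a b : ℝ} (ha : 1 ≤ a) (hb : 1 ≤ b) :
    a⁻¹ * b⁻¹ ≤ (a * b) ^ (-(15 / 16) : ℝ) := by
  rw [← mul_inv, ← Real.rpow_neg_one]
  exact Real.rpow_le_rpow_of_exponent_le (by nlinarith) (by norm_num)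

/-- Compare `(a b)^(1/8)` with `r`. Below `r`, that power is paid by `r` and an integrable decay in
the product remains. Above `r`, its cube gives `r⁻³`, and the remaining `(a b)^(-9/16)` is at most
the decay in the smaller of the two weights. -/
lemma dichotomy {a b r : ℝ} (ha : 1 ≤ a) (hb : 1 ≤ b) (hr : 1 ≤ r) :
    (a * b) ^ (-(15 / 16) : ℝ) ≤ r * dec (a * b) + (r ^ 3)⁻¹ * (dec a + dec b) := by
  have hab : 1 ≤ a * b := by nlinarith
  have pab : 0 < a * b := by linarith
  have pa : 0 < a := by linarith
  have pb : 0 < b := by linarith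
  have d0 := dec_pos pab
  have d1 := dec_pos pa
  have d2 := dec_pos pb
  have pr : 0 < r := by linarith
  rcases le_total ((a * b) ^ (1 / 8 : ℝ)) r with h | h
  · have e : (a * b) ^ (-(15 / 16) : ℝ) = dec (a * b) * (a * b) ^ (1 / 8 : ℝ) := by
      unfold dec; rw [← Real.rpow_add pab]; norm_num
    rw [e]
    have : dec (a * b) * (a * b) ^ (1 / 8 : ℝ) ≤ r * dec (a * b) := by
      rw [mul_comm]; gcongr
    have : 0 ≤ (r ^ 3)⁻¹ * (dec a + dec b) := by positivity
    linarith
  · have key : ∀ {c d : ℝ}, 1 ≤ c → c ≤ d → (c * d) ^ (1 / 8 : ℝ) ≥ r →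
        (c * d) ^ (-(15 / 16) : ℝ) ≤ (r ^ 3)⁻¹ * dec c := by
      intro c d hc hcd hrr
      have pc : 0 < c := by linarith
      have pd : 0 < d := by linarith
      have e3 : r ^ 3 ≤ (c * d) ^ (3 / 8 : ℝ) := by
        calc r ^ 3 ≤ ((c * d) ^ (1 / 8 : ℝ)) ^ 3 := by gcongr
          _ = _ := by rw [← Real.rpow_natCast, ← Real.rpow_mul (by positivity)]; norm_num
      have e4 : (r ^ 3)⁻¹ ≥ (c * d) ^ (-(3 / 8) : ℝ) := by
        rw [Real.rpow_neg (by positivity)]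
        gcongr
      have e5 : (c * d) ^ (-(15 / 16) : ℝ) ≤ (c * d) ^ (-(3 / 8) : ℝ) * dec c := by
        have f1 : (c * d) ^ (-(15 / 16) : ℝ) =
            (c * d) ^ (-(3 / 8) : ℝ) * (c ^ (-(9 / 16) : ℝ) * d ^ (-(9 / 16) : ℝ)) := by
          rw [← Real.mul_rpow pc.le pd.le, ← Real.rpow_add (by positivity)]; norm_num
        rw [f1]
        gcongr
        calc c ^ (-(9 / 16) : ℝ) * d ^ (-(9 / 16) : ℝ)
            ≤ c ^ (-(9 / 16) : ℝ) * c ^ (-(9 / 16) : ℝ) := by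
              gcongr _ * ?_
              exact Real.rpow_le_rpow_of_nonpos pc hcd (by norm_num)
          _ = c ^ (-(9 / 8) : ℝ) := by rw [← Real.rpow_add pc]; norm_num
          _ ≤ dec c := Real.rpow_le_rpow_of_exponent_le hc (by norm_num)
      refine e5.trans ?_
      have := dec_nonneg pc.le
      gcongr
    have p1 : 0 ≤ r * dec (a * b) := by positivity
    have p2 : 0 ≤ (r ^ 3)⁻¹ * dec a := by positivity
    have p3 : 0 ≤ (r ^ 3)⁻¹ * dec b := by positivity
    rw [mul_add]
    rcases le_total a b with hab' | hab'
    · have := key ha hab' h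
      linarith
    · rw [mul_comm a b] at h ⊢
      have := key hb hab' h
      rw [mul_comm b a] at this ⊢
      linarith

/-- Since the product is at least the square of the smaller weight, that weight alone carries the
exponent `-15/8`. -/
lemma rpow_le_dec_add {a b : ℝ} (ha : 1 ≤ a) (hb : 1 ≤ b) :
    (a * b) ^ (-(15 / 16) : ℝ) ≤ dec a + dec b := by
  have key : ∀ {c d : ℝ}, 1 ≤ c → c ≤ d → (c * d) ^ (-(15 / 16) : ℝ) ≤ dec c := by
    intro c d hc hcd
    have pc : 0 < c := by linarith
    calc (c * d) ^ (-(15 / 16) : ℝ) ≤ (c * c) ^ (-(15 / 16) : ℝ) :=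
          Real.rpow_le_rpow_of_nonpos (by positivity) (by gcongr) (by norm_num)
      _ = c ^ (-(15 / 8) : ℝ) := by
          rw [Real.mul_rpow pc.le pc.le, ← Real.rpow_add pc]; norm_num
      _ ≤ dec c := Real.rpow_le_rpow_of_exponent_le hc (by norm_num)
  have d1 := dec_nonneg (show 0 ≤ a by linarith)
  have d2 := dec_nonneg (show 0 ≤ b by linarith)
  rcases le_total a b with h | h
  · have := key ha h; linarith
  · have := key hb h
    rw [mul_comm] at this; linarith

/-- The weight `(L / λ)^{1/16} + (λ / L)^{1/16}` localizing modulations near `λ`. -/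
def rho (L l : ℝ) : ℝ := (L / l) ^ (1 / 16 : ℝ) + (l / L) ^ (1 / 16 : ℝ)

lemma rho_pos {L l : ℝ} (hL : 0 < L) (hl : 0 < l) : 0 < rho L l := by
  unfold rho; positivity

lemma inv_mul_rho_le {L l : ℝ} (hl : 0 < l) (h : l ≤ L) : L⁻¹ * rho L l ≤ 2 * l⁻¹ := by
  have hL : 0 < L := hl.trans_le h
  have h1 : 1 ≤ L / l := by rwa [one_le_div hl]
  have h2 : (L / l) ^ (1 / 16 : ℝ) ≤ L / l := by
    calc _ ≤ (L / l) ^ (1 : ℝ) := Real.rpow_le_rpow_of_exponent_le h1 (by norm_num)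
      _ = _ := Real.rpow_one _
  have h3 : (l / L) ^ (1 / 16 : ℝ) ≤ 1 :=
    Real.rpow_le_one (by positivity) (by rwa [div_le_one hL]) (by norm_num)
  unfold rho
  calc _ ≤ L⁻¹ * (L / l + 1) := by gcongr
    _ = l⁻¹ + L⁻¹ := by field_simp
    _ ≤ l⁻¹ + l⁻¹ := by gcongr
    _ = _ := by ring

lemma rho_le_of_le {L l l' c : ℝ} (hL : 0 < L) (hl : 0 < l) (hl' : 0 < l') (hc : 1 ≤ c)
    (h : l ≤ c * l') (h' : l' ≤ c * l) : rho L l ≤ c * rho L l' := by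
  have key : ∀ {u v : ℝ}, 0 ≤ u → 0 ≤ v → u ≤ c * v →
      u ^ (1 / 16 : ℝ) ≤ c * v ^ (1 / 16 : ℝ) := by
    intro u v hu hv huv
    calc u ^ (1 / 16 : ℝ) ≤ (c * v) ^ (1 / 16 : ℝ) := by gcongr
      _ = c ^ (1 / 16 : ℝ) * v ^ (1 / 16 : ℝ) := Real.mul_rpow (by linarith) hv
      _ ≤ c ^ (1 : ℝ) * v ^ (1 / 16 : ℝ) := by
          gcongr
          norm_num
      _ = _ := by rw [Real.rpow_one]
  unfold rho
  rw [mul_add]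
  apply add_le_add
  · apply key (by positivity) (by positivity)
    rw [div_le_iff₀ hl, mul_div_assoc', div_mul_eq_mul_div, le_div_iff₀ hl']
    nlinarith
  · apply key (by positivity) (by positivity)
    rw [mul_div_assoc']
    gcongr

end Powers

/-! ### The comparison kernel and the pointwise bounds by frequency regime. -/

section Pointwise

/-- The bumps entering the comparison kernel. -/
def VV (x y : ℝ) : ℝ :=
  bump 1 0 y + bump |x| 0 y + bump (Real.sqrt |x|) 0 y +
    bump (|x| ^ (5 / 4 : ℝ)) (1 / (Real.sqrt 3 * |x|)) y + bump (Real.sqrt |x|) (|x| / 2) y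

/-- The five bumps, for a frozen frequency `x`: the unit bump serves bounded frequencies; the one of
height `|x|` a very small output of two high frequencies; the one of height `√|x|` at the origin a
low frequency near the boundary of `D`. The last two sit where `dd` vanishes: near `|x y| = 1/√3`,
where `3 = 1 / (y w)²` for `w` close to `x`, and at `|y| = |x|/2`, where `y² = w²`. -/
lemma le_VV (x y : ℝ) : 0 ≤ VV x y ∧ bump 1 0 y ≤ VV x y ∧ bump |x| 0 y ≤ VV x y ∧
    bump (Real.sqrt |x|) 0 y ≤ VV x y ∧
    bump (|x| ^ (5 / 4 : ℝ)) (1 / (Real.sqrt 3 * |x|)) y ≤ VV x y ∧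
    bump (Real.sqrt |x|) (|x| / 2) y ≤ VV x y := by
  have h1 := bump_nonneg zero_le_one 0 y
  have h2 := bump_nonneg (abs_nonneg x) 0 y
  have h3 := bump_nonneg (Real.sqrt_nonneg |x|) 0 y
  have h4 := bump_nonneg (Real.rpow_nonneg (abs_nonneg x) (5 / 4 : ℝ)) (1 / (Real.sqrt 3 * |x|)) y
  have h5 := bump_nonneg (Real.sqrt_nonneg |x|) (|x| / 2) y
  unfold VV
  refine ⟨?_, ?_, ?_, ?_, ?_, ?_⟩ <;> linarith

lemma VV_nonneg (x y : ℝ) : 0 ≤ VV x y := (le_VV x y).1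

lemma measurable_VV : Measurable (Function.uncurry VV) := by
  unfold VV bump; simp only [Function.uncurry_def]; fun_prop

lemma lintegral_VV_le (x : ℝ) : ∫⁻ y, ENNReal.ofReal (VV x y) ≤ 10 * decInt := by
  have hb : ∀ β y₀ : ℝ, Measurable (bump β y₀) := fun β y₀ => by unfold bump; fun_prop
  have e : ∀ y, ENNReal.ofReal (VV x y) = ENNReal.ofReal (bump 1 0 y) +
      ENNReal.ofReal (bump |x| 0 y) + ENNReal.ofReal (bump (Real.sqrt |x|) 0 y) +
      ENNReal.ofReal (bump (|x| ^ (5 / 4 : ℝ)) (1 / (Real.sqrt 3 * |x|)) y) +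
      ENNReal.ofReal (bump (Real.sqrt |x|) (|x| / 2) y) := by
    intro y
    have h1 := bump_nonneg zero_le_one 0 y
    have h2 := bump_nonneg (abs_nonneg x) 0 y
    have h3 := bump_nonneg (Real.sqrt_nonneg |x|) 0 y
    have h4 := bump_nonneg (Real.rpow_nonneg (abs_nonneg x) (5 / 4 : ℝ))
      (1 / (Real.sqrt 3 * |x|)) y
    have h5 := bump_nonneg (Real.sqrt_nonneg |x|) (|x| / 2) y
    rw [← ENNReal.ofReal_add h1 h2, ← ENNReal.ofReal_add (by positivity) h3,
      ← ENNReal.ofReal_add (by positivity) h4, ← ENNReal.ofReal_add (by positivity) h5]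
    rfl
  have hm : ∀ β y₀ : ℝ, Measurable fun y => ENNReal.ofReal (bump β y₀ y) :=
    fun β y₀ => (hb β y₀).ennreal_ofReal
  simp_rw [e]
  rw [lintegral_add_right _ (hm _ _), lintegral_add_right _ (hm _ _),
    lintegral_add_right _ (hm _ _), lintegral_add_right _ (hm _ _)]
  calc _ ≤ 2 * decInt + 2 * decInt + 2 * decInt + 2 * decInt + 2 * decInt := by
        gcongr <;> exact lintegral_bump_le (by positivity) _
    _ = _ := by ring

lemma dec_six : 1 / 36 ≤ dec 6 := by
  unfold dec
  calc (1 / 36 : ℝ) = 6 ^ (-2 : ℝ) := by rw [Real.rpow_neg (by norm_num)]; norm_num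
    _ ≤ _ := Real.rpow_le_rpow_of_exponent_le (by norm_num) (by norm_num)

/-- Within five widths of its centre a bump is comparable with its height: the bracket is at most 6,
and `dec 6` is at least `1/36`. -/
lemma le_bump {β y₀ y : ℝ} (hβ : 0 ≤ β) (h : |β * (|y| - y₀)| ≤ 5) : β ≤ 36 * bump β y₀ y := by
  have h1 : jap (β * (|y| - y₀)) ≤ 6 := (jap_le_one_add_abs _).trans (by linarith)
  have h2 := dec_anti (jap_pos _) h1
  have h3 := dec_six
  unfold bump
  nlinarith

/-- A polynomial lower bound for a bump away from its centre. -/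
lemma le_bump_of_one_le {β y₀ y u : ℝ} (hβ : 0 ≤ β) (hu : 1 ≤ u) (h : |β * (|y| - y₀)| ≤ u) :
    β * (u ^ 3)⁻¹ ≤ 4 * bump β y₀ y := by
  have h1 : jap (β * (|y| - y₀)) ≤ 2 * u := (jap_le_one_add_abs _).trans (by linarith)
  have h2 := dec_anti (jap_pos _) h1
  have pu : 0 < u := by linarith
  have h3 : (u ^ 3)⁻¹ ≤ 4 * dec (2 * u) := by
    have : dec (2 * u) = dec 2 * dec u := dec_mul (by norm_num) pu.le
    rw [this]
    have e1 : 1 / 4 ≤ dec 2 := by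
      unfold dec
      calc (1 / 4 : ℝ) = 2 ^ (-2 : ℝ) := by rw [Real.rpow_neg (by norm_num)]; norm_num
        _ ≤ _ := Real.rpow_le_rpow_of_exponent_le (by norm_num) (by norm_num)
    have e2 : (u ^ 3)⁻¹ ≤ dec u := by
      unfold dec
      calc (u ^ 3)⁻¹ = u ^ (-3 : ℝ) := by
            rw [Real.rpow_neg pu.le]; norm_num
        _ ≤ _ := Real.rpow_le_rpow_of_exponent_le hu (by norm_num)
    have := dec_nonneg pu.le
    nlinarith
  unfold bump
  calc β * (u ^ 3)⁻¹ ≤ β * (4 * dec (2 * u)) := by gcongr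
    _ ≤ β * (4 * dec (jap (β * (|y| - y₀)))) := by gcongr
    _ = _ := by ring

/-- The frequency weight. -/
def freqW (x₁ x₂ x : ℝ) : ℝ :=
  x ^ 2 * jap x ^ (-(3 / 2) : ℝ) * (jap x₁ ^ (3 / 2 : ℝ) * jap x₂ ^ (3 / 2 : ℝ))

lemma freqW_nonneg (x₁ x₂ x : ℝ) : 0 ≤ freqW x₁ x₂ x := by
  have := jap_pos x; have := jap_pos x₁; have := jap_pos x₂
  unfold freqW; positivity

lemma jap_rpow_le_one (x : ℝ) : jap x ^ (-(3 / 2) : ℝ) ≤ 1 :=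
  Real.rpow_le_one_of_one_le_of_nonpos (one_le_jap x) (by norm_num)

lemma sq_mul_jap_rpow_le (x : ℝ) : x ^ 2 * jap x ^ (-(3 / 2) : ℝ) ≤ Real.sqrt |x| := by
  have h0 := abs_nonneg x
  have hs := Real.sq_sqrt h0
  have hsn := Real.sqrt_nonneg |x|
  rcases eq_or_ne x 0 with rfl | hx
  · simp
  have hx' : 0 < |x| := abs_pos.2 hx
  calc x ^ 2 * jap x ^ (-(3 / 2) : ℝ) ≤ |x| ^ 2 * |x| ^ (-(3 / 2) : ℝ) := by
        rw [sq_abs]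
        gcongr ?_ * ?_
        exact Real.rpow_le_rpow_of_nonpos hx' (abs_le_jap x) (by norm_num)
    _ = |x| ^ (1 / 2 : ℝ) := by
        rw [← Real.rpow_natCast, ← Real.rpow_add hx']; norm_num
    _ = _ := (Real.sqrt_eq_rpow _).symm

lemma jap_rpow_le_of_four_le {x : ℝ} {N : ℝ} (h : 4 ≤ N) (hx : |x| ≤ N) :
    jap x ^ (3 / 2 : ℝ) ≤ 2 * N ^ (3 / 2 : ℝ) := by
  have h1 : jap x ≤ 5 / 4 * N := (jap_le_one_add_abs x).trans (by linarith)
  have h2 := jap_pos x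
  calc jap x ^ (3 / 2 : ℝ) ≤ (5 / 4 * N) ^ (3 / 2 : ℝ) := by gcongr
    _ = (5 / 4) ^ (3 / 2 : ℝ) * N ^ (3 / 2 : ℝ) := Real.mul_rpow (by norm_num) (by linarith)
    _ ≤ (5 / 4) ^ (2 : ℝ) * N ^ (3 / 2 : ℝ) := by
        gcongr
        · norm_num
        · norm_num
    _ ≤ _ := by
        have : 0 ≤ N ^ (3 / 2 : ℝ) := Real.rpow_nonneg (by linarith) _
        norm_num
        nlinarith

lemma rpow_three_halves_sq {N : ℝ} (h : 0 ≤ N) : N ^ (3 / 2 : ℝ) * N ^ (3 / 2 : ℝ) = N ^ 3 := by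
  rw [← Real.rpow_add_of_nonneg h (by norm_num) (by norm_num), ← Real.rpow_natCast]; norm_num

lemma rpow_three_halves {N : ℝ} (h : 0 ≤ N) : N ^ (3 / 2 : ℝ) = N * Real.sqrt N := by
  rw [Real.sqrt_eq_rpow]
  nth_rewrite 2 [← Real.rpow_one N]
  rw [← Real.rpow_add_of_nonneg h (by norm_num) (by norm_num)]; norm_num

/-- Frequency weight, high-low interaction. -/
lemma freqW_le_high_low {x₁ x₂ x : ℝ} (h : 4 ≤ |x₁|) (hx : |x| ≤ 5 / 4 * |x₁|) :
    freqW x₁ x₂ x ≤ 4 * |x₁| ^ 2 * jap x₂ ^ (3 / 2 : ℝ) := by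
  have h1 := sq_mul_jap_rpow_le x
  have h2 := jap_rpow_le_of_four_le h le_rfl
  set N := |x₁|
  have hj1 := jap_pos x₁
  have hjx := jap_pos x
  have h3 : Real.sqrt |x| ≤ 2 * Real.sqrt N := by
    rw [show (2 : ℝ) = Real.sqrt 4 by rw [show (4 : ℝ) = 2 ^ 2 by norm_num]; simp,
      ← Real.sqrt_mul (by norm_num)]
    apply Real.sqrt_le_sqrt
    linarith
  have hj := jap_pos x₂
  rw [rpow_three_halves (N := N) (by linarith)] at h2
  have hs := Real.sq_sqrt (show 0 ≤ N by linarith)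
  have hsn := Real.sqrt_nonneg N
  unfold freqW
  calc _ ≤ (2 * Real.sqrt N) * (2 * (N * Real.sqrt N) * jap x₂ ^ (3 / 2 : ℝ)) := by
        refine mul_le_mul (h1.trans h3) ?_ (by positivity) (by positivity)
        gcongr
    _ = 4 * N * (Real.sqrt N ^ 2) * jap x₂ ^ (3 / 2 : ℝ) := by ring
    _ = _ := by rw [hs]; ring

/-- Frequency weight, high-high interaction. -/
lemma freqW_le_high_high {x₁ x₂ x N : ℝ} (h : 4 ≤ N) (h₁ : |x₁| ≤ N) (h₂ : |x₂| ≤ N) :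
    freqW x₁ x₂ x ≤ 4 * N ^ 3 * (x ^ 2 * jap x ^ (-(3 / 2) : ℝ)) := by
  have h1 := jap_rpow_le_of_four_le h h₁
  have h2 := jap_rpow_le_of_four_le h h₂
  have h3 := jap_pos x
  have h4 := jap_pos x₁
  have h5 := jap_pos x₂
  have h6 : 0 ≤ N ^ (3 / 2 : ℝ) := Real.rpow_nonneg (by linarith) _
  unfold freqW
  calc _ ≤ x ^ 2 * jap x ^ (-(3 / 2) : ℝ) * ((2 * N ^ (3 / 2 : ℝ)) * (2 * N ^ (3 / 2 : ℝ))) := by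
        gcongr
    _ = 4 * (N ^ (3 / 2 : ℝ) * N ^ (3 / 2 : ℝ)) * (x ^ 2 * jap x ^ (-(3 / 2) : ℝ)) := by ring
    _ = _ := by rw [rpow_three_halves_sq (by linarith)]

lemma freqW_comm (x₁ x₂ x : ℝ) : freqW x₁ x₂ x = freqW x₂ x₁ x := by
  unfold freqW; ring

section Kr

variable {V : ℝ → ℝ → ℝ} {x y w a b : ℝ}

lemma kr_nonneg (hV : ∀ x y, 0 ≤ V x y) (ha : 1 ≤ a) (hb : 1 ≤ b) : 0 ≤ kr V x y w a b := by
  have h1 := dec_nonneg (show 0 ≤ a by linarith)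
  have h2 := dec_nonneg (show 0 ≤ b by linarith)
  have h3 := dec_nonneg (show 0 ≤ a * b by nlinarith)
  have h4 := hV x y
  have h5 := hV x w
  have h6 := dd_nonneg y w
  unfold kr; positivity

lemma kr_comm : kr V x y w a b = kr V x w y b a := by
  unfold kr; rw [dd_comm, mul_comm a b]; ring

/-- As `a, b ≥ 1`, the decay in `a b` is dominated by the decay in `a`, so both halves of the kernel
majorize it. -/
lemma le_kr (hV : ∀ x y, 0 ≤ V x y) (ha : 1 ≤ a) (hb : 1 ≤ b) :
    (dd y w + V x y + V x w) * dec (a * b) ≤ kr V x y w a b := by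
  have d1 : dec (a * b) ≤ dec a := dec_anti (by linarith) (by nlinarith)
  have h2 := dec_nonneg (show 0 ≤ b by linarith)
  have h4 := hV x y
  have h5 := hV x w
  unfold kr
  nlinarith

lemma bump_dec_le_kr (hV : ∀ x y, 0 ≤ V x y) (ha : 1 ≤ a) (hb : 1 ≤ b) :
    V x y * (dec a + dec b) ≤ kr V x y w a b := by
  have h1 := dec_nonneg (show 0 ≤ a by linarith)
  have h2 := dec_nonneg (show 0 ≤ b by linarith)
  have h3 := dec_nonneg (show 0 ≤ a * b by nlinarith)
  have h4 := hV x y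
  have h5 := hV x w
  have h6 := dd_nonneg y w
  unfold kr
  nlinarith [mul_nonneg h6 h3, mul_nonneg h5 (add_nonneg h1 h2)]

lemma dd_dec_le_kr (hV : ∀ x y, 0 ≤ V x y) (ha : 1 ≤ a) (hb : 1 ≤ b) :
    dd y w * dec (a * b) ≤ kr V x y w a b := by
  have h1 := dec_nonneg (show 0 ≤ a by linarith)
  have h2 := dec_nonneg (show 0 ≤ b by linarith)
  have h4 := hV x y
  have h5 := hV x w
  unfold kr
  nlinarith [mul_nonneg (add_nonneg h4 h5) (add_nonneg h1 h2)]

end Kr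

/-- For `q² ≥ 1` the second factor of `dd` stays away from its zero at `q² = 1/3`. -/
lemma two_le_of_one_le {q : ℝ} (h : 1 ≤ q ^ 2) : 2 ≤ |3 - 1 / q ^ 2| := by
  have : 1 / q ^ 2 ≤ 1 := by rw [div_le_one (by linarith)]; exact h
  rw [abs_of_nonneg (by linarith)]; linarith

lemma jap_rpow_mul_rpow_neg {y A : ℝ} (hA : 0 < A) :
    jap y ^ (3 / 2 : ℝ) * A ^ (-(3 / 4) : ℝ) = (jap y ^ 2 / A) ^ (3 / 4 : ℝ) := by
  have hj := jap_pos y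
  rw [Real.div_rpow (by positivity) hA.le, Real.rpow_neg hA.le, ← Real.rpow_natCast,
    ← Real.rpow_mul hj.le, show ((2 : ℕ) : ℝ) * (3 / 4) = 3 / 2 by norm_num]
  exact (div_eq_mul_inv _ _).symm

set_option maxHeartbeats 800000 in
/-- High-low interactions, with a high frequency frozen. -/
lemma high_low_bound {x y w N A : ℝ} (hN : 4 ≤ N) (hx : 3 / 4 * N ≤ |x|) (hx' : |x| ≤ 5 / 4 * N)
    (hw : 3 / 4 * N ≤ |w|) (hxw : |w| ≤ |x| + |y|) (hxw' : |x| ≤ |w| + |y|) (hy0 : y ≠ 0)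
    (hy : |y| ≤ N / 4) (hA : N ≤ A) (hAy : jap y ^ 2 ≤ 2 * A) :
    4 * N ^ 2 * jap y ^ (3 / 2 : ℝ) * A ^ (-(3 / 4) : ℝ) ≤ 10000 * (dd y w + VV x y) := by
  have hA0 : 0 < A := by linarith
  have hy1 : 0 < |y| := abs_pos.2 hy0
  have hVV := VV_nonneg x y
  have hdiff : N ^ 2 / 2 ≤ |y ^ 2 - w ^ 2| := by
    rw [abs_sub_comm]
    refine le_trans ?_ (le_abs_self _)
    rw [← sq_abs y, ← sq_abs w]
    nlinarith
  have hd0 := dd_nonneg y w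
  have hN2 : 0 ≤ N ^ 2 := by positivity
  -- For `|y| ≥ 2/N` one has `|y w| ≥ 1`, so `dd ≥ N²` and no bump is needed. For smaller `|y|` the
  -- product `|y w|` may be close to the zero `1/√3`.
  rcases le_or_gt (2 / N) |y| with h | h
  · have h1 : 2 ≤ N * |y| := by rw [div_le_iff₀ (by linarith)] at h; linarith
    have h2 : 1 ≤ (y * w) ^ 2 := by
      rw [← sq_abs, abs_mul]
      have : 1 ≤ |y| * |w| := by nlinarith
      nlinarith
    have h3 := two_le_of_one_le h2
    have h4 : N ^ 2 ≤ dd y w := by unfold dd; nlinarith [abs_nonneg (y ^ 2 - w ^ 2)]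
    have h5 : (jap y ^ 2 / A) ^ (3 / 4 : ℝ) ≤ 2 := by
      have : jap y ^ 2 / A ≤ 2 := by rw [div_le_iff₀ hA0]; linarith
      calc _ ≤ (2 : ℝ) ^ (3 / 4 : ℝ) := by
            have := jap_pos y
            gcongr
        _ ≤ 2 ^ (1 : ℝ) := Real.rpow_le_rpow_of_exponent_le (by norm_num) (by norm_num)
        _ = 2 := Real.rpow_one _
    rw [mul_assoc, jap_rpow_mul_rpow_neg hA0]
    nlinarith
  · have h1 : N * |y| ≤ 2 := by rw [lt_div_iff₀ (by linarith)] at h; linarith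
    have hyh : |y| ≤ 1 / 2 := by nlinarith
    -- The left side is now at most `8 r⁵ = 8 N^(5/4)`, which is the height of the bump at `1/(√3
    -- |x|)` up to a constant. Outside a neighbourhood of size `1/r` in `|x y|`, `dd` is of order at
    -- least `N²/r`, which is more than enough.
    set r := N ^ (1 / 4 : ℝ) with hr
    have hr1 : 1 ≤ r := Real.one_le_rpow (by linarith) (by norm_num)
    have hr4 : r ^ 4 = N := by
      rw [hr, ← Real.rpow_natCast, ← Real.rpow_mul (by linarith)]; norm_num
    have hjap : jap y ^ (3 / 2 : ℝ) ≤ 2 := by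
      have hj : jap y ≤ 3 / 2 := (jap_le_one_add_abs y).trans (by linarith)
      have := jap_pos y
      calc _ ≤ (3 / 2 : ℝ) ^ (3 / 2 : ℝ) := by gcongr
        _ ≤ (3 / 2 : ℝ) ^ (3 / 2 : ℝ) := le_rfl
        _ = 3 / 2 * Real.sqrt (3 / 2) := rpow_three_halves (by norm_num)
        _ ≤ 3 / 2 * (4 / 3) := by
          gcongr
          rw [Real.sqrt_le_left (by norm_num)]; norm_num
        _ = 2 := by norm_num
    have hA' : A ^ (-(3 / 4) : ℝ) ≤ (r ^ 3)⁻¹ := by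
      calc A ^ (-(3 / 4) : ℝ) ≤ N ^ (-(3 / 4) : ℝ) :=
            Real.rpow_le_rpow_of_nonpos (by linarith) hA (by norm_num)
        _ = (r ^ 3)⁻¹ := by
          rw [Real.rpow_neg (by linarith), hr, ← Real.rpow_natCast, ← Real.rpow_mul (by linarith)]
          norm_num
    have hL : 4 * N ^ 2 * jap y ^ (3 / 2 : ℝ) * A ^ (-(3 / 4) : ℝ) ≤ 8 * r ^ 5 := by
      have : 0 ≤ A ^ (-(3 / 4) : ℝ) := Real.rpow_nonneg hA0.le _
      calc _ ≤ 4 * N ^ 2 * 2 * (r ^ 3)⁻¹ := by gcongr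
        _ = 8 * r ^ 5 := by rw [← hr4]; field_simp; ring
    refine hL.trans ?_
    have hx0 : 0 < |x| := by linarith
    have s3 : 0 < Real.sqrt 3 := by positivity
    rcases le_or_gt |(|x| * |y| - 1 / Real.sqrt 3)| (2 / r) with hδ | hδ
    · set β := |x| ^ (5 / 4 : ℝ) with hβ
      have hβ1 : β = |x| * |x| ^ (1 / 4 : ℝ) := by
        rw [hβ]
        nth_rewrite 2 [← Real.rpow_one |x|]
        rw [← Real.rpow_add hx0]; norm_num
      have hx4 : |x| ^ (1 / 4 : ℝ) ≤ 5 / 4 * r := by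
        calc |x| ^ (1 / 4 : ℝ) ≤ (5 / 4 * N) ^ (1 / 4 : ℝ) := by gcongr
          _ = (5 / 4) ^ (1 / 4 : ℝ) * r := Real.mul_rpow (by norm_num) (by linarith)
          _ ≤ (5 / 4) ^ (1 : ℝ) * r := by
            gcongr
            · norm_num
            · norm_num
          _ = _ := by rw [Real.rpow_one]
      have hx4' : 1 / 2 * r ≤ |x| ^ (1 / 4 : ℝ) := by
        calc 1 / 2 * r = (1 / 2 : ℝ) ^ (1 : ℝ) * r := by rw [Real.rpow_one]
          _ ≤ (1 / 2 : ℝ) ^ (1 / 4 : ℝ) * r := by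
            gcongr ?_ * _
            exact Real.rpow_le_rpow_of_exponent_ge (by norm_num) (by norm_num) (by norm_num)
          _ = (1 / 2 * N) ^ (1 / 4 : ℝ) := (Real.mul_rpow (by norm_num) (by linarith)).symm
          _ ≤ _ := by gcongr; linarith
      have hb : |β * (|y| - 1 / (Real.sqrt 3 * |x|))| ≤ 5 := by
        have : β * (|y| - 1 / (Real.sqrt 3 * |x|)) =
            |x| ^ (1 / 4 : ℝ) * (|x| * |y| - 1 / Real.sqrt 3) := by
          rw [hβ1]; field_simp
        rw [this, abs_mul, abs_of_nonneg (Real.rpow_nonneg hx0.le _)]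
        calc _ ≤ (5 / 4 * r) * (2 / r) := by gcongr
          _ = 5 / 2 := by field_simp; norm_num
          _ ≤ 5 := by norm_num
      have h2 := le_bump (Real.rpow_nonneg hx0.le _) hb
      have h3 := (le_VV x y).2.2.2.2.1
      have h4 : r ^ 5 ≤ 4 * β := by
        rw [hβ1]
        calc r ^ 5 = N * r := by rw [← hr4]; ring
          _ ≤ 4 * ((3 / 4 * N) * (1 / 2 * r)) := by nlinarith
          _ ≤ _ := by gcongr
      linarith
    -- Replacing `|x|` by `|w|` moves `|x| |y|` by at most `|y|² ≤ 1/r`, half of the margin `2/r`,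
    -- so the second factor of `dd` is still at least `1/r`.
    · set q := |y| * |w| with hq
      have hw0 : 0 < |w| := by linarith
      have hq0 : 0 < q := by positivity
      have hqx : |(q - |x| * |y|)| ≤ |y| ^ 2 := by
        rw [hq, show |y| * |w| - |x| * |y| = |y| * (|w| - |x|) by ring, abs_mul, abs_abs, sq]
        refine mul_le_mul_of_nonneg_left ?_ (abs_nonneg y)
        rw [abs_le]; constructor <;> linarith
      have hsmall : |y| ^ 2 ≤ 1 / r := by
        have e1 : |y| ^ 2 ≤ 1 / N := by
          rw [le_div_iff₀ (by linarith)]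
          nlinarith
        refine e1.trans ?_
        apply one_div_le_one_div_of_le (by linarith)
        rw [← hr4]
        calc r = r ^ 1 := (pow_one r).symm
          _ ≤ r ^ 4 := by gcongr <;> norm_num
      have hq3 : 1 / r ≤ |q - 1 / Real.sqrt 3| := by
        have : |(|x| * |y| - 1 / Real.sqrt 3)| ≤ |q - 1 / Real.sqrt 3| + |(q - |x| * |y|)| := by
          rw [show |x| * |y| - 1 / Real.sqrt 3 = (q - 1 / Real.sqrt 3) - (q - |x| * |y|) by ring]
          exact abs_sub _ _
        have e : 2 / r = 1 / r + 1 / r := by ring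
        linarith
      have hqle : q ≤ 3 := by
        calc q ≤ |y| * (5 / 4 * N + 1 / 2) := by rw [hq]; gcongr; linarith
          _ = 5 / 4 * (N * |y|) + 1 / 2 * |y| := by ring
          _ ≤ 3 := by linarith
      have hfac : 1 / r ≤ |3 - 1 / (y * w) ^ 2| := by
        have e1 : (y * w) ^ 2 = q ^ 2 := by rw [hq, ← abs_mul, sq_abs]
        rw [e1]
        have e2 : 3 - 1 / q ^ 2 =
            (q - 1 / Real.sqrt 3) * (3 * (q + 1 / Real.sqrt 3) / q ^ 2) := by
          have : (1 / Real.sqrt 3) ^ 2 = 1 / 3 := by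
            rw [div_pow, Real.sq_sqrt (by norm_num)]; norm_num
          have e3 : (q - 1 / Real.sqrt 3) * (3 * (q + 1 / Real.sqrt 3) / q ^ 2) =
              3 * (q ^ 2 - (1 / Real.sqrt 3) ^ 2) / q ^ 2 := by ring
          rw [e3, this]
          field_simp
        rw [e2, abs_mul]
        have e4 : 1 ≤ |3 * (q + 1 / Real.sqrt 3) / q ^ 2| := by
          refine le_trans ?_ (le_abs_self _)
          rw [le_div_iff₀ (by positivity)]
          have : 0 ≤ 1 / Real.sqrt 3 := by positivity
          nlinarith
        calc 1 / r = 1 / r * 1 := (mul_one _).symm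
          _ ≤ _ := by gcongr
      have : r ^ 5 ≤ 2 * dd y w := by
        unfold dd
        calc r ^ 5 = 2 * (r ^ 4 / 2 * r ^ 2 * (1 / r)) := by field_simp
          _ ≤ 2 * (|y ^ 2 - w ^ 2| * |3 - 1 / (y * w) ^ 2|) := by
            gcongr
            refine le_trans ?_ hdiff
            rw [← hr4]
            have : r ^ 2 ≤ r ^ 4 := by gcongr <;> norm_num
            nlinarith [pow_pos (show 0 < r by linarith) 4]
      linarith

/-- High-low interactions, with the low frequency frozen. -/
lemma low_frozen_bound {x₁ x₂ x A : ℝ} (h : x = x₁ + x₂) (hN : 4 ≤ |x₁|) (hm : 1 ≤ |x₂|)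
    (hm' : |x₂| ≤ |x₁| / 4) (hA : |x * x₁ * x₂| ≤ A) :
    4 * |x₁| ^ 2 * jap x₂ ^ (3 / 2 : ℝ) * A ^ (-(3 / 4) : ℝ) ≤ 10000 * dd x₁ x := by
  have hx : 3 / 4 * |x₁| ≤ |x| := by
    have : |x₁| ≤ |x| + |x₂| := by
      rw [show x₁ = x - x₂ by rw [h]; ring]; exact abs_sub _ _
    linarith
  have hxx : 7 / 4 * |x₁| ≤ |x₁ + x| := by
    have : 2 * |x₁| ≤ |x₁ + x| + |x₂| := by
      rw [show 2 * |x₁| = |x₁ + x - x₂| by rw [h, ← abs_two, ← abs_mul]; congr 1; ring]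
      exact abs_sub _ _
    linarith
  rw [abs_mul, abs_mul] at hA
  set N := |x₁| with hNd
  set m := |x₂| with hmd
  have hA' : 3 / 4 * N ^ 2 * m ≤ A := by
    refine le_trans ?_ hA
    calc 3 / 4 * N ^ 2 * m = (3 / 4 * N) * N * m := by ring
      _ ≤ _ := by gcongr
  have hA0 : 0 < A := lt_of_lt_of_le (by positivity) hA'
  have hdd : 2 * (N * m) ≤ dd x₁ x := by
    have h2 : 1 ≤ (x₁ * x) ^ 2 := by
      rw [← sq_abs, abs_mul, ← hNd]
      have : 1 ≤ N * |x| := by nlinarith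
      nlinarith
    have h3 := two_le_of_one_le h2
    have h4 : N * m ≤ |x₁ ^ 2 - x ^ 2| := by
      rw [show x₁ ^ 2 - x ^ 2 = -(x₂ * (x₁ + x)) by rw [h]; ring, abs_neg, abs_mul, ← hmd]
      nlinarith
    unfold dd
    nlinarith [abs_nonneg (x₁ ^ 2 - x ^ 2)]
  have hj : jap x₂ ^ 2 / A ≤ 8 / 3 * m / N ^ 2 := by
    rw [div_le_div_iff₀ hA0 (by positivity), jap_sq, ← sq_abs x₂, ← hmd]
    have e1 : (1 + m ^ 2) ≤ 2 * m ^ 2 := by nlinarith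
    calc (1 + m ^ 2) * N ^ 2 ≤ (2 * m ^ 2) * N ^ 2 := by gcongr
      _ = 8 / 3 * m * (3 / 4 * N ^ 2 * m) := by ring
      _ ≤ _ := by gcongr
  have hj0 : 0 ≤ jap x₂ ^ 2 / A := by positivity
  have hpow : (jap x₂ ^ 2 / A) ^ (3 / 4 : ℝ) ≤ 2 * m / N := by
    set t := 8 / 3 * m / N ^ 2 with ht
    have ht1 : t ≤ 1 := by
      rw [ht, div_le_one (by positivity)]; nlinarith
    have ht0 : 0 < t := by positivity
    calc _ ≤ t ^ (3 / 4 : ℝ) := by gcongr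
      -- As `t ≤ 1`, the exponent may drop to `1/2`; the resulting `m / N` is exactly what `dd ≥ 2 N
      -- m` can pay for.
      _ ≤ t ^ (1 / 2 : ℝ) := Real.rpow_le_rpow_of_exponent_ge ht0 ht1 (by norm_num)
      _ = Real.sqrt t := (Real.sqrt_eq_rpow _).symm
      _ ≤ 2 * m / N := by
        rw [Real.sqrt_le_left (by positivity), ht, div_pow]
        gcongr
        nlinarith
  rw [mul_assoc, jap_rpow_mul_rpow_neg hA0]
  calc _ ≤ 4 * N ^ 2 * (2 * m / N) := by gcongr
    _ = 8 * (N * m) := by field_simp; ring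
    _ ≤ _ := by linarith [dd_nonneg x₁ x]

/-- Comparable high frequencies. -/
lemma comparable_bound {x y w a b : ℝ} (hx : 1 ≤ |x|) (hyw : 1 ≤ (y * w) ^ 2)
    (hd : |x| * |(|x| - 2 * |y|)| ≤ |y ^ 2 - w ^ 2|) (ha : 1 ≤ a) (hb : 1 ≤ b) :
    Real.sqrt |x| * (a * b) ^ (-(15 / 16) : ℝ) ≤ 100 * kr VV x y w a b := by
  set s := Real.sqrt |x| with hs
  have hs0 : 0 ≤ s := Real.sqrt_nonneg _
  have hss : s ^ 2 = |x| := Real.sq_sqrt (abs_nonneg x)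
  -- Up to a factor 2, `u` is the distance from the degenerate points `|y| = |x|/2` in units of the
  -- bump width `1/s`.
  set u := s * |(|x| - 2 * |y|)| with hu
  have hu0 : 0 ≤ u := by positivity
  have hdd : 2 * (s * u) ≤ dd y w := by
    unfold dd
    have h1 := two_le_of_one_le hyw
    have h2 : s * u ≤ |y ^ 2 - w ^ 2| := by
      calc s * u = s ^ 2 * |(|x| - 2 * |y|)| := by rw [hu]; ring
        _ ≤ _ := by rw [hss]; exact hd
    nlinarith [abs_nonneg (y ^ 2 - w ^ 2)]
  have hub : |s * (|y| - |x| / 2)| ≤ u := by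
    rw [abs_mul, abs_of_nonneg hs0, hu]
    refine mul_le_mul_of_nonneg_left ?_ hs0
    rw [show |y| - |x| / 2 = -(1 / 2) * (|x| - 2 * |y|) by ring, abs_mul]
    norm_num
    linarith [abs_nonneg (|x| - 2 * |y|)]
  have hVV := (le_VV x y).2.2.2.2.2
  have k1 := bump_dec_le_kr (V := VV) (x := x) (y := y) (w := w) VV_nonneg ha hb
  have k2 := dd_dec_le_kr (V := VV) (x := x) (y := y) (w := w) VV_nonneg ha hb
  have d1 := dec_nonneg (show 0 ≤ a by linarith)
  have d2 := dec_nonneg (show 0 ≤ b by linarith)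
  have d3 := dec_nonneg (show 0 ≤ a * b by nlinarith)
  rcases le_total u 1 with h1 | h1
  · have e1 : s ≤ 36 * VV x y := (le_bump hs0 (hub.trans (by linarith))).trans (by linarith)
    have e2 := rpow_le_dec_add ha hb
    calc s * (a * b) ^ (-(15 / 16) : ℝ) ≤ (36 * VV x y) * (dec a + dec b) := by
          have := VV_nonneg x y
          gcongr
      _ ≤ 36 * kr VV x y w a b := by rw [mul_assoc]; gcongr
      _ ≤ _ := by
        have := kr_nonneg (V := VV) (x := x) (y := y) (w := w) VV_nonneg ha hb
        linarith
  -- Away from the degenerate points `dichotomy` applies with `r = u`: `dd` pays for `s u`, and the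
  -- tail of the bump for `s u⁻³`.
  · have e1 : s * (u ^ 3)⁻¹ ≤ 4 * VV x y := (le_bump_of_one_le hs0 h1 hub).trans (by linarith)
    have e2 := dichotomy ha hb h1
    calc s * (a * b) ^ (-(15 / 16) : ℝ)
        ≤ s * (u * dec (a * b) + (u ^ 3)⁻¹ * (dec a + dec b)) := by gcongr
      _ = (s * u) * dec (a * b) + (s * (u ^ 3)⁻¹) * (dec a + dec b) := by ring
      _ ≤ (dd y w) * dec (a * b) + (4 * VV x y) * (dec a + dec b) := by
          gcongr
          have : 0 ≤ s * u := by positivity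
          linarith
      _ ≤ kr VV x y w a b + 4 * kr VV x y w a b := by
          rw [mul_assoc 4]; gcongr
      _ ≤ _ := by
        have := kr_nonneg (V := VV) (x := x) (y := y) (w := w) VV_nonneg ha hb
        linarith

/-- High-high to low interactions, with a high frequency frozen. -/
lemma high_high_bound {x₁ x₂ x N A : ℝ} (hN : 4 ≤ N) (h₁ : |x₁| ≤ N)
    (h₁' : 3 / 4 * N ≤ |x₁|) (h₂' : 3 / 4 * N ≤ |x₂|)
    (hx : |x| ≤ N / 4) (hx0 : x ≠ 0)
    (hA : |x * x₁ * x₂| ≤ A) (hA1 : 1 ≤ A) :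
    4 * N ^ 3 * (x ^ 2 * jap x ^ (-(3 / 2) : ℝ)) * A ^ (-(3 / 4) : ℝ) ≤
      10000 * (dd x₂ x + VV x₁ x) := by
  have hM : 0 < |x| := abs_pos.2 hx0
  rw [abs_mul, abs_mul] at hA
  have hA' : 9 / 16 * |x| * N ^ 2 ≤ A := by
    refine le_trans ?_ hA
    calc 9 / 16 * |x| * N ^ 2 = |x| * (3 / 4 * N) * (3 / 4 * N) := by ring
      _ ≤ _ := by gcongr
  have hA0 : 0 < A := by linarith
  have hVV := VV_nonneg x₁ x
  have hd0 := dd_nonneg x₂ x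
  have hj0 : 0 ≤ jap x ^ (-(3 / 2) : ℝ) := Real.rpow_nonneg (jap_pos x).le _
  rcases le_or_gt (2 / N) |x| with hc | hc
  · have h1 : 2 ≤ N * |x| := by rw [div_le_iff₀ (by linarith)] at hc; linarith
    have h2 : 1 ≤ (x₂ * x) ^ 2 := by
      rw [← sq_abs, abs_mul]
      have : 1 ≤ |x₂| * |x| := by nlinarith
      nlinarith
    have h3 := two_le_of_one_le h2
    have hdiff : N ^ 2 / 2 ≤ |x₂ ^ 2 - x ^ 2| := by
      refine le_trans ?_ (le_abs_self _)
      rw [← sq_abs x₂, ← sq_abs x]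
      nlinarith
    have h4 : N ^ 2 ≤ dd x₂ x := by unfold dd; nlinarith [abs_nonneg (x₂ ^ 2 - x ^ 2)]
    have h5 : x ^ 2 * jap x ^ (-(3 / 2) : ℝ) * A ^ (-(3 / 4) : ℝ) ≤ 4 / 3 / N := by
      have e1 : A ^ (-(3 / 4) : ℝ) ≤ (Real.sqrt A)⁻¹ := by
        rw [Real.sqrt_eq_rpow, ← Real.rpow_neg hA0.le]
        exact Real.rpow_le_rpow_of_exponent_le hA1 (by norm_num)
      have e2 : 3 / 4 * Real.sqrt |x| * N ≤ Real.sqrt A := by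
        apply Real.le_sqrt_of_sq_le
        rw [mul_pow, mul_pow, Real.sq_sqrt hM.le]
        linarith
      have hs : 0 < Real.sqrt |x| := Real.sqrt_pos.2 hM
      calc _ ≤ Real.sqrt |x| * (3 / 4 * Real.sqrt |x| * N)⁻¹ := by
            gcongr
            · exact sq_mul_jap_rpow_le x
            · exact e1.trans (by gcongr)
        _ = 4 / 3 / N := by field_simp
    calc _ = 4 * N ^ 3 * (x ^ 2 * jap x ^ (-(3 / 2) : ℝ) * A ^ (-(3 / 4) : ℝ)) := by ring
      _ ≤ 4 * N ^ 3 * (4 / 3 / N) := by gcongr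
      _ = 16 / 3 * N ^ 2 := by field_simp; norm_num
      _ ≤ _ := by nlinarith
  -- For so small an output the left side is at most `16 N`, the height of a bump up to a constant,
  -- and the decay in `A` is not needed.
  · have h1 : N * |x| ≤ 2 := by rw [lt_div_iff₀ (by linarith)] at hc; linarith
    have h2 : A ^ (-(3 / 4) : ℝ) ≤ 1 := Real.rpow_le_one_of_one_le_of_nonpos hA1 (by norm_num)
    have h3 := jap_rpow_le_one x
    have h5 : |x₁| ≤ 36 * bump |x₁| 0 x := by
      apply le_bump (abs_nonneg _)
      rw [sub_zero, abs_mul, abs_abs, abs_abs]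
      nlinarith
    have h6 := (le_VV x₁ x).2.2.1
    have hAn : 0 ≤ A ^ (-(3 / 4) : ℝ) := Real.rpow_nonneg hA0.le _
    calc _ ≤ 4 * N ^ 3 * (x ^ 2 * 1) * 1 := by gcongr
      _ = 4 * N * (N * |x|) ^ 2 := by rw [mul_pow, sq_abs]; ring
      _ ≤ 4 * N * 2 ^ 2 := by gcongr
      _ ≤ _ := by nlinarith

end Pointwise

/-! ### The resonance identity and the choice of the largest modulation. -/

section Master

/-- The resonance identity in the form of lower bounds for the largest modulation. -/
lemma resonance {x₁ x₂ x s₁ s₂ s A : ℝ} (h : x = x₁ + x₂) (h₁ : x₁ ≠ 0) (h₂ : x₂ ≠ 0)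
    (h₀ : x ≠ 0) (hs : s - s₁ - s₂ = x₁ ^ 3 - 1 / x₁ + (x₂ ^ 3 - 1 / x₂) - (x ^ 3 - 1 / x))
    (hA : |s| ≤ A) (hA₁ : |s₁| ≤ A) (hA₂ : |s₂| ≤ A) :
    |x * x₁ * x₂| ≤ A ∧ |x₁| ≤ A ∧ |x₂| ≤ A := by
  set q := x * x₁ * x₂ with hq
  set e := x₁ ^ 2 + x₁ * x₂ + x₂ ^ 2 with he
  have hq0 : q ≠ 0 := mul_ne_zero (mul_ne_zero h₀ h₁) h₂
  have hqp : 0 < |q| := abs_pos.2 hq0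
  have he0 : 0 ≤ e := by rw [he]; nlinarith [sq_nonneg (x₁ + x₂), sq_nonneg (x₁ - x₂)]
  have h3 : s - s₁ - s₂ = -(3 * q + e / q) := by
    rw [hs, hq, he]
    have : x₁ + x₂ ≠ 0 := h ▸ h₀
    subst h
    field_simp
    ring
  -- Since `e ≥ 0`, the terms `3 q` and `e / q` have the same sign.
  have h4 : |s - s₁ - s₂| = 3 * |q| + e / |q| := by
    rw [h3, abs_neg]
    rcases lt_or_gt_of_ne hq0 with hneg | hpos
    · rw [abs_of_neg hneg, abs_of_nonpos]
      · rw [div_neg]; ring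
      · have : e / q ≤ 0 := div_nonpos_of_nonneg_of_nonpos he0 hneg.le
        linarith
    · rw [abs_of_pos hpos, abs_of_nonneg]
      positivity
  have h5 : |s - s₁ - s₂| ≤ 3 * A := by
    have := abs_sub (s - s₁) s₂
    have := abs_sub s s₁
    linarith
  have h6 : 0 ≤ e / |q| := by positivity
  have hA0 : 0 ≤ A := (abs_nonneg s).trans hA
  -- Arithmetic–geometric mean for `3 |q|` and `e / |q|`, whose sum is at most `3 A`. Since `e` is
  -- at least `3/4` of the square of either input frequency, both are at most `A`.
  have h7 : e ≤ 3 / 4 * A ^ 2 := by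
    have e1 : e = |q| * (e / |q|) := by field_simp
    rw [e1]
    nlinarith [sq_nonneg (3 * |q| - e / |q|)]
  refine ⟨by linarith, ?_, ?_⟩
  · apply abs_le_of_sq_le_sq _ hA0
    nlinarith [sq_nonneg (x₁ + 2 * x₂)]
  · apply abs_le_of_sq_le_sq _ hA0
    nlinarith [sq_nonneg (2 * x₁ + x₂)]

/-- The sum of the three comparison kernels. -/
def krSum (V : ℝ → ℝ → ℝ) (x₁ x₂ x a₁ a₂ a : ℝ) : ℝ :=
  kr V x₁ x₂ x a₂ a + kr V x₂ x₁ x a₁ a + kr V x x₁ x₂ a₁ a₂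

lemma krSum_ge {V : ℝ → ℝ → ℝ} (hV : ∀ x y, 0 ≤ V x y) {x₁ x₂ x a₁ a₂ a : ℝ} (h : 1 ≤ a)
    (h₁ : 1 ≤ a₁) (h₂ : 1 ≤ a₂) :
    0 ≤ krSum V x₁ x₂ x a₁ a₂ a ∧
    kr V x₁ x₂ x a₂ a ≤ krSum V x₁ x₂ x a₁ a₂ a ∧
    kr V x₂ x₁ x a₁ a ≤ krSum V x₁ x₂ x a₁ a₂ a ∧
    kr V x x₁ x₂ a₁ a₂ ≤ krSum V x₁ x₂ x a₁ a₂ a := by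
  have e1 := kr_nonneg (x := x₁) (y := x₂) (w := x) hV h₂ h
  have e2 := kr_nonneg (x := x₂) (y := x₁) (w := x) hV h₁ h
  have e3 := kr_nonneg (x := x) (y := x₁) (w := x₂) hV h₁ h₂
  unfold krSum
  refine ⟨?_, ?_, ?_, ?_⟩ <;> linarith

variable {x₁ x₂ x a₁ a₂ a : ℝ}

/-- If the largest modulation is gained with exponent `3/4`, it suffices to compare frequencies. -/
lemma frozen_le {X y w A b c F P : ℝ} (hb : 1 ≤ b) (hc : 1 ≤ c) (hF : 0 ≤ F)
    (hP : P ≤ A ^ (-(3 / 4) : ℝ) * dec (b * c))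
    (h : F * A ^ (-(3 / 4) : ℝ) ≤ 100000 * (dd y w + VV X y + VV X w)) :
    F * P ≤ 100000 * kr VV X y w b c := by
  have d := dec_nonneg (show 0 ≤ b * c by nlinarith)
  calc F * P ≤ F * (A ^ (-(3 / 4) : ℝ) * dec (b * c)) := by gcongr
    _ = F * A ^ (-(3 / 4) : ℝ) * dec (b * c) := by ring
    _ ≤ 100000 * (dd y w + VV X y + VV X w) * dec (b * c) := by gcongr
    _ = 100000 * ((dd y w + VV X y + VV X w) * dec (b * c)) := by ring
    _ ≤ _ := by gcongr; exact le_kr VV_nonneg hb hc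

lemma exists_max (a₁ a₂ a : ℝ) :
    (a₁ ≤ a ∧ a₂ ≤ a) ∨ (a ≤ a₁ ∧ a₂ ≤ a₁) ∨ (a₁ ≤ a₂ ∧ a ≤ a₂) := by
  rcases le_total a₁ a with h1 | h1 <;> rcases le_total a₂ a with h2 | h2 <;>
    rcases le_total a₁ a₂ with h3 | h3 <;> grind

/-- The modulation bounds in the three cases for the largest modulation. -/
lemma krSum_of_frozen {F : ℝ} (h : 1 ≤ a) (h₁ : 1 ≤ a₁) (h₂ : 1 ≤ a₂) (hF : 0 ≤ F)
    (H₀ : a₁ ≤ a → a₂ ≤ a →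
      F * a ^ (-(3 / 4) : ℝ) ≤ 100000 * (dd x₁ x₂ + VV x x₁ + VV x x₂))
    (H₁ : a ≤ a₁ → a₂ ≤ a₁ →
      F * a₁ ^ (-(3 / 4) : ℝ) ≤ 100000 * (dd x₂ x + VV x₁ x₂ + VV x₁ x))
    (H₂ : a ≤ a₂ → a₁ ≤ a₂ →
      F * (a ^ (-(15 / 16) : ℝ) * a₁⁻¹ * a₂⁻¹) ≤ 100000 * krSum VV x₁ x₂ x a₁ a₂ a) :
    F * (a ^ (-(15 / 16) : ℝ) * a₁⁻¹ * a₂⁻¹) ≤ 100000 * krSum VV x₁ x₂ x a₁ a₂ a := by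
  obtain ⟨k0, k1, k2, k3⟩ := krSum_ge (x₁ := x₁) (x₂ := x₂) (x := x) VV_nonneg h h₁ h₂
  rcases exists_max a₁ a₂ a with ⟨e1, e2⟩ | ⟨e1, e2⟩ | ⟨e1, e2⟩
  · have := frozen_le h₁ h₂ hF (modulation_bound_out h₁ h₂ e1 e2) (H₀ e1 e2)
    linarith
  · have := frozen_le h₂ h hF (modulation_bound_in h h₂ e1 e2) (H₁ e1 e2)
    linarith
  · exact H₂ e2 e1

/-- The mirror image of the `H₁` branch of `krSum_of_frozen`. It stands apart because a low second
frequency with the largest modulation may need the full power of that modulation instead. -/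
lemma krSum_of_frozen_second {F : ℝ} (h : 1 ≤ a) (h₁ : 1 ≤ a₁) (h₂ : 1 ≤ a₂) (hF : 0 ≤ F)
    (e1 : a ≤ a₂) (e2 : a₁ ≤ a₂)
    (H₂ : F * a₂ ^ (-(3 / 4) : ℝ) ≤ 100000 * (dd x₁ x + VV x₂ x₁ + VV x₂ x)) :
    F * (a ^ (-(15 / 16) : ℝ) * a₁⁻¹ * a₂⁻¹) ≤ 100000 * krSum VV x₁ x₂ x a₁ a₂ a := by
  obtain ⟨k0, k1, k2, k3⟩ := krSum_ge (x₁ := x₁) (x₂ := x₂) (x := x) VV_nonneg h h₁ h₂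
  have hP : a ^ (-(15 / 16) : ℝ) * a₁⁻¹ * a₂⁻¹ ≤ a₂ ^ (-(3 / 4) : ℝ) * dec (a₁ * a) := by
    have := modulation_bound_in h h₁ e1 e2
    calc _ = a ^ (-(15 / 16) : ℝ) * a₂⁻¹ * a₁⁻¹ := by ring
      _ ≤ _ := this
  have := frozen_le h₁ h hF hP H₂
  linarith

/-- All frequencies are bounded, so `freqW ≤ 3 * 16 * 16 = 768`, and the unit bump at the origin
suffices. -/
lemma low_case (hx : x = x₁ + x₂) (h : 1 ≤ a) (h₁ : 1 ≤ a₁) (h₂ : 1 ≤ a₂)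
    (hN : |x₁| ≤ 4) (hm : |x₂| ≤ 4) :
    freqW x₁ x₂ x * (a ^ (-(15 / 16) : ℝ) * a₁⁻¹ * a₂⁻¹) ≤
      100000 * krSum VV x₁ x₂ x a₁ a₂ a := by
  have hF := freqW_nonneg x₁ x₂ x
  have hx8 : |x| ≤ 8 := by rw [hx]; exact (abs_add_le _ _).trans (by linarith)
  have hFle : freqW x₁ x₂ x ≤ 768 := by
    have h1 := jap_rpow_le_of_four_le le_rfl hN
    have h2 := jap_rpow_le_of_four_le le_rfl hm
    have h3 := sq_mul_jap_rpow_le x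
    have h4 : Real.sqrt |x| ≤ 3 := by
      rw [Real.sqrt_le_left (by norm_num)]; linarith
    have e : (4 : ℝ) ^ (3 / 2 : ℝ) = 8 := by
      rw [rpow_three_halves (by norm_num), show (4 : ℝ) = 2 ^ 2 by norm_num,
        Real.sqrt_sq (by norm_num)]; norm_num
    rw [e] at h1 h2
    have := jap_pos x₁
    have := jap_pos x₂
    unfold freqW
    calc _ ≤ (3 : ℝ) * ((2 * 8) * (2 * 8)) := by
          refine mul_le_mul (h3.trans h4) ?_ (by positivity) (by norm_num)
          gcongr
      _ ≤ _ := by norm_num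
  have hV : ∀ X {y : ℝ}, |y| ≤ 4 → 1 ≤ 36 * VV X y := by
    intro X y hy
    have := le_bump (β := 1) (y₀ := 0) (y := y) zero_le_one (by
      rw [one_mul, sub_zero, abs_abs]; linarith)
    have := (le_VV X y).2.1
    linarith
  have hpow : ∀ {A : ℝ}, 1 ≤ A → freqW x₁ x₂ x * A ^ (-(3 / 4) : ℝ) ≤ 768 := by
    intro A hA
    have := Real.rpow_le_one_of_one_le_of_nonpos hA (show (-(3 / 4) : ℝ) ≤ 0 by norm_num)
    nlinarith
  apply krSum_of_frozen h h₁ h₂ hF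
  · intro _ _
    have := hpow h
    have := hV x hN
    have := VV_nonneg x x₂
    have := dd_nonneg x₁ x₂
    linarith
  · intro _ _
    have := hpow h₁
    have := hV x₁ hm
    have := VV_nonneg x₁ x
    have := dd_nonneg x₂ x
    linarith
  · intro e1 e2
    apply krSum_of_frozen_second h h₁ h₂ hF e1 e2
    have := hpow h₂
    have := hV x₂ hN
    have := VV_nonneg x₂ x
    have := dd_nonneg x₁ x
    linarith

/-- The region where a low frequency with a small modulation interacts with a high one. -/
def IsLowHigh (x₁ x₂ a₁ a₂ a : ℝ) : Prop :=
  4 ≤ |x₁| ∧ |x₂| ≤ 1 ∧ a₁ ≤ a₂ ∧ a ≤ a₂ ∧ 2 * a₂ * |x₂| ^ 3 < 1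

/-- The region where two comparable high frequencies interact and the output modulation is the
largest one. -/
def IsHighHigh (x₁ x₂ a₁ a₂ a : ℝ) : Prop :=
  4 ≤ |x₁| ∧ |x₂| ≤ |x₁| ∧ |x₁| / 4 ≤ |x₂| ∧ a₁ ≤ a ∧ a₂ ≤ a

lemma freqW_le_low (hx : x = x₁ + x₂) (hN : 4 ≤ |x₁|) (hm : |x₂| ≤ 1) :
    freqW x₁ x₂ x ≤ 12 * |x₁| ^ 2 := by
  have hxa : |x| ≤ |x₁| + |x₂| := by rw [hx]; exact abs_add_le _ _
  have hF := freqW_le_high_low (x₂ := x₂) hN (show |x| ≤ 5 / 4 * |x₁| by linarith)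
  have hj : jap x₂ ^ (3 / 2 : ℝ) ≤ 3 := by
    have h1 : jap x₂ ≤ 2 := (jap_le_one_add_abs _).trans (by linarith)
    have := jap_pos x₂
    calc jap x₂ ^ (3 / 2 : ℝ) ≤ 2 ^ (3 / 2 : ℝ) := by gcongr
      _ = 2 * Real.sqrt 2 := rpow_three_halves (by norm_num)
      _ ≤ 2 * (3 / 2) := by
        gcongr
        rw [Real.sqrt_le_left (by norm_num)]; norm_num
      _ = 3 := by norm_num
  have : 0 ≤ |x₁| ^ 2 := by positivity
  nlinarith

/-- The modulation `a₂` of the low frequency keeps its full power. The decay in `a` is charged to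
the kernel with `x₁` frozen and the decay in `a₁` to the one with the output frozen, so that both
use a bump in the low variable `x₂`. The product decay goes to the kernel with `x₂` frozen. -/
lemma low_combine {V : ℝ → ℝ → ℝ} (hV : ∀ x y, 0 ≤ V x y) {F N K K₁ K₂ c : ℝ} (h : 1 ≤ a)
    (h₁ : 1 ≤ a₁) (h₂ : 1 ≤ a₂) (hc : 0 ≤ c) (hF : F ≤ 12 * N ^ 2) (hK : N ^ 2 * a₂⁻¹ ≤ K)
    (hdich : K * (a₁ * a) ^ (-(15 / 16) : ℝ) ≤ K₁ * dec (a₁ * a) + K₂ * (dec a₁ + dec a))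
    (hK₁ : K₁ ≤ c * dd x₁ x) (hK₂ : K₂ ≤ c * V x₁ x₂) (hK₃ : K₂ ≤ c * V x x₂) :
    F * (a ^ (-(15 / 16) : ℝ) * a₁⁻¹ * a₂⁻¹) ≤ 12 * c * krSum V x₁ x₂ x a₁ a₂ a := by
  have hP := modulation_bound_in_sharp h h₂ h₁
  have q0 : 0 ≤ (a₁ * a) ^ (-(15 / 16) : ℝ) := Real.rpow_nonneg (by nlinarith) _
  have q1 : 0 ≤ a ^ (-(15 / 16) : ℝ) := Real.rpow_nonneg (by linarith) _
  have d1 := dec_nonneg (show 0 ≤ a by linarith)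
  have d2 := dec_nonneg (show 0 ≤ a₁ by linarith)
  have d3 := dec_nonneg (show 0 ≤ a₂ by linarith)
  have d4 := dec_nonneg (show 0 ≤ a₁ * a by nlinarith)
  have c1 := bump_dec_le_kr (x := x₁) (y := x₂) (w := x) hV h₂ h
  have c2 := dd_dec_le_kr (x := x₂) (y := x₁) (w := x) hV h₁ h
  have c3 : V x x₂ * (dec a₂ + dec a₁) ≤ kr V x x₁ x₂ a₁ a₂ := by
    rw [kr_comm]; exact bump_dec_le_kr hV h₂ h₁
  have c1' : V x₁ x₂ * dec a ≤ kr V x₁ x₂ x a₂ a :=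
    (mul_le_mul_of_nonneg_left (by linarith) (hV _ _)).trans c1
  have c3' : V x x₂ * dec a₁ ≤ kr V x x₁ x₂ a₁ a₂ :=
    (mul_le_mul_of_nonneg_left (by linarith) (hV _ _)).trans c3
  have i1 : 0 ≤ a₁⁻¹ := inv_nonneg.2 (by linarith)
  have i2 : 0 ≤ a₂⁻¹ := inv_nonneg.2 (by linarith)
  calc F * (a ^ (-(15 / 16) : ℝ) * a₁⁻¹ * a₂⁻¹)
      ≤ (12 * N ^ 2) * (a ^ (-(15 / 16) : ℝ) * a₁⁻¹ * a₂⁻¹) := by gcongr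
    _ = (12 * N ^ 2) * (a ^ (-(15 / 16) : ℝ) * a₂⁻¹ * a₁⁻¹) := by ring
    _ ≤ (12 * N ^ 2) * (a₂⁻¹ * (a₁ * a) ^ (-(15 / 16) : ℝ)) := by gcongr
    _ = 12 * ((N ^ 2 * a₂⁻¹) * (a₁ * a) ^ (-(15 / 16) : ℝ)) := by ring
    _ ≤ 12 * (K * (a₁ * a) ^ (-(15 / 16) : ℝ)) := by gcongr
    _ ≤ 12 * (K₁ * dec (a₁ * a) + K₂ * dec a₁ + K₂ * dec a) := by linarith
    _ ≤ 12 * ((c * dd x₁ x) * dec (a₁ * a) + (c * V x x₂) * dec a₁ +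
          (c * V x₁ x₂) * dec a) := by gcongr
    _ = 12 * c * (dd x₁ x * dec (a₁ * a) + V x x₂ * dec a₁ + V x₁ x₂ * dec a) := by ring
    _ ≤ 12 * c * krSum V x₁ x₂ x a₁ a₂ a := by
        refine mul_le_mul_of_nonneg_left ?_ (by positivity)
        unfold krSum
        linarith

lemma sqrt_le_VV {X y N : ℝ} (hN : 0 < N) (h : 3 / 4 * N ≤ |X|) (h' : |X| ≤ 5 / 4 * N)
    (hy : Real.sqrt N * |y| ≤ 1) : Real.sqrt N ≤ 72 * VV X y := by
  have b := (le_VV X y).2.2.2.1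
  have h1 : Real.sqrt N ≤ 2 * Real.sqrt |X| := by
    rw [show (2 : ℝ) = Real.sqrt (2 ^ 2) by simp, ← Real.sqrt_mul (by norm_num)]
    apply Real.sqrt_le_sqrt; linarith
  have h2 : Real.sqrt |X| ≤ 2 * Real.sqrt N := by
    rw [show (2 : ℝ) = Real.sqrt (2 ^ 2) by simp, ← Real.sqrt_mul (by norm_num)]
    apply Real.sqrt_le_sqrt; linarith
  have h3 := le_bump (β := Real.sqrt |X|) (y₀ := 0) (y := y) (Real.sqrt_nonneg _) (by
    rw [sub_zero, abs_mul, abs_abs, abs_of_nonneg (Real.sqrt_nonneg _)]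
    calc _ ≤ 2 * Real.sqrt N * |y| := by gcongr
      _ ≤ 5 := by linarith)
  linarith

lemma sqrt_mul_le_VV {X y N : ℝ} (hN : 0 < N) (h : 3 / 4 * N ≤ |X|) (h' : |X| ≤ 5 / 4 * N)
    (hy : 1 ≤ Real.sqrt N * |y|) :
    Real.sqrt N * ((Real.sqrt N * |y|) ^ 3)⁻¹ ≤ 64 * VV X y := by
  have b := (le_VV X y).2.2.2.1
  set s := Real.sqrt N
  have h1 : s ≤ 2 * Real.sqrt |X| := by
    rw [show (2 : ℝ) = Real.sqrt (2 ^ 2) by simp, ← Real.sqrt_mul (by norm_num)]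
    apply Real.sqrt_le_sqrt; linarith
  have h2 : Real.sqrt |X| ≤ 2 * s := by
    rw [show (2 : ℝ) = Real.sqrt (2 ^ 2) by simp, ← Real.sqrt_mul (by norm_num)]
    apply Real.sqrt_le_sqrt; linarith
  have h3 := le_bump_of_one_le (β := Real.sqrt |X|) (y₀ := 0) (y := y) (Real.sqrt_nonneg _)
    (show 1 ≤ 2 * (s * |y|) by linarith) (by
    rw [sub_zero, abs_mul, abs_abs, abs_of_nonneg (Real.sqrt_nonneg _)]
    calc _ ≤ 2 * s * |y| := by gcongr
      _ = _ := by ring)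
  have e : ((s * |y|) ^ 3)⁻¹ = 8 * ((2 * (s * |y|)) ^ 3)⁻¹ := by
    rw [mul_pow 2, mul_inv]; norm_num; ring
  have i : 0 ≤ ((2 * (s * |y|)) ^ 3)⁻¹ := by positivity
  calc s * ((s * |y|) ^ 3)⁻¹ ≤ (2 * Real.sqrt |X|) * (8 * ((2 * (s * |y|)) ^ 3)⁻¹) := by
        rw [e]; gcongr
    _ = 16 * (Real.sqrt |X| * ((2 * (s * |y|)) ^ 3)⁻¹) := by ring
    _ ≤ 16 * (4 * bump (Real.sqrt |X|) 0 y) := by gcongr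
    _ ≤ _ := by linarith

lemma two_mul_le_dd (hx : x = x₁ + x₂) (hN : 4 ≤ |x₁|) (hm : |x₂| ≤ |x₁| / 4) :
    |x₂| * |x₁| ≤ dd x₁ x := by
  have hxb : |x₁| ≤ |x| + |x₂| := by
    rw [show x₁ = x - x₂ by rw [hx]; ring]; exact abs_sub _ _
  have h2 : 1 ≤ (x₁ * x) ^ 2 := by
    rw [← sq_abs, abs_mul]
    have : 1 ≤ |x₁| * |x| := by nlinarith
    nlinarith
  have h3 := two_le_of_one_le h2
  have h4 : |x₂| * |x₁| ≤ |x₁ ^ 2 - x ^ 2| := by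
    rw [show x₁ ^ 2 - x ^ 2 = -(x₂ * (x₁ + x)) by rw [hx]; ring, abs_neg, abs_mul]
    refine mul_le_mul_of_nonneg_left ?_ (abs_nonneg _)
    have : 2 * |x₁| ≤ |x₁ + x| + |x₂| := by
      rw [show 2 * |x₁| = |x₁ + x - x₂| by rw [hx, ← abs_two, ← abs_mul]; congr 1; ring]
      exact abs_sub _ _
    linarith
  unfold dd
  nlinarith [abs_nonneg (x₁ ^ 2 - x ^ 2)]

/-- `hD` places the low frequency essentially in `D`. If `√N |x₂| ≤ 1`, it gives `N² a₂⁻¹ ≤ 2 √N`,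
the height of a bump. Otherwise the resonance gives `N² a₂⁻¹ ≲ 1/|x₂|`, and `dichotomy` with `r = N
x₂²` splits this between `dd` and the tail of the bump. -/
lemma low_frozen_in_D (hx : x = x₁ + x₂) (h : 1 ≤ a) (h₁ : 1 ≤ a₁) (h₂ : 1 ≤ a₂)
    (hN : 4 ≤ |x₁|) (hm : |x₂| ≤ 1) (hx₂ : x₂ ≠ 0) (hA : |x * x₁ * x₂| ≤ a₂)
    (hD : 1 ≤ 2 * a₂ * |x₂| ^ 3) :
    freqW x₁ x₂ x * (a ^ (-(15 / 16) : ℝ) * a₁⁻¹ * a₂⁻¹) ≤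
      100000 * krSum VV x₁ x₂ x a₁ a₂ a := by
  have k0 := (krSum_ge (x₁ := x₁) (x₂ := x₂) (x := x) VV_nonneg h h₁ h₂).1
  have hxa : |x| ≤ |x₁| + |x₂| := by rw [hx]; exact abs_add_le _ _
  have hxb : |x₁| ≤ |x| + |x₂| := by
    rw [show x₁ = x - x₂ by rw [hx]; ring]; exact abs_sub _ _
  have hF := freqW_le_low hx hN hm
  have hdd := two_mul_le_dd hx hN (by linarith)
  have hm0 : 0 < |x₂| := abs_pos.2 hx₂
  have hN0 : 0 < |x₁| := by linarith
  have hd0 := dd_nonneg x₁ x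
  set N := |x₁|
  set m := |x₂|
  set s := Real.sqrt N with hs
  have hs0 : 0 < s := Real.sqrt_pos.2 hN0
  have hss : s ^ 2 = N := Real.sq_sqrt hN0.le
  rcases le_total (s * m) 1 with hsm | hsm
  · have f1 := sqrt_le_VV (X := x₁) hN0 (by linarith) (by linarith) hsm
    have f3 := sqrt_le_VV (X := x) hN0 (by linarith) (by linarith) hsm
    have ha₂ : N ^ 2 * a₂⁻¹ ≤ 2 * s := by
      have e1 : a₂⁻¹ ≤ 2 * m ^ 3 := by
        rw [inv_le_iff_one_le_mul₀ (by linarith)]; linarith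
      calc N ^ 2 * a₂⁻¹ ≤ N ^ 2 * (2 * m ^ 3) := by gcongr
        _ = 2 * s * (s * m) ^ 3 := by rw [← hss]; ring
        _ ≤ 2 * s * 1 ^ 3 := by gcongr
        _ = 2 * s := by ring
    have e2 := rpow_le_dec_add h₁ h
    have := low_combine (x₁ := x₁) (x₂ := x₂) (x := x) VV_nonneg (c := 144) (K₁ := 0) (K₂ := 2 * s) h h₁ h₂ (by norm_num) hF ha₂
      (by rw [zero_mul, zero_add]; gcongr) (by linarith) (by linarith) (by linarith)
    linarith
  · have ha₂ : N ^ 2 * a₂⁻¹ ≤ 4 / 3 / m := by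
      rw [abs_mul, abs_mul] at hA
      have : 3 / 4 * N ^ 2 * m ≤ a₂ := by
        refine le_trans ?_ hA
        calc 3 / 4 * N ^ 2 * m = (3 / 4 * N) * N * m := by ring
          _ ≤ _ := by
            gcongr
            linarith
      rw [← div_eq_mul_inv, div_le_div_iff₀ (by linarith) hm0]
      linarith
    set r := (s * m) ^ 2 with hr
    have hr1 : 1 ≤ r := by rw [hr]; exact one_le_pow₀ hsm
    have e2 := dichotomy h₁ h hr1
    have f1 : s * ((s * m) ^ 3)⁻¹ ≤ _ := sqrt_mul_le_VV (X := x₁) hN0 (by linarith) (by linarith) hsm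
    have f3 : s * ((s * m) ^ 3)⁻¹ ≤ _ := sqrt_mul_le_VV (X := x) hN0 (by linarith) (by linarith) hsm
    have g0 : 1 / m * (r ^ 3)⁻¹ ≤ s * ((s * m) ^ 3)⁻¹ := by
      have e : 1 / m * (r ^ 3)⁻¹ = s * ((s * m) ^ 7)⁻¹ := by rw [hr]; field_simp
      rw [e]
      gcongr
      norm_num
    have g2 : 1 / m * r = m * N := by rw [hr, mul_pow, hss]; field_simp
    have e3 : 4 / 3 / m = 4 / 3 * (1 / m) := by ring
    have := low_combine (x₁ := x₁) (x₂ := x₂) (x := x) VV_nonneg (c := 100) (K₁ := 4 / 3 * (1 / m * r))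
      (K₂ := 4 / 3 * (1 / m * (r ^ 3)⁻¹)) h h₁ h₂ (by norm_num) hF ha₂
      (by
        rw [e3]
        calc _ ≤ 4 / 3 * (1 / m) *
              (r * dec (a₁ * a) + (r ^ 3)⁻¹ * (dec a₁ + dec a)) := by gcongr
          _ = _ := by ring)
      (by rw [g2]; linarith) (by linarith [VV_nonneg x₁ x₂]) (by linarith [VV_nonneg x x₂])
    linarith

end Master

/-! ### Bounds of the multiplier, generic and exceptional. -/

section Cases

variable {x₁ x₂ x a₁ a₂ a : ℝ}

/-- With `x₁` frozen, `x₂² - x² = -x₁ (x₁ + 2 x₂)`, which degenerates at the half-frequency. -/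
lemma mul_abs_sub_le (hx : x = x₁ + x₂) :
    |x₁| * |(|x₁| - 2 * |x₂|)| ≤ |x₂ ^ 2 - x ^ 2| := by
  rw [show x₂ ^ 2 - x ^ 2 = -(x₁ * (x₁ - -(2 * x₂))) by rw [hx]; ring, abs_neg, abs_mul]
  refine mul_le_mul_of_nonneg_left ?_ (abs_nonneg _)
  have := abs_abs_sub_abs_le_abs_sub x₁ (-(2 * x₂))
  rwa [abs_neg, abs_mul, abs_two] at this

/-- `freqW` is of order at most `N³ √|x₁|`. The modulation `a₁ ≳ N³` cancels `N³` and has nothing to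
spare, so `comparable_bound` must cope with the exponents `-15/16`. -/
lemma comparable_frozen_in {N : ℝ} (hx : x = x₁ + x₂) (h : 1 ≤ a) (h₁ : 1 ≤ a₁) (h₂ : 1 ≤ a₂)
    (hN : 4 ≤ N) (n₁ : |x₁| ≤ N) (n₂ : |x₂| ≤ N) (m₁ : N / 4 ≤ |x₁|) (m₂ : N / 4 ≤ |x₂|)
    (m : N / 4 ≤ |x|) (hA : N ^ 3 / 16 ≤ a₁) :
    freqW x₁ x₂ x * (a ^ (-(15 / 16) : ℝ) * a₁⁻¹ * a₂⁻¹) ≤ 100000 * kr VV x₁ x₂ x a₂ a := by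
  have hF := freqW_le_high_high (x := x) hN n₁ n₂
  have hs := sq_mul_jap_rpow_le x
  have hxa : |x| ≤ |x₁| + |x₂| := by rw [hx]; exact abs_add_le _ _
  have hc := comparable_bound (x := x₁) (y := x₂) (w := x) (by linarith)
    (by
      rw [← sq_abs, abs_mul]
      exact one_le_pow₀ (one_le_mul_of_one_le_of_one_le (by linarith) (by linarith)))
    (mul_abs_sub_le hx) h₂ h
  have hP := modulation_bound_in_sharp h h₁ h₂
  have e1 : Real.sqrt |x| ≤ 3 * Real.sqrt |x₁| := by
    rw [show (3 : ℝ) = Real.sqrt (3 ^ 2) by simp, ← Real.sqrt_mul (by norm_num)]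
    apply Real.sqrt_le_sqrt; linarith
  have e2 : N ^ 3 * a₁⁻¹ ≤ 16 := by
    rw [← div_eq_mul_inv, div_le_iff₀ (by linarith)]; linarith
  have q0 : 0 ≤ (a₂ * a) ^ (-(15 / 16) : ℝ) := Real.rpow_nonneg (by nlinarith) _
  have q1 : 0 ≤ a ^ (-(15 / 16) : ℝ) := Real.rpow_nonneg (by linarith) _
  have i1 : 0 ≤ a₁⁻¹ := inv_nonneg.2 (by linarith)
  have i2 : 0 ≤ a₂⁻¹ := inv_nonneg.2 (by linarith)
  have hN0 : 0 ≤ N := by linarith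
  calc freqW x₁ x₂ x * (a ^ (-(15 / 16) : ℝ) * a₁⁻¹ * a₂⁻¹)
      ≤ (4 * N ^ 3 * (3 * Real.sqrt |x₁|)) * (a ^ (-(15 / 16) : ℝ) * a₁⁻¹ * a₂⁻¹) := by
        refine mul_le_mul_of_nonneg_right (hF.trans ?_) (by positivity)
        exact mul_le_mul_of_nonneg_left (hs.trans e1) (by positivity)
    _ ≤ (4 * N ^ 3 * (3 * Real.sqrt |x₁|)) * (a₁⁻¹ * (a₂ * a) ^ (-(15 / 16) : ℝ)) := by gcongr
    _ = 12 * (N ^ 3 * a₁⁻¹) * (Real.sqrt |x₁| * (a₂ * a) ^ (-(15 / 16) : ℝ)) := by ring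
    _ ≤ 12 * 16 * (100 * kr VV x₁ x₂ x a₂ a) := by gcongr
    _ ≤ _ := by
      have := kr_nonneg (x := x₁) (y := x₂) (w := x) VV_nonneg h₂ h
      linarith

/-- The pointwise bound of the multiplier outside the two exceptional regions. -/
theorem generic_bound (hx : x = x₁ + x₂) (z₁ : x₁ ≠ 0) (z₂ : x₂ ≠ 0) (z : x ≠ 0)
    (h : 1 ≤ a) (h₁ : 1 ≤ a₁) (h₂ : 1 ≤ a₂) (h21 : |x₂| ≤ |x₁|)
    (hres : ∀ A, a ≤ A → a₁ ≤ A → a₂ ≤ A → |x * x₁ * x₂| ≤ A ∧ |x₁| ≤ A ∧ |x₂| ≤ A)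
    (hHH : ¬ IsHighHigh x₁ x₂ a₁ a₂ a) (hLH : ¬ IsLowHigh x₁ x₂ a₁ a₂ a) :
    freqW x₁ x₂ x * (a ^ (-(15 / 16) : ℝ) * a₁⁻¹ * a₂⁻¹) ≤
      100000 * krSum VV x₁ x₂ x a₁ a₂ a := by
  rcases le_total |x₁| 4 with hN | hN
  · exact low_case hx h h₁ h₂ hN (h21.trans hN)
  obtain ⟨k0, k1, k2, k3⟩ := krSum_ge (x₁ := x₁) (x₂ := x₂) (x := x) VV_nonneg h h₁ h₂
  have hF := freqW_nonneg x₁ x₂ x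
  have hxa : |x| ≤ |x₁| + |x₂| := by rw [hx]; exact abs_add_le _ _
  have hxb : |x₁| ≤ |x| + |x₂| := by
    rw [show x₁ = x - x₂ by rw [hx]; ring]; exact abs_sub _ _
  have hxc : |x₂| ≤ |x| + |x₁| := by
    rw [show x₂ = x - x₁ by rw [hx]; ring]; exact abs_sub _ _
  have m0 : 0 < |x₂| := abs_pos.2 z₂
  rcases le_total |x₂| (|x₁| / 4) with hm | hm
  · have hFl := freqW_le_high_low (x₂ := x₂) hN (show |x| ≤ 5 / 4 * |x₁| by linarith)
    have hjap : ∀ {A}, 1 ≤ A → |x * x₁ * x₂| ≤ A → jap x₂ ^ 2 ≤ 2 * A := by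
      intro A hA1 hA
      rw [jap_sq, ← sq_abs]
      rcases le_total |x₂| 1 with hx1 | hx1
      · nlinarith
      · rw [abs_mul, abs_mul] at hA
        have : |x₂| ≤ |x| * |x₁| := by nlinarith
        nlinarith
    apply krSum_of_frozen h h₁ h₂ hF
    · intro e1 e2
      obtain ⟨r1, r2, -⟩ := hres a le_rfl e1 e2
      have := high_low_bound (x := x) (y := x₂) (w := x₁) hN (by linarith) (by linarith)
        (by linarith) (by linarith) (by linarith) z₂ hm r2 (hjap h r1)
      rw [dd_comm] at this
      have v := VV_nonneg x x₁
      have d := dd_nonneg x₁ x₂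
      have v2 := VV_nonneg x x₂
      refine (mul_le_mul_of_nonneg_right hFl (Real.rpow_nonneg (by linarith) _)).trans ?_
      linarith
    · intro e1 e2
      obtain ⟨r1, r2, -⟩ := hres a₁ e1 le_rfl e2
      have := high_low_bound (x := x₁) (y := x₂) (w := x) hN (by linarith) (by linarith)
        (by linarith) (by linarith) (by linarith) z₂ hm r2 (hjap h₁ r1)
      have v := VV_nonneg x₁ x
      have d := dd_nonneg x₂ x
      have v2 := VV_nonneg x₁ x₂
      refine (mul_le_mul_of_nonneg_right hFl (Real.rpow_nonneg (by linarith) _)).trans ?_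
      linarith
    · intro e1 e2
      obtain ⟨r1, r2, -⟩ := hres a₂ e1 e2 le_rfl
      -- With the largest modulation on the low frequency and `|x₂| ≤ 1`, the negation of
      -- `IsLowHigh` is exactly `1 ≤ 2 a₂ |x₂|³`.
      rcases le_total |x₂| 1 with hx1 | hx1
      · have : 1 ≤ 2 * a₂ * |x₂| ^ 3 := by
          by_contra hcon
          exact hLH ⟨hN, hx1, e2, e1, not_le.1 hcon⟩
        exact low_frozen_in_D hx h h₁ h₂ hN hx1 z₂ r1 this
      · apply krSum_of_frozen_second h h₁ h₂ hF e1 e2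
        have := low_frozen_bound hx hN hx1 hm r1
        have v := VV_nonneg x₂ x
        have d := dd_nonneg x₁ x
        have v2 := VV_nonneg x₂ x₁
        refine (mul_le_mul_of_nonneg_right hFl (Real.rpow_nonneg (by linarith) _)).trans ?_
        linarith
  · have hnot : ¬ (a₁ ≤ a ∧ a₂ ≤ a) := fun e => hHH ⟨hN, h21, hm, e.1, e.2⟩
    rcases le_total (|x₁| / 4) |x| with hM | hM
    · have hcube : |x₁| ^ 3 / 16 ≤ |x * x₁ * x₂| := by
        rw [abs_mul, abs_mul]
        calc |x₁| ^ 3 / 16 = |x₁| / 4 * |x₁| * (|x₁| / 4) := by ring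
          _ ≤ _ := by gcongr
      rcases exists_max a₁ a₂ a with e | ⟨e1, e2⟩ | ⟨e1, e2⟩
      · exact absurd e hnot
      · obtain ⟨r1, -, -⟩ := hres a₁ e1 le_rfl e2
        have := comparable_frozen_in hx h h₁ h₂ hN le_rfl h21 (by linarith) hm hM (by linarith)
        linarith
      · obtain ⟨r1, -, -⟩ := hres a₂ e2 e1 le_rfl
        have := comparable_frozen_in (x₁ := x₂) (x₂ := x₁) (by rw [hx]; ring) h h₂ h₁ hN h21 le_rfl
          hm (by linarith) hM (by linarith)
        rw [freqW_comm] at this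
        calc _ = freqW x₁ x₂ x * (a ^ (-(15 / 16) : ℝ) * a₂⁻¹ * a₁⁻¹) := by ring
          _ ≤ _ := by linarith
    · have hFl := freqW_le_high_high (x := x) hN le_rfl h21
      apply krSum_of_frozen h h₁ h₂ hF
      · exact fun e1 e2 => absurd ⟨e1, e2⟩ hnot
      · intro e1 e2
        obtain ⟨r1, -, -⟩ := hres a₁ e1 le_rfl e2
        have := high_high_bound (x₁ := x₁) (x₂ := x₂) hN le_rfl (by linarith) (by linarith) hM z
          r1 h₁
        have v := VV_nonneg x₁ x
        have d := dd_nonneg x₂ x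
        have v2 := VV_nonneg x₁ x₂
        refine (mul_le_mul_of_nonneg_right hFl (Real.rpow_nonneg (by linarith) _)).trans ?_
        linarith
      · intro e1 e2
        obtain ⟨r1, -, -⟩ := hres a₂ e1 e2 le_rfl
        apply krSum_of_frozen_second h h₁ h₂ hF e1 e2
        have := high_high_bound (x₁ := x₂) (x₂ := x₁) (x := x) hN h21 (by linarith) (by linarith)
          hM z (by rwa [mul_right_comm]) h₂
        have v := VV_nonneg x₂ x
        have d := dd_nonneg x₁ x
        have v2 := VV_nonneg x₂ x₁
        refine (mul_le_mul_of_nonneg_right hFl (Real.rpow_nonneg (by linarith) _)).trans ?_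
        linarith

/-- As a function of `L` this is a combination of `L^(-15/16)` and `L^(-17/16)` with positive
coefficients, so a lower bound for the modulation may be inserted. -/
lemma inv_mul_rho_anti {L l' l : ℝ} (h' : 0 < l') (hl : 0 < l) (h : l' ≤ L) :
    L⁻¹ * rho L l ≤ l'⁻¹ * rho l' l := by
  have hL : 0 < L := h'.trans_le h
  have e : ∀ {L : ℝ}, 0 < L → L⁻¹ * rho L l =
      L ^ (-(15 / 16) : ℝ) * l ^ (-(1 / 16) : ℝ) + L ^ (-(17 / 16) : ℝ) * l ^ (1 / 16 : ℝ) := by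
    intro L hL
    unfold rho
    rw [Real.div_rpow hL.le hl.le, Real.div_rpow hl.le hL.le, mul_add, ← Real.rpow_neg_one L,
      show (-(15 / 16) : ℝ) = -1 + 1 / 16 by norm_num,
      show (-(17 / 16) : ℝ) = -1 + -(1 / 16) by norm_num, Real.rpow_add hL, Real.rpow_add hL,
      Real.rpow_neg hl.le, Real.rpow_neg hL.le (1 / 16)]
    ring
  rw [e hL, e h']
  have h1 := Real.rpow_le_rpow_of_nonpos h' h (show (-(15 / 16) : ℝ) ≤ 0 by norm_num)
  have h2 := Real.rpow_le_rpow_of_nonpos h' h (show (-(17 / 16) : ℝ) ≤ 0 by norm_num)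
  gcongr

/-- Localizing the output at modulation one costs a power `1/16`; this is the origin of the exponent
`-15/16` in the generic bound. -/
lemma inv_mul_rho_one_le (h : 1 ≤ a) : a⁻¹ * rho a 1 ≤ 2 * a ^ (-(15 / 16) : ℝ) := by
  have h0 : 0 < a := by linarith
  unfold rho
  rw [div_one, show (-(15 / 16) : ℝ) = -1 + 1 / 16 by norm_num, Real.rpow_add h0, Real.rpow_neg_one]
  have : (1 / a) ^ (1 / 16 : ℝ) ≤ a ^ (1 / 16 : ℝ) := by
    have : 1 / a ≤ a := by rw [div_le_iff₀ h0]; nlinarith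
    gcongr
  have i := inv_pos.2 h0
  nlinarith

/-- Comparable frequencies, with the largest modulation on the output. -/
theorem comparable_out_bound (hx : x = x₁ + x₂) (h₁ : 1 ≤ a₁) (h₂ : 1 ≤ a₂)
    (hA : |x * x₁ * x₂| ≤ a) (hH : IsHighHigh x₁ x₂ a₁ a₂ a) (hM : |x₁| / 4 ≤ |x|) :
    freqW x₁ x₂ x * (a⁻¹ * a₁⁻¹ * a₂⁻¹) * rho a (jap x ^ 3) ≤
      10000000 * krSum VV x₁ x₂ x a₁ a₂ a := by
  obtain ⟨hN, n₂, m₂, ha₁, ha₂⟩ := hH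
  have h : 1 ≤ a := h₁.trans ha₁
  obtain ⟨k0, k1, k2, k3⟩ := krSum_ge (x₁ := x₁) (x₂ := x₂) (x := x) VV_nonneg h h₁ h₂
  have hF := freqW_le_high_high (x := x) hN le_rfl n₂
  have hs := sq_mul_jap_rpow_le x
  have hxa : |x| ≤ |x₁| + |x₂| := by rw [hx]; exact abs_add_le _ _
  have hc := comparable_bound (x := x) (y := x₁) (w := x₂) (by linarith)
    (by
      rw [← sq_abs, abs_mul]
      exact one_le_pow₀ (one_le_mul_of_one_le_of_one_le (by linarith) (by linarith)))
    (by
      have := mul_abs_sub_le (x₁ := x) (x₂ := -x₁) (x := x₂) (by rw [hx]; ring)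
      rwa [abs_neg, neg_sq] at this) h₁ h₂
  have hP := inv_mul_le_rpow h₁ h₂
  set N := |x₁|
  have hN0 : 0 < N := by linarith
  -- The lower bound of the resonance for `a`. It is comparable with `jap x ^ 3`, since `|x|` is
  -- comparable with `N`.
  set l := N ^ 3 / 16 with hl
  have hl0 : 0 < l := by positivity
  have hla : l ≤ a := by
    refine le_trans ?_ hA
    rw [abs_mul, abs_mul]
    calc N ^ 3 / 16 = N / 4 * N * (N / 4) := by ring
      _ ≤ _ := by gcongr
  have hj1 : jap x ≤ 3 * N := (jap_le_one_add_abs _).trans (by linarith)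
  have hj2 : N / 4 ≤ jap x := hM.trans (abs_le_jap x)
  have hj0 := jap_pos x
  have hr : rho a (jap x ^ 3) ≤ 432 * rho a l := by
    apply rho_le_of_le (by linarith) (by positivity) hl0 (by norm_num)
    · calc jap x ^ 3 ≤ (3 * N) ^ 3 := by gcongr
        _ = _ := by rw [hl]; ring
    · calc l = 4 * (N / 4) ^ 3 := by rw [hl]; ring
        _ ≤ 4 * jap x ^ 3 := by gcongr
        _ ≤ _ := by have : 0 ≤ jap x ^ 3 := by positivity
                    linarith
  have hi := inv_mul_rho_le hl0 hla
  have i0 : 0 ≤ a⁻¹ := inv_nonneg.2 (by linarith)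
  have i1 : 0 ≤ a₁⁻¹ := inv_nonneg.2 (by linarith)
  have i2 : 0 ≤ a₂⁻¹ := inv_nonneg.2 (by linarith)
  have r0 := (rho_pos (show 0 < a by linarith) (show 0 < jap x ^ 3 by positivity)).le
  have hlN : N ^ 3 * l⁻¹ = 16 := by rw [hl]; field_simp
  calc freqW x₁ x₂ x * (a⁻¹ * a₁⁻¹ * a₂⁻¹) * rho a (jap x ^ 3)
      ≤ (4 * N ^ 3 * Real.sqrt |x|) * (a⁻¹ * a₁⁻¹ * a₂⁻¹) * (432 * rho a l) := by
        gcongr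
        exact hF.trans (mul_le_mul_of_nonneg_left hs (by positivity))
    _ = 1728 * N ^ 3 * (a⁻¹ * rho a l) * (Real.sqrt |x| * (a₁⁻¹ * a₂⁻¹)) := by ring
    _ ≤ 1728 * N ^ 3 * (2 * l⁻¹) * (Real.sqrt |x| * (a₁ * a₂) ^ (-(15 / 16) : ℝ)) := by gcongr
    _ = 3456 * (N ^ 3 * l⁻¹) * (Real.sqrt |x| * (a₁ * a₂) ^ (-(15 / 16) : ℝ)) := by ring
    _ ≤ 3456 * (N ^ 3 * l⁻¹) * (100 * kr VV x x₁ x₂ a₁ a₂) := by gcongr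
    _ ≤ _ := by rw [hlN]; linarith

/-- The bump of width `2 ^ k / x ^ 2`. -/
def shellBump (k : ℕ) (x y : ℝ) : ℝ := bump (x ^ 2 * ((2 : ℝ) ^ k)⁻¹) 0 y

lemma shellBump_nonneg (k : ℕ) (x y : ℝ) : 0 ≤ shellBump k x y :=
  bump_nonneg (mul_nonneg (sq_nonneg x) (by positivity)) _ _

/-- A high frequency and a low frequency with modulation about `2 ^ k`. -/
theorem low_high_bound {k : ℕ} (hx : x = x₁ + x₂) (h : 1 ≤ a) (h₁ : 1 ≤ a₁) (h₂ : 1 ≤ a₂)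
    (hA : |x * x₁ * x₂| ≤ a₂) (hL : IsLowHigh x₁ x₂ a₁ a₂ a) (hk : (2 : ℝ) ^ k ≤ a₂)
    (hk' : a₂ < 2 ^ (k + 1)) :
    freqW x₁ x₂ x * (a⁻¹ * a₁⁻¹ * a₂⁻¹) * rho a 1 ≤
      10000000 * krSum (shellBump k) x₁ x₂ x a₁ a₂ a := by
  obtain ⟨hN, hm, -, -, -⟩ := hL
  have k0 := (krSum_ge (x₁ := x₁) (x₂ := x₂) (x := x) (shellBump_nonneg k) h h₁ h₂).1
  have hF := freqW_le_low hx hN hm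
  have hF0 := freqW_nonneg x₁ x₂ x
  have hxa : |x| ≤ |x₁| + |x₂| := by rw [hx]; exact abs_add_le _ _
  have hxb : |x₁| ≤ |x| + |x₂| := by
    rw [show x₁ = x - x₂ by rw [hx]; ring]; exact abs_sub _ _
  have hρ := inv_mul_rho_one_le h
  set N := |x₁| with hNd
  set Q : ℝ := 2 ^ k with hQ
  have hQ0 : 0 < Q := by positivity
  -- The resonance together with `a₂ < 2^(k+1)` confines `|x₂|` to order `2^k / N²`, the width of
  -- `shellBump k`.
  have hNm : N ^ 2 * |x₂| * Q⁻¹ ≤ 8 / 3 := by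
    rw [← div_eq_mul_inv, div_le_iff₀ hQ0]
    rw [abs_mul, abs_mul] at hA
    have : 3 / 4 * N * N * |x₂| ≤ |x| * N * |x₂| := by
      gcongr
      linarith
    have : (2 : ℝ) ^ (k + 1) = 2 * Q := by rw [hQ]; ring
    nlinarith
  have hbump : ∀ X : ℝ, 3 / 4 * N ≤ |X| → |X| ≤ 5 / 4 * N → N ^ 2 * Q⁻¹ ≤ 64 * shellBump k X x₂ := by
    intro X h1 h2
    have e1 : X ^ 2 ≤ 25 / 16 * N ^ 2 := by
      rw [← sq_abs]; nlinarith [abs_nonneg X]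
    have e2 : 9 / 16 * N ^ 2 ≤ X ^ 2 := by
      rw [← sq_abs X]; nlinarith
    have := le_bump (β := X ^ 2 * Q⁻¹) (y₀ := 0) (y := x₂) (by positivity) (by
      rw [sub_zero, abs_of_nonneg (by positivity)]
      calc X ^ 2 * Q⁻¹ * |x₂| ≤ (25 / 16 * N ^ 2) * Q⁻¹ * |x₂| := by gcongr
        _ = 25 / 16 * (N ^ 2 * |x₂| * Q⁻¹) := by ring
        _ ≤ 5 := by linarith)
    have e3 : 9 / 16 * (N ^ 2 * Q⁻¹) ≤ X ^ 2 * Q⁻¹ := by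
      rw [← mul_assoc]; gcongr
    unfold shellBump
    linarith
  -- The power `a₂⁻¹ ≤ 2^(-k)` produces just the height `N² 2^(-k)` of the bump, and transversality
  -- is not used: hence `K₁ = 0`.
  have hlc := low_combine (x₁ := x₁) (x₂ := x₂) (x := x) (shellBump_nonneg k) (c := 64) (K₁ := 0)
    (K := N ^ 2 * Q⁻¹) (K₂ := N ^ 2 * Q⁻¹) h h₁ h₂ (by norm_num) hF (by gcongr)
    (by
      rw [zero_mul, zero_add]
      exact mul_le_mul_of_nonneg_left (rpow_le_dec_add h₁ h) (by positivity))
    (by have := dd_nonneg x₁ x; linarith) (hbump x₁ (by linarith) (by linarith))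
    (hbump x (by linarith) (by linarith))
  have i1 : 0 ≤ a₁⁻¹ := inv_nonneg.2 (by linarith)
  have i2 : 0 ≤ a₂⁻¹ := inv_nonneg.2 (by linarith)
  calc freqW x₁ x₂ x * (a⁻¹ * a₁⁻¹ * a₂⁻¹) * rho a 1
      = freqW x₁ x₂ x * ((a⁻¹ * rho a 1) * a₁⁻¹ * a₂⁻¹) := by ring
    _ ≤ freqW x₁ x₂ x * ((2 * a ^ (-(15 / 16) : ℝ)) * a₁⁻¹ * a₂⁻¹) := by gcongr
    _ = 2 * (freqW x₁ x₂ x * (a ^ (-(15 / 16) : ℝ) * a₁⁻¹ * a₂⁻¹)) := by ring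
    _ ≤ _ := by linarith

lemma freqW_le_cube (hH : IsHighHigh x₁ x₂ a₁ a₂ a) :
    freqW x₁ x₂ x ≤ 4 * |x₁| ^ 3 * |x| ^ 2 := by
  obtain ⟨hN, n₂, -⟩ := hH
  refine (freqW_le_high_high (x := x) hN le_rfl n₂).trans ?_
  have := jap_rpow_le_one x
  rw [sq_abs]
  gcongr
  have : 0 ≤ x ^ 2 := sq_nonneg x
  nlinarith

/-- `l' / l` is comparable with `t`, which is bounded, so `rho` grows at most like `t^(-1/16)` and
the factor `t` absorbs it. -/
lemma mul_rho_le {s t l l' : ℝ} (hs : 0 < s) (ht0 : 0 < t) (ht2 : t ≤ 3 / 2) (hl : 0 < l)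
    (hl₁ : s ^ 3 ≤ 4 * l) (hl₂ : l ≤ 4 * s ^ 3) (hlt : l' = 3 / 4 * (s ^ 3 * t)) :
    t * rho l' l ≤ 20 := by
  have hl'0 : 0 < l' := by rw [hlt]; positivity
  have f1 : l' / l ≤ 3 * t := by
    rw [div_le_iff₀ hl, hlt]
    nlinarith
  have f2 : l / l' ≤ 16 / 3 * t⁻¹ := by
    rw [div_le_iff₀ hl'0, hlt]
    calc l ≤ 4 * s ^ 3 := hl₂
      _ = _ := by field_simp; norm_num
  have g1 : (l' / l) ^ (1 / 16 : ℝ) ≤ 5 := by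
    calc (l' / l) ^ (1 / 16 : ℝ) ≤ (5 : ℝ) ^ (1 / 16 : ℝ) := by
          have : 0 ≤ l' / l := by positivity
          gcongr; linarith
      _ ≤ 5 ^ (1 : ℝ) := Real.rpow_le_rpow_of_exponent_le (by norm_num) (by norm_num)
      _ = 5 := Real.rpow_one _
  have g2 : t * (l / l') ^ (1 / 16 : ℝ) ≤ 12 := by
    have j1 : (l / l') ^ (1 / 16 : ℝ) ≤ 1 + 16 / 3 * t⁻¹ := by
      have p : 0 ≤ l / l' := by positivity
      have p' : 0 < t⁻¹ := by positivity
      calc (l / l') ^ (1 / 16 : ℝ) ≤ (1 + 16 / 3 * t⁻¹) ^ (1 / 16 : ℝ) := by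
            gcongr; linarith
        _ ≤ (1 + 16 / 3 * t⁻¹) ^ (1 : ℝ) :=
            Real.rpow_le_rpow_of_exponent_le (by linarith) (by norm_num)
        _ = _ := Real.rpow_one _
    calc t * (l / l') ^ (1 / 16 : ℝ) ≤ t * (1 + 16 / 3 * t⁻¹) := by gcongr
      _ = t + 16 / 3 := by field_simp
      _ ≤ 12 := by linarith
  unfold rho
  nlinarith

lemma sqrt_le_VV' {X y N : ℝ} (h1 : 3 / 4 * N ≤ |X|) (h2 : |X| ≤ N)
    (hy : Real.sqrt N * |y| ≤ 5) : Real.sqrt N ≤ 72 * VV X y := by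
  have b := (le_VV X y).2.2.2.1
  have q1 : Real.sqrt N ≤ 2 * Real.sqrt |X| := by
    rw [show (2 : ℝ) = Real.sqrt (2 ^ 2) by simp, ← Real.sqrt_mul (by norm_num)]
    apply Real.sqrt_le_sqrt; linarith [abs_nonneg X]
  have q2 : Real.sqrt |X| ≤ Real.sqrt N := Real.sqrt_le_sqrt h2
  have := le_bump (β := Real.sqrt |X|) (y₀ := 0) (y := y) (Real.sqrt_nonneg _) (by
    rw [sub_zero, abs_of_nonneg (by positivity)]
    calc Real.sqrt |X| * |y| ≤ Real.sqrt N * |y| := by gcongr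
      _ ≤ 5 := hy)
  linarith

set_option maxHeartbeats 600000 in
/-- Comparable high frequencies with a low output frequency of moderate modulation. -/
theorem high_high_low_bound {l : ℝ} (hx : x = x₁ + x₂) (h₁ : 1 ≤ a₁) (h₂ : 1 ≤ a₂) (z : x ≠ 0)
    (hA : |x * x₁ * x₂| ≤ a) (hH : IsHighHigh x₁ x₂ a₁ a₂ a) (hM : |x| ≤ |x₁| / 4)
    (hD : a * |x| ^ 3 ≤ 2) (hl : 0 < l) (hl₁ : |x₁| ^ (3 / 2 : ℝ) ≤ 4 * l)
    (hl₂ : l ≤ 4 * |x₁| ^ (3 / 2 : ℝ)) :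
    freqW x₁ x₂ x * (a⁻¹ * a₁⁻¹ * a₂⁻¹) * rho a l ≤
      10000000 * krSum VV x₁ x₂ x a₁ a₂ a := by
  have hF := freqW_le_cube (x := x) hH
  obtain ⟨hN, n₂, m₂, ha₁, ha₂⟩ := hH
  have h : 1 ≤ a := h₁.trans ha₁
  obtain ⟨k0, k1, k2, k3⟩ := krSum_ge (x₁ := x₁) (x₂ := x₂) (x := x) VV_nonneg h h₁ h₂
  have hxb : |x₁| ≤ |x| + |x₂| := by
    rw [show x₁ = x - x₂ by rw [hx]; ring]; exact abs_sub _ _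
  have hM0 : 0 < |x| := abs_pos.2 z
  set N := |x₁| with hNd
  set M := |x| with hMd
  have hN0 : 0 < N := by linarith
  set s := Real.sqrt N with hs
  have hs0 : 0 < s := Real.sqrt_pos.2 hN0
  have hss : s ^ 2 = N := Real.sq_sqrt hN0.le
  set t := s * M with ht
  have ht0 : 0 < t := by positivity
  have hq : 3 / 4 * M * N ^ 2 ≤ a := by
    refine le_trans ?_ hA
    rw [abs_mul, abs_mul]
    calc 3 / 4 * M * N ^ 2 = M * N * (3 / 4 * N) := by ring
      _ ≤ _ := by gcongr; linarith
  -- The product of `a |x|³ ≤ 2`, valid outside `D`, and the resonance bound `a ≥ (3/4) |x| N²`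
  -- controls `t⁴ = |x|⁴ N²`. Hence `|x| ≲ N^(-1/2)`, within the width of the bump of height `√N`.
  have ht2 : t ≤ 3 / 2 := by
    have e : 3 / 4 * t ^ 4 ≤ 2 := by
      calc 3 / 4 * t ^ 4 = (3 / 4 * M * N ^ 2) * M ^ 3 := by rw [ht, ← hss]; ring
        _ ≤ a * M ^ 3 := by gcongr
        _ ≤ 2 := hD
    by_contra hcon
    have h1 : (3 / 2 : ℝ) < t := not_le.1 hcon
    have h2 : (3 / 2 : ℝ) ^ 4 < t ^ 4 := by gcongr
    norm_num at h2
    linarith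
  set l' := 3 / 4 * M * N ^ 2 with hl'
  have hl'0 : 0 < l' := by positivity
  have hNs : N ^ (3 / 2 : ℝ) = s ^ 3 := by rw [rpow_three_halves hN0.le, ← hs, ← hss]; ring
  have e1 := inv_mul_rho_anti hl'0 hl hq
  have e2 : l'⁻¹ * (N ^ 3 * M ^ 2) = 4 / 3 * (s * t) := by
    rw [hl', ht, ← hss]; field_simp
  have e3 : t * rho l' l ≤ 20 := by
    rw [hNs] at hl₁ hl₂
    exact mul_rho_le hs0 ht0 ht2 hl hl₁ hl₂ (by rw [hl', ht, ← hss]; ring)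
  have hV : ∀ X : ℝ, 3 / 4 * N ≤ |X| → |X| ≤ N → s ≤ 72 * VV X x := by
    intro X h1 h2
    exact sqrt_le_VV' h1 h2 (by linarith)
  have d1 := dec_nonneg (show 0 ≤ a by linarith)
  have d2 := dec_nonneg (show 0 ≤ a₁ by linarith)
  have d3 := dec_nonneg (show 0 ≤ a₂ by linarith)
  -- The bump is in the output frequency, with an input frozen: the decay in `a₂` goes with `x₁`
  -- frozen, that in `a₁` with `x₂` frozen.
  have c1 : s * dec a₂ ≤ 72 * kr VV x₁ x₂ x a₂ a := by
    have := bump_dec_le_kr (x := x₁) (y := x) (w := x₂) VV_nonneg h h₂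
    rw [kr_comm] at this
    have v := VV_nonneg x₁ x
    calc s * dec a₂ ≤ 72 * VV x₁ x * dec a₂ := by gcongr; exact hV x₁ (by linarith) le_rfl
      _ = 72 * (VV x₁ x * dec a₂) := by ring
      _ ≤ 72 * (VV x₁ x * (dec a + dec a₂)) := by gcongr; linarith
      _ ≤ _ := by gcongr
  have c2 : s * dec a₁ ≤ 72 * kr VV x₂ x₁ x a₁ a := by
    have := bump_dec_le_kr (x := x₂) (y := x) (w := x₁) VV_nonneg h h₁
    rw [kr_comm] at this
    have v := VV_nonneg x₂ x
    calc s * dec a₁ ≤ 72 * VV x₂ x * dec a₁ := by gcongr; exact hV x₂ (by linarith) n₂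
      _ = 72 * (VV x₂ x * dec a₁) := by ring
      _ ≤ 72 * (VV x₂ x * (dec a + dec a₁)) := by gcongr; linarith
      _ ≤ _ := by gcongr
  have hP : a₁⁻¹ * a₂⁻¹ ≤ dec a₁ + dec a₂ := (inv_mul_le_rpow h₁ h₂).trans (rpow_le_dec_add h₁ h₂)
  have i0 : 0 ≤ a⁻¹ := inv_nonneg.2 (by linarith)
  have i1 : 0 ≤ a₁⁻¹ := inv_nonneg.2 (by linarith)
  have i2 : 0 ≤ a₂⁻¹ := inv_nonneg.2 (by linarith)
  have r0 := (rho_pos (show 0 < a by linarith) hl).le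
  have r1 := (rho_pos hl'0 hl).le
  calc freqW x₁ x₂ x * (a⁻¹ * a₁⁻¹ * a₂⁻¹) * rho a l
      ≤ (4 * N ^ 3 * M ^ 2) * (a⁻¹ * a₁⁻¹ * a₂⁻¹) * rho a l := by gcongr
    _ = 4 * (N ^ 3 * M ^ 2) * (a⁻¹ * rho a l) * (a₁⁻¹ * a₂⁻¹) := by ring
    _ ≤ 4 * (N ^ 3 * M ^ 2) * (l'⁻¹ * rho l' l) * (dec a₁ + dec a₂) := by gcongr
    _ = 4 * (l'⁻¹ * (N ^ 3 * M ^ 2)) * rho l' l * (dec a₁ + dec a₂) := by ring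
    _ = 16 / 3 * (t * rho l' l) * (s * dec a₁ + s * dec a₂) := by rw [e2]; ring
    _ ≤ 16 / 3 * 20 * (72 * kr VV x₂ x₁ x a₁ a + 72 * kr VV x₁ x₂ x a₂ a) := by gcongr
    _ ≤ _ := by linarith

/-- Comparable high frequencies with the largest modulation on the low frequency output. -/
theorem high_high_sharp_bound {Q : ℝ} (hx : x = x₁ + x₂) (h₁ : 1 ≤ a₁) (h₂ : 1 ≤ a₂) (z : x ≠ 0)
    (hA : |x * x₁ * x₂| ≤ a) (hH : IsHighHigh x₁ x₂ a₁ a₂ a) (hM : |x| ≤ |x₁| / 4)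
    (hQ : |x₁| ≤ 2 * Q) (hQ' : Q ≤ 2 * |x₁|) :
    freqW x₁ x₂ x * (a⁻¹ * a₁⁻¹ * a₂⁻¹) * rho a (|x| * Q ^ 2) ≤
      10000000 * (dd x₁ x₂ * (a₁⁻¹ * a₂⁻¹)) := by
  have hF := freqW_le_cube (x := x) hH
  obtain ⟨hN, n₂, m₂, ha₁, ha₂⟩ := hH
  have h : 1 ≤ a := h₁.trans ha₁
  have hxb : |x₁| ≤ |x| + |x₂| := by
    rw [show x₁ = x - x₂ by rw [hx]; ring]; exact abs_sub _ _
  have hM0 : 0 < |x| := abs_pos.2 z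
  -- `x₁² - x₂² = (x₁ - x₂) x`. The transversality `|x₁| |x|` is exactly what `N³ x²` leaves after
  -- division by the resonance `|x| N²`. Nothing remains to improve the decay in `a₁` and `a₂`,
  -- hence the shell kernel `KD`.
  have hdd : |x₁| * |x| ≤ dd x₁ x₂ := by
    have h2 : 1 ≤ (x₁ * x₂) ^ 2 := by
      rw [← sq_abs, abs_mul]
      exact one_le_pow₀ (one_le_mul_of_one_le_of_one_le (by linarith) (by linarith))
    have h3 := two_le_of_one_le h2
    have h4 : |x₁| * |x| ≤ |x₁ ^ 2 - x₂ ^ 2| := by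
      rw [show x₁ ^ 2 - x₂ ^ 2 = (x₁ - x₂) * x by rw [hx]; ring, abs_mul]
      refine mul_le_mul_of_nonneg_right ?_ (abs_nonneg _)
      have : |2 * x₁| ≤ |x₁ - x₂| + |x| := by
        rw [show 2 * x₁ = x₁ - x₂ + x by rw [hx]; ring]; exact abs_add_le _ _
      rw [abs_mul, abs_two] at this
      linarith
    unfold dd
    nlinarith [abs_nonneg (x₁ ^ 2 - x₂ ^ 2)]
  set N := |x₁| with hNd
  set M := |x| with hMd
  have hN0 : 0 < N := by linarith
  have hQ0 : 0 < Q := by linarith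
  set l := 3 / 4 * M * N ^ 2 with hl
  have hl0 : 0 < l := by positivity
  have hq : l ≤ a := by
    refine le_trans ?_ hA
    rw [abs_mul, abs_mul]
    calc l = M * N * (3 / 4 * N) := by rw [hl]; ring
      _ ≤ _ := by gcongr; linarith
  have hr : rho a (M * Q ^ 2) ≤ 6 * rho a l := by
    apply rho_le_of_le (by linarith) (by positivity) hl0 (by norm_num)
    · calc M * Q ^ 2 ≤ M * (2 * N) ^ 2 := by gcongr
        _ ≤ _ := by rw [hl]; nlinarith [mul_pos hM0 (pow_pos hN0 2)]
    · calc l ≤ 3 / 4 * M * (2 * Q) ^ 2 := by rw [hl]; gcongr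
        _ ≤ _ := by nlinarith [mul_pos hM0 (pow_pos hQ0 2)]
  have hi := inv_mul_rho_le hl0 hq
  have e2 : l⁻¹ * (N ^ 3 * M ^ 2) = 4 / 3 * (N * M) := by
    rw [hl]; field_simp
  have i0 : 0 ≤ a⁻¹ := inv_nonneg.2 (by linarith)
  have i1 : 0 ≤ a₁⁻¹ := inv_nonneg.2 (by linarith)
  have i2 : 0 ≤ a₂⁻¹ := inv_nonneg.2 (by linarith)
  have r0 := (rho_pos (show 0 < a by linarith) (show 0 < M * Q ^ 2 by positivity)).le
  have d0 := dd_nonneg x₁ x₂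
  calc freqW x₁ x₂ x * (a⁻¹ * a₁⁻¹ * a₂⁻¹) * rho a (M * Q ^ 2)
      ≤ (4 * N ^ 3 * M ^ 2) * (a⁻¹ * a₁⁻¹ * a₂⁻¹) * (6 * rho a l) := by gcongr
    _ = 24 * (N ^ 3 * M ^ 2) * (a⁻¹ * rho a l) * (a₁⁻¹ * a₂⁻¹) := by ring
    _ ≤ 24 * (N ^ 3 * M ^ 2) * (2 * l⁻¹) * (a₁⁻¹ * a₂⁻¹) := by gcongr
    _ = 48 * (l⁻¹ * (N ^ 3 * M ^ 2)) * (a₁⁻¹ * a₂⁻¹) := by ring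
    _ = 64 * ((N * M) * (a₁⁻¹ * a₂⁻¹)) := by rw [e2]; ring
    _ ≤ 64 * (dd x₁ x₂ * (a₁⁻¹ * a₂⁻¹)) := by gcongr
    _ ≤ _ := by
      have : 0 ≤ dd x₁ x₂ * (a₁⁻¹ * a₂⁻¹) := by positivity
      linarith

/-- The generic bound, with the output weight. -/
theorem generic_bound_rho (h : 1 ≤ a) (h₁ : 1 ≤ a₁) (h₂ : 1 ≤ a₂)
    (H : freqW x₁ x₂ x * (a ^ (-(15 / 16) : ℝ) * a₁⁻¹ * a₂⁻¹) ≤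
      100000 * krSum VV x₁ x₂ x a₁ a₂ a) :
    freqW x₁ x₂ x * (a⁻¹ * a₁⁻¹ * a₂⁻¹) * rho a 1 ≤
      10000000 * krSum VV x₁ x₂ x a₁ a₂ a := by
  have k0 := (krSum_ge (x₁ := x₁) (x₂ := x₂) (x := x) VV_nonneg h h₁ h₂).1
  have hρ := inv_mul_rho_one_le h
  have hF0 := freqW_nonneg x₁ x₂ x
  have i1 : 0 ≤ a₁⁻¹ := inv_nonneg.2 (by linarith)
  have i2 : 0 ≤ a₂⁻¹ := inv_nonneg.2 (by linarith)
  calc freqW x₁ x₂ x * (a⁻¹ * a₁⁻¹ * a₂⁻¹) * rho a 1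
      = freqW x₁ x₂ x * ((a⁻¹ * rho a 1) * a₁⁻¹ * a₂⁻¹) := by ring
    _ ≤ freqW x₁ x₂ x * ((2 * a ^ (-(15 / 16) : ℝ)) * a₁⁻¹ * a₂⁻¹) := by gcongr
    _ = 2 * (freqW x₁ x₂ x * (a ^ (-(15 / 16) : ℝ) * a₁⁻¹ * a₂⁻¹)) := by ring
    _ ≤ _ := by linarith

end Cases

/-! ### Summability of the localization weight. -/

section SumBound

/-- A bound for the sum over dyadic `L` of the inverse weights `1 / rho L l`. -/
def rhoSum : ℝ≥0∞ := ∑' m : ℤ, ENNReal.ofReal (2 * ((2 : ℝ) ^ (-(1 / 16) : ℝ)) ^ m.natAbs)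

lemma rhoSum_lt_top : rhoSum < ∞ := by
  refine lt_top_iff_ne_top.2 (Summable.tsum_ofReal_ne_top ?_)
  apply Summable.mul_left
  have h1 : ((2 : ℝ) ^ (-(1 / 16) : ℝ)) < 1 :=
    Real.rpow_lt_one_of_one_lt_of_neg (by norm_num) (by norm_num)
  have h0 : 0 ≤ ((2 : ℝ) ^ (-(1 / 16) : ℝ)) := by positivity
  refine Summable.of_nat_of_neg ?_ ?_
  · simpa using summable_geometric_of_lt_one h0 h1
  · simpa using summable_geometric_of_lt_one h0 h1

/-- Round `l` down to a power `2ⁿ`. Then `rho (2^k) l` is at least a constant times `2^(|k -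
n|/16)`, and the geometric series over all integers `k - n` does not depend on `l`. -/
lemma tsum_inv_rho_le {l : ℝ} (hl : 0 < l) :
    ∑' k : ℕ, ENNReal.ofReal ((rho (2 ^ k) l)⁻¹) ≤ rhoSum := by
  obtain ⟨n, hn, hn'⟩ := exists_mem_Ico_zpow hl (show (1 : ℝ) < 2 by norm_num)
  set r : ℝ := (2 : ℝ) ^ (-(1 / 16) : ℝ) with hr
  have hr0 : 0 < r := by positivity
  have hrz : ∀ m : ℤ, ((2 : ℝ) ^ m) ^ (1 / 16 : ℝ) = r ^ (-m) := by
    intro m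
    rw [hr, ← Real.rpow_intCast, ← Real.rpow_mul (by norm_num), ← Real.rpow_intCast,
      ← Real.rpow_mul (by norm_num)]
    congr 1; push_cast; ring
  have key : ∀ k : ℕ, (rho (2 ^ k) l)⁻¹ ≤ 2 * r ^ ((k : ℤ) - n).natAbs := by
    intro k
    have hk : (0 : ℝ) < 2 ^ k := by positivity
    have h2n : (0 : ℝ) < 2 ^ n := by positivity
    have hz : (2 : ℝ) ^ (n + 1) = 2 ^ n * 2 := zpow_add_one₀ (by norm_num) n
    have hc : rho (2 ^ k) ((2 : ℝ) ^ n) ≤ 2 * rho (2 ^ k) l :=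
      rho_le_of_le hk h2n hl (by norm_num) (by linarith) (by rw [hz] at hn'; linarith)
    have hlow : (r ^ ((k : ℤ) - n).natAbs)⁻¹ ≤ rho (2 ^ k) ((2 : ℝ) ^ n) := by
      have e1 : (2 : ℝ) ^ k / 2 ^ n = 2 ^ ((k : ℤ) - n) := by
        rw [zpow_sub₀ (by norm_num), zpow_natCast]
      have e2 : (2 : ℝ) ^ n / 2 ^ k = 2 ^ (n - (k : ℤ)) := by
        rw [zpow_sub₀ (by norm_num), zpow_natCast]
      unfold rho
      rw [e1, e2, hrz, hrz, ← zpow_natCast, ← zpow_neg]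
      have p1 : 0 < r ^ (-((k : ℤ) - n)) := by positivity
      have p2 : 0 < r ^ (-(n - (k : ℤ))) := by positivity
      rcases le_total 0 ((k : ℤ) - n) with h | h
      · rw [Int.natAbs_of_nonneg h]; linarith
      · rw [show (((k : ℤ) - n).natAbs : ℤ) = n - k by omega]; linarith
    have hp : 0 < r ^ ((k : ℤ) - n).natAbs := by positivity
    have hρ := rho_pos hk hl
    rw [inv_le_iff_one_le_mul₀ hρ]
    have : 1 ≤ r ^ ((k : ℤ) - n).natAbs * rho (2 ^ k) ((2 : ℝ) ^ n) := by
      rwa [inv_le_iff_one_le_mul₀ hp, mul_comm] at hlow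
    nlinarith
  calc ∑' k : ℕ, ENNReal.ofReal ((rho (2 ^ k) l)⁻¹)
      ≤ ∑' k : ℕ, ENNReal.ofReal (2 * r ^ ((k : ℤ) - n).natAbs) :=
        ENNReal.tsum_le_tsum fun k => ENNReal.ofReal_le_ofReal (key k)
    _ ≤ ∑' m : ℤ, ENNReal.ofReal (2 * r ^ (m - n).natAbs) :=
        ENNReal.tsum_comp_le_tsum_of_injective (f := ((↑) : ℕ → ℤ)) Nat.cast_injective
          fun m : ℤ => ENNReal.ofReal (2 * r ^ (m - n).natAbs)
    _ = ∑' m : ℤ, ENNReal.ofReal (2 * r ^ m.natAbs) :=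
        (Equiv.subRight n).tsum_eq fun m : ℤ => ENNReal.ofReal (2 * r ^ m.natAbs)
    _ = rhoSum := rfl

lemma one_le_rho {L l : ℝ} (hL : 0 < L) (hl : 0 < l) : 1 ≤ rho L l := by
  unfold rho
  rcases le_total l L with h | h
  · have : 1 ≤ (L / l) ^ (1 / 16 : ℝ) := Real.one_le_rpow (by rwa [one_le_div hl]) (by norm_num)
    have : 0 ≤ (l / L) ^ (1 / 16 : ℝ) := by positivity
    linarith
  · have : 1 ≤ (l / L) ^ (1 / 16 : ℝ) := Real.one_le_rpow (by rwa [one_le_div hL]) (by norm_num)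
    have : 0 ≤ (L / l) ^ (1 / 16 : ℝ) := by positivity
    linarith

lemma rho_comm (L l : ℝ) : rho L l = rho l L := by unfold rho; ring

lemma inv_rho_le_of_shell {L l L' l' c : ℝ} (hL : 0 < L) (hL' : 0 < L') (hl : 0 < l)
    (hl' : 0 < l') (hc : 1 ≤ c) (h1 : L' ≤ L) (h2 : L ≤ 2 * L') (h3 : l ≤ c * l')
    (h4 : l' ≤ c * l) : (rho L l)⁻¹ ≤ 2 * c * (rho L' l')⁻¹ := by
  have e1 : rho L' l ≤ 2 * rho L l := by
    rw [rho_comm L' l, rho_comm L l]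
    exact rho_le_of_le hl hL' hL (by norm_num) (by linarith) h2
  have e2 := rho_le_of_le hL' hl' hl hc h4 h3
  have p1 := rho_pos hL hl
  have p2 := rho_pos hL' hl'
  rw [inv_le_iff_one_le_mul₀ p1]
  calc 1 = rho L' l' * (rho L' l')⁻¹ := (mul_inv_cancel₀ p2.ne').symm
    _ ≤ (2 * c * rho L l) * (rho L' l')⁻¹ := by
      gcongr
      nlinarith
    _ = _ := by ring

end SumBound

/-! ### The norms on weighted densities. -/

section Norms

/-- The `X` norm on weighted densities. -/
def Xn (H : ℝ × ℝ → ℝ≥0∞) : ℝ≥0∞ :=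
  (∑' j : ℕ, (∑' k : ℕ,
    nl2 ((regionDᶜ ∩ (shellA j ∩ shellB k)).indicator H) volume) ^ (2 : ℝ)) ^ (1 / 2 : ℝ)
    + nl2 (regionD.indicator H) volume

/-- The `Y` norm on weighted densities. -/
def Yn (H : ℝ × ℝ → ℝ≥0∞) : ℝ≥0∞ :=
  nl2 (fun ξ => ∫⁻ τ, ENNReal.ofReal (modW (τ, ξ) ^ (-(1 / 2) : ℝ)) * H (τ, ξ)) (volume : Measure ℝ)

/-- The sum of the two norms on weighted densities. -/
def XYn (H : ℝ × ℝ → ℝ≥0∞) : ℝ≥0∞ := Xn H + Yn H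

lemma measurableSet_regionD : MeasurableSet regionD := by
  have h1 : Measurable fun p : ℝ × ℝ => |p.2| := by fun_prop
  have h2 : Measurable fun p : ℝ × ℝ => (|p.2| ^ 3)⁻¹ := by fun_prop
  have h3 : Measurable fun p : ℝ × ℝ => |p.1| := by fun_prop
  exact (measurableSet_le h1 measurable_const).inter (measurableSet_le h2 h3)

lemma measurableSet_cell (j k : ℕ) :
    MeasurableSet (regionDᶜ ∩ (shellA j ∩ shellB k)) :=
  measurableSet_regionD.compl.inter ((measurableSet_shellA j).inter (measurableSet_shellB k))

lemma XYn_mono {H H' : ℝ × ℝ → ℝ≥0∞} (h : ∀ z, H z ≤ H' z) : XYn H ≤ XYn H' := by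
  unfold XYn Xn Yn
  gcongr with j k
  · exact nl2_mono fun z => Set.indicator_le_indicator (h z)
  · exact nl2_mono fun z => Set.indicator_le_indicator (h z)
  · exact nl2_mono fun ξ => lintegral_mono fun τ => by gcongr; exact h _

lemma indicator_tsum {ι α : Type*} (s : Set α) (H : ι → α → ℝ≥0∞) :
    s.indicator (fun z => ∑' i, H i z) = fun z => ∑' i, s.indicator (H i) z := by
  ext z; by_cases hz : z ∈ s <;> simp [hz]

lemma XYn_tsum_le {ι : Type*} [Countable ι] {H : ι → ℝ × ℝ → ℝ≥0∞}
    (hH : ∀ i, Measurable (H i)) : XYn (fun z => ∑' i, H i z) ≤ ∑' i, XYn (H i) := by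
  unfold XYn Xn
  rw [ENNReal.tsum_add, ENNReal.tsum_add]
  gcongr ?_ + ?_ + ?_
  · refine le_trans ?_ (ell2_tsum_le fun i j => ∑' k : ℕ,
      nl2 ((regionDᶜ ∩ (shellA j ∩ shellB k)).indicator (H i)) volume)
    gcongr with j
    rw [ENNReal.tsum_comm]
    gcongr with k
    rw [indicator_tsum]
    exact nl2_tsum_le fun i => (hH i).indicator (measurableSet_cell j k)
  · rw [indicator_tsum]
    exact nl2_tsum_le fun i => (hH i).indicator measurableSet_regionD
  · unfold Yn
    have hm : ∀ i, Measurable fun w : ℝ × ℝ =>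
        ENNReal.ofReal (modW (w.2, w.1) ^ (-(1 / 2) : ℝ)) * H i (w.2, w.1) := by
      intro i
      have := hH i
      have := measurable_modW
      fun_prop
    have : ∀ ξ : ℝ, ∫⁻ τ, ENNReal.ofReal (modW (τ, ξ) ^ (-(1 / 2) : ℝ)) * ∑' i, H i (τ, ξ)
        = ∑' i, ∫⁻ τ, ENNReal.ofReal (modW (τ, ξ) ^ (-(1 / 2) : ℝ)) * H i (τ, ξ) := by
      intro ξ
      simp_rw [← ENNReal.tsum_mul_left]
      exact lintegral_tsum fun i => ((hm i).comp
        ((measurable_const (a := ξ)).prodMk measurable_id)).aemeasurable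
    simp_rw [this]
    exact nl2_tsum_le fun i => (hm i).lintegral_prod_right'

lemma XYn_add_le {H H' : ℝ × ℝ → ℝ≥0∞} (hH : Measurable H) (hH' : Measurable H') :
    XYn (fun z => H z + H' z) ≤ XYn H + XYn H' := by
  have := XYn_tsum_le (H := fun b : Bool => if b then H else H') (by intro b; cases b <;> simpa)
  simpa [tsum_fintype] using this

lemma disjoint_dyadic {u : ℝ} {i j : ℕ} (hi : (2 : ℝ) ^ i ≤ u) (hi' : u < 2 ^ (i + 1))
    (hj : (2 : ℝ) ^ j ≤ u) (hj' : u < 2 ^ (j + 1)) : i = j := by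
  have h1 := (pow_lt_pow_iff_right₀ (show (1 : ℝ) < 2 by norm_num)).1 (hi.trans_lt hj')
  have h2 := (pow_lt_pow_iff_right₀ (show (1 : ℝ) < 2 by norm_num)).1 (hj.trans_lt hi')
  omega

lemma exists_dyadic {u : ℝ} (h : 1 ≤ u) : ∃ i : ℕ, (2 : ℝ) ^ i ≤ u ∧ u < 2 ^ (i + 1) :=
  exists_nat_pow_near h (by norm_num)

/-- Orthogonality of the pieces on disjoint sets. -/
lemma tsum_nl2_sq_le {ι α : Type*} [Countable ι] [MeasurableSpace α] {μ : Measure α}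
    {S : ι → Set α} (hS : ∀ i, MeasurableSet (S i)) (hd : Pairwise fun i j => Disjoint (S i) (S j))
    (G : α → ℝ≥0∞) : ∑' i, nl2 ((S i).indicator G) μ ^ (2 : ℝ) = nl2 ((⋃ i, S i).indicator G) μ ^ (2 : ℝ) := by
  have h := fun s (hs : MeasurableSet s) => nl2_restrict (μ := μ) (F := G) (s := s) hs
  simp_rw [← h _ (hS _), ← h _ (MeasurableSet.iUnion hS), nl2_sq]
  rw [lintegral_iUnion hS hd]

lemma pairwise_disjoint_cell : Pairwise fun p q : ℕ × ℕ =>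
    Disjoint (regionDᶜ ∩ (shellA p.1 ∩ shellB p.2)) (regionDᶜ ∩ (shellA q.1 ∩ shellB q.2)) := by
  intro p q hpq
  rw [Set.disjoint_left]
  rintro z ⟨-, ⟨a1, a2⟩, b1, b2⟩ ⟨-, ⟨c1, c2⟩, d1, d2⟩
  exact hpq (Prod.ext (disjoint_dyadic a1 a2 c1 c2) (disjoint_dyadic b1 b2 d1 d2))

lemma iUnion_cell : (⋃ p : ℕ × ℕ, regionDᶜ ∩ (shellA p.1 ∩ shellB p.2)) = regionDᶜ := by
  apply Set.Subset.antisymm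
  · exact Set.iUnion_subset fun p => Set.inter_subset_left
  · intro z hz
    obtain ⟨j, hj⟩ := exists_dyadic (one_le_jap z.2)
    obtain ⟨k, hk⟩ := exists_dyadic (one_le_jap (modulation z))
    exact Set.mem_iUnion.2 ⟨(j, k), hz, hj, hk⟩

lemma tsum_cell (G : ℝ × ℝ → ℝ≥0∞) :
    ∑' j : ℕ, ∑' k : ℕ, nl2 ((regionDᶜ ∩ (shellA j ∩ shellB k)).indicator G) volume ^ (2 : ℝ)
      = nl2 (regionDᶜ.indicator G) volume ^ (2 : ℝ) := by
  have := tsum_nl2_sq_le (μ := volume) (fun p : ℕ × ℕ => measurableSet_cell p.1 p.2)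
    pairwise_disjoint_cell G
  rwa [iUnion_cell, ENNReal.tsum_prod'] at this

lemma rpow_two_half (x : ℝ≥0∞) : (x ^ (2 : ℝ)) ^ (1 / 2 : ℝ) = x := by
  rw [← ENNReal.rpow_mul]; norm_num

lemma tsum_sq_le (a : ℕ → ℝ≥0∞) : ∑' k, a k ^ (2 : ℝ) ≤ (∑' k, a k) ^ (2 : ℝ) := by
  rw [ENNReal.rpow_two, sq, ← ENNReal.tsum_mul_right]
  gcongr with k
  rw [ENNReal.rpow_two, sq]
  gcongr
  exact ENNReal.le_tsum k

/-- `ℓ¹` dominates `ℓ²` in the modulation index, and the cells partition the complement of `D`. -/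
lemma nl2_le_Xn {H : ℝ × ℝ → ℝ≥0∞} (hH : Measurable H) : nl2 H volume ≤ Xn H := by
  have e : H = fun z => regionDᶜ.indicator H z + regionD.indicator H z := by
    ext z; by_cases hz : z ∈ regionD <;> simp [hz]
  calc nl2 H volume ≤ nl2 (regionDᶜ.indicator H) volume + nl2 (regionD.indicator H) volume := by
        conv_lhs => rw [e]
        exact nl2_add_le (hH.indicator measurableSet_regionD.compl)
          (hH.indicator measurableSet_regionD)
    _ ≤ _ := by
        unfold Xn
        gcongr
        rw [← rpow_two_half (nl2 (regionDᶜ.indicator H) volume), ← tsum_cell]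
        gcongr with j
        exact tsum_sq_le _

end Norms

/-! ### Functions localized near a reference modulation. -/

section Localized

variable {H G : ℝ × ℝ → ℝ≥0∞} {l : ℝ → ℝ}

/-- The factor `rho ^ (-1/2)` for the modulation at `z` and the reference value `l ξ`. -/
def rhoW (l : ℝ → ℝ) (z : ℝ × ℝ) : ℝ≥0∞ := ENNReal.ofReal (rho (modW z) (l z.2) ^ (-(1 / 2) : ℝ))

lemma rhoW_le_one (hl : ∀ x, x ≠ 0 → 0 < l x) {z : ℝ × ℝ} (hz : z.2 ≠ 0) : rhoW l z ≤ 1 := by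
  unfold rhoW
  rw [ENNReal.ofReal_le_one]
  exact Real.rpow_le_one_of_one_le_of_nonpos (one_le_rho (modW_pos z) (hl _ hz)) (by norm_num)

lemma ae_snd_ne_zero : ∀ᵐ z : ℝ × ℝ, z.2 ≠ 0 := by
  have : (volume : Measure (ℝ × ℝ)) (Prod.snd ⁻¹' {(0 : ℝ)}) = 0 := by
    have : Prod.snd ⁻¹' {(0 : ℝ)} = (Set.univ : Set ℝ) ×ˢ {(0 : ℝ)} := by ext; simp
    rw [this, Measure.volume_eq_prod, Measure.prod_prod]; simp
  exact measure_mono_null (fun z hz => by simpa using hz) this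

lemma rhoW_sq {z : ℝ × ℝ} (h : 0 < l z.2) :
    rhoW l z ^ (2 : ℝ) = ENNReal.ofReal ((rho (modW z) (l z.2))⁻¹) := by
  have := rho_pos (modW_pos z) h
  unfold rhoW
  rw [ENNReal.ofReal_rpow_of_nonneg (by positivity) (by norm_num), ← Real.rpow_mul this.le,
    ← Real.rpow_neg_one]
  norm_num

/-- Cauchy–Schwarz in `k`: on a cell `rho⁻¹` is comparable with its value at `(2^k, m j)`, and these
values are summable in `k` uniformly in `j`. In `D` only `rhoW ≤ 1` is used, so there `l` may vary
freely over a frequency shell. -/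
lemma Xn_le_of_localized (hG : Measurable G) (hl : ∀ x, x ≠ 0 → 0 < l x) {O : Set (ℝ × ℝ)}
    (hO : ∀ z ∉ O, H z = 0) (hH : ∀ z, H z ≤ rhoW l z * G z) {c : ℝ} (hc : 1 ≤ c)
    {m : ℕ → ℝ} (hm : ∀ j, 0 < m j)
    (hlm : ∀ j, ∀ z ∈ shellA j, z ∈ O → z ∉ regionD → l z.2 ≤ c * m j ∧ m j ≤ c * l z.2) :
    Xn H ≤ ((ENNReal.ofReal (2 * c) * rhoSum) ^ (1 / 2 : ℝ) + 1) * nl2 G volume := by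
  set E : ℕ → ℕ → Set (ℝ × ℝ) := fun j k => regionDᶜ ∩ (shellA j ∩ shellB k) with hE
  have h1 : ∀ j k, nl2 ((E j k).indicator H) volume ≤
      ENNReal.ofReal (2 * c * (rho (2 ^ k) (m j))⁻¹) ^ (1 / 2 : ℝ) *
        nl2 ((E j k).indicator G) volume := by
    intro j k
    rw [← nl2_const_mul (hG.indicator (measurableSet_cell j k))]
    apply nl2_mono_ae
    filter_upwards [ae_snd_ne_zero] with z hz0
    by_cases hz : z ∈ E j k
    · rw [Set.indicator_of_mem hz, Set.indicator_of_mem hz]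
      by_cases hzO : z ∈ O
      · refine (hH z).trans ?_
        gcongr
        rw [← rpow_two_half (rhoW l z), rhoW_sq (hl _ hz0)]
        gcongr
        obtain ⟨q1, q2⟩ := hlm j z hz.2.1 hzO hz.1
        have q3 := hz.2.2.2
        exact inv_rho_le_of_shell (modW_pos z) (by positivity) (hl _ hz0) (hm j) hc hz.2.2.1
          (by unfold modW; rw [pow_succ] at q3; linarith) q1 q2
      · rw [hO z hzO]; exact bot_le
    · simp [hz]
  have h2 : ∀ j, (∑' k, nl2 ((E j k).indicator H) volume) ^ (2 : ℝ) ≤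
      (ENNReal.ofReal (2 * c) * rhoSum) * ∑' k, nl2 ((E j k).indicator G) volume ^ (2 : ℝ) := by
    intro j
    have : ∑' k, nl2 ((E j k).indicator H) volume ≤
        (∑' k, ENNReal.ofReal (2 * c * (rho (2 ^ k) (m j))⁻¹)) ^ (1 / 2 : ℝ) *
          (∑' k, nl2 ((E j k).indicator G) volume ^ (2 : ℝ)) ^ (1 / 2 : ℝ) := by
      refine (ENNReal.tsum_le_tsum (h1 j)).trans ((tsum_mul_le_ell2 _ _).trans ?_)
      simp_rw [rpow_half_two]
      rfl
    calc _ ≤ ((∑' k, ENNReal.ofReal (2 * c * (rho (2 ^ k) (m j))⁻¹)) ^ (1 / 2 : ℝ) *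
          (∑' k, nl2 ((E j k).indicator G) volume ^ (2 : ℝ)) ^ (1 / 2 : ℝ)) ^ (2 : ℝ) := by gcongr
      _ = (∑' k, ENNReal.ofReal (2 * c * (rho (2 ^ k) (m j))⁻¹)) *
          ∑' k, nl2 ((E j k).indicator G) volume ^ (2 : ℝ) := by
        rw [ENNReal.mul_rpow_of_nonneg _ _ (by norm_num), rpow_half_two, rpow_half_two]
      _ ≤ _ := by
        gcongr
        simp_rw [ENNReal.ofReal_mul (show 0 ≤ 2 * c by linarith)]
        rw [ENNReal.tsum_mul_left]
        gcongr
        exact tsum_inv_rho_le (hm j)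
  unfold Xn
  rw [add_mul, one_mul]
  gcongr ?_ + ?_
  · calc _ ≤ (∑' j, (ENNReal.ofReal (2 * c) * rhoSum) *
          ∑' k, nl2 ((E j k).indicator G) volume ^ (2 : ℝ)) ^ (1 / 2 : ℝ) := by
          gcongr with j; exact h2 j
      _ = (ENNReal.ofReal (2 * c) * rhoSum) ^ (1 / 2 : ℝ) * nl2 (regionDᶜ.indicator G) volume := by
          rw [ENNReal.tsum_mul_left, tsum_cell, ENNReal.mul_rpow_of_nonneg _ _ (by norm_num),
            rpow_two_half]
      _ ≤ _ := by
          gcongr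
          exact nl2_mono fun z => Set.indicator_le_self _ _ _
  · apply nl2_mono_ae
    filter_upwards [ae_snd_ne_zero] with z hz0
    refine (Set.indicator_le_self _ _ _).trans ((hH z).trans ?_)
    calc rhoW l z * G z ≤ 1 * G z := by gcongr; exact rhoW_le_one hl hz0
      _ = G z := one_mul _

lemma lintegral_inv_mul_inv_rho_le (s : ℝ) {l : ℝ} (hl : 0 < l) :
    ∫⁻ τ, ENNReal.ofReal ((jap (τ - s))⁻¹ * (rho (jap (τ - s)) l)⁻¹) ≤ 8 * rhoSum := by
  rw [lintegral_sub_right_eq_self (fun τ => ENNReal.ofReal ((jap τ)⁻¹ * (rho (jap τ) l)⁻¹)) s]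
  set S : ℕ → Set ℝ := fun k => {τ | 2 ^ k ≤ jap τ ∧ jap τ < 2 ^ (k + 1)} with hS
  have hSm : ∀ k, MeasurableSet (S k) := fun k =>
    (measurableSet_le measurable_const measurable_jap).inter
      (measurableSet_lt measurable_jap measurable_const)
  have hU : (⋃ k, S k) = Set.univ := by
    rw [Set.eq_univ_iff_forall]
    intro τ
    obtain ⟨k, hk⟩ := exists_dyadic (one_le_jap τ)
    exact Set.mem_iUnion.2 ⟨k, hk⟩
  rw [← setLIntegral_univ, ← hU]
  refine (lintegral_iUnion_le _ _).trans ?_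
  calc _ ≤ ∑' k : ℕ, 8 * ENNReal.ofReal ((rho (2 ^ k) l)⁻¹) := by
        gcongr with k
        have h2k : (0 : ℝ) < 2 ^ k := by positivity
        have hle : ∀ τ ∈ S k, ENNReal.ofReal ((jap τ)⁻¹ * (rho (jap τ) l)⁻¹) ≤
            ENNReal.ofReal ((2 ^ k)⁻¹ * (2 * (rho (2 ^ k) l)⁻¹)) := by
          intro τ hτ
          apply ENNReal.ofReal_le_ofReal
          have := inv_rho_le_of_shell (jap_pos τ) h2k hl hl le_rfl hτ.1
            (by have := hτ.2; rw [pow_succ] at this; linarith) (by linarith) (by linarith)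
          rw [mul_one] at this
          have p := rho_pos (jap_pos τ) hl
          gcongr
          exact hτ.1
        have hvol : volume (S k) ≤ ENNReal.ofReal (4 * 2 ^ k) := by
          calc volume (S k) ≤ volume (Set.Icc (-(2 * 2 ^ k) : ℝ) (2 * 2 ^ k)) := by
                apply measure_mono
                intro τ hτ
                have h1 := hτ.2
                rw [pow_succ] at h1
                have := abs_le.1 ((abs_le_jap τ).trans (show jap τ ≤ 2 * 2 ^ k by linarith))
                exact this
            _ = _ := by rw [Real.volume_Icc]; congr 1; ring
        calc _ ≤ ∫⁻ τ in S k, ENNReal.ofReal ((2 ^ k)⁻¹ * (2 * (rho (2 ^ k) l)⁻¹)) :=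
              setLIntegral_mono' (hSm k) hle
          _ = ENNReal.ofReal ((2 ^ k)⁻¹ * (2 * (rho (2 ^ k) l)⁻¹)) * volume (S k) :=
              setLIntegral_const _ _
          _ ≤ ENNReal.ofReal ((2 ^ k)⁻¹ * (2 * (rho (2 ^ k) l)⁻¹)) * ENNReal.ofReal (4 * 2 ^ k) := by
              gcongr
          _ = _ := by
              have p := rho_pos h2k hl
              rw [← ENNReal.ofReal_mul (by positivity),
                show (8 : ℝ≥0∞) = ENNReal.ofReal 8 by norm_num,
                ← ENNReal.ofReal_mul (by norm_num)]
              congr 1; field_simp; norm_num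
    _ = 8 * ∑' k : ℕ, ENNReal.ofReal ((rho (2 ^ k) l)⁻¹) := ENNReal.tsum_mul_left
    _ ≤ _ := by gcongr; exact tsum_inv_rho_le hl

/-- Cauchy–Schwarz in `τ` at fixed `ξ`. On a dyadic shell the weight `⟨σ⟩⁻¹` cancels the length of
the shell, so the sum of `rho⁻¹` remains, uniformly in the reference value. -/
lemma Yn_le_of_localized (hG : Measurable G) (hl : ∀ x, x ≠ 0 → 0 < l x)
    (hH : ∀ z, H z ≤ rhoW l z * G z) : Yn H ≤ (8 * rhoSum) ^ (1 / 2 : ℝ) * nl2 G volume := by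
  have key : ∀ ξ : ℝ, ξ ≠ 0 →
      ∫⁻ τ, ENNReal.ofReal (modW (τ, ξ) ^ (-(1 / 2) : ℝ)) * H (τ, ξ) ≤
        (8 * rhoSum) ^ (1 / 2 : ℝ) * nl2 (fun τ => G (τ, ξ)) (volume : Measure ℝ) := by
    intro ξ hξ
    have hmod : ∀ τ, modW (τ, ξ) = jap (τ - (ξ ^ 3 - 1 / ξ)) := by
      intro τ; unfold modW modulation; congr 1; ring
    have hmeas : Measurable fun τ : ℝ => modW (τ, ξ) :=
      measurable_modW.comp (measurable_id.prodMk measurable_const)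
    have hmr : Measurable fun τ : ℝ => rhoW l (τ, ξ) := by
      unfold rhoW rho; simp only; fun_prop
    calc _ ≤ ∫⁻ τ, (ENNReal.ofReal (modW (τ, ξ) ^ (-(1 / 2) : ℝ)) * rhoW l (τ, ξ)) * G (τ, ξ) := by
          refine lintegral_mono fun τ => ?_
          rw [mul_assoc]
          gcongr
          exact hH _
      _ ≤ nl2 (fun τ => ENNReal.ofReal (modW (τ, ξ) ^ (-(1 / 2) : ℝ)) * rhoW l (τ, ξ)) volume *
          nl2 (fun τ => G (τ, ξ)) volume :=
          lintegral_mul_le_nl2 (by fun_prop)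
            (hG.comp (measurable_id.prodMk measurable_const)).aemeasurable
      _ ≤ _ := by
          gcongr
          unfold nl2
          gcongr
          refine le_trans (le_of_eq ?_) (lintegral_inv_mul_inv_rho_le (ξ ^ 3 - 1 / ξ) (hl ξ hξ))
          congr 1; ext τ
          rw [ENNReal.mul_rpow_of_nonneg _ _ (by norm_num), rhoW_sq (hl _ hξ),
            ENNReal.ofReal_rpow_of_nonneg (Real.rpow_nonneg (modW_pos _).le _) (by norm_num),
            ← Real.rpow_mul (modW_pos _).le, ← ENNReal.ofReal_mul (Real.rpow_nonneg (modW_pos _).le _),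
            hmod]
          norm_num
          rw [Real.rpow_neg_one]
  calc Yn H ≤ nl2 (fun ξ => (8 * rhoSum) ^ (1 / 2 : ℝ) *
        nl2 (fun τ => G (τ, ξ)) (volume : Measure ℝ)) (volume : Measure ℝ) := by
        apply nl2_mono_ae
        have : ∀ᵐ ξ : ℝ, ξ ≠ 0 := by simp [ae_iff]
        filter_upwards [this] with ξ hξ
        exact key ξ hξ
    _ = (8 * rhoSum) ^ (1 / 2 : ℝ) * nl2 G volume := by
        have hm : Measurable fun ξ : ℝ => ∫⁻ τ : ℝ, G (τ, ξ) ^ (2 : ℝ) :=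
          Measurable.lintegral_prod_left' (f := fun w : ℝ × ℝ => G w ^ (2 : ℝ)) (by fun_prop)
        rw [nl2_const_mul (by unfold nl2; fun_prop)]
        congr 1
        unfold nl2
        simp_rw [rpow_half_two]
        rw [Measure.volume_eq_prod, lintegral_prod_symm' _ (by fun_prop)]

/-- The constant in the bound of the norms of functions localized near a modulation. -/
def locC (c : ℝ) : ℝ≥0∞ :=
  (ENNReal.ofReal (2 * c) * rhoSum) ^ (1 / 2 : ℝ) + 1 + (8 * rhoSum) ^ (1 / 2 : ℝ)

lemma locC_lt_top (c : ℝ) : locC c < ∞ := by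
  have := rhoSum_lt_top
  unfold locC
  refine ENNReal.add_lt_top.2 ⟨ENNReal.add_lt_top.2 ⟨?_, ENNReal.one_lt_top⟩, ?_⟩
  · exact ENNReal.rpow_lt_top_of_nonneg (by norm_num)
      (ENNReal.mul_lt_top ENNReal.ofReal_lt_top this).ne
  · exact ENNReal.rpow_lt_top_of_nonneg (by norm_num) (ENNReal.mul_lt_top (by simp) this).ne

theorem XYn_le_of_localized (hG : Measurable G) (hl : ∀ x, x ≠ 0 → 0 < l x) {O : Set (ℝ × ℝ)}
    (hO : ∀ z ∉ O, H z = 0) (hH : ∀ z, H z ≤ rhoW l z * G z) {c : ℝ} (hc : 1 ≤ c)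
    {m : ℕ → ℝ} (hm : ∀ j, 0 < m j)
    (hlm : ∀ j, ∀ z ∈ shellA j, z ∈ O → z ∉ regionD → l z.2 ≤ c * m j ∧ m j ≤ c * l z.2) :
    XYn H ≤ locC c * nl2 G volume := by
  unfold XYn locC
  rw [add_mul]
  exact add_le_add (Xn_le_of_localized hG hl hO hH hc hm hlm) (Yn_le_of_localized hG hl hH)

end Localized

/-! ### `L²` bounds for the model bilinear operators. -/

section Kernels

/-- The square root of the sum of the three comparison kernels, as a bilinear kernel. -/
def KV (V : ℝ → ℝ → ℝ) (z₁ z₂ : ℝ × ℝ) : ℝ≥0∞ :=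
  ENNReal.ofReal (krSum V z₁.2 z₂.2 (z₁ + z₂).2 (modW z₁) (modW z₂) (modW (z₁ + z₂)))
    ^ (1 / 2 : ℝ)

/-- The bilinear kernel on the product of two modulation shells. -/
def KD (k₁ k₂ : ℕ) (z₁ z₂ : ℝ × ℝ) : ℝ≥0∞ :=
  (ENNReal.ofReal (dd z₁.2 z₂.2) * (ENNReal.ofReal ((2 ^ k₁)⁻¹ * (2 ^ k₂)⁻¹) *
    ((shellB k₁).indicator 1 z₁ * (shellB k₂).indicator 1 z₂))) ^ (1 / 2 : ℝ)

lemma measurable_kr_comp {α : Type*} [MeasurableSpace α] {V : ℝ → ℝ → ℝ}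
    (hV : Measurable (Function.uncurry V)) {x y w a b : α → ℝ} (hx : Measurable x)
    (hy : Measurable y) (hw : Measurable w) (ha : Measurable a) (hb : Measurable b) :
    Measurable fun p => kr V (x p) (y p) (w p) (a p) (b p) := by
  have h1 : Measurable fun p => V (x p) (y p) := hV.comp (hx.prodMk hy)
  have h2 : Measurable fun p => V (x p) (w p) := hV.comp (hx.prodMk hw)
  have h3 : Measurable fun p => dd (y p) (w p) := measurable_dd.comp (hy.prodMk hw)
  unfold kr
  fun_prop

lemma measurable_kr_one {V : ℝ → ℝ → ℝ} (hV : Measurable (Function.uncurry V)) :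
    Measurable fun p : (ℝ × ℝ) × (ℝ × ℝ) =>
      kr V p.1.2 p.2.2 (p.1 + p.2).2 (modW p.2) (modW (p.1 + p.2)) :=
  measurable_kr_comp hV (by fun_prop) (by fun_prop) (by fun_prop) (by fun_prop) (by fun_prop)

lemma measurable_kr_two {V : ℝ → ℝ → ℝ} (hV : Measurable (Function.uncurry V)) :
    Measurable fun p : (ℝ × ℝ) × (ℝ × ℝ) =>
      kr V p.2.2 p.1.2 (p.1 + p.2).2 (modW p.1) (modW (p.1 + p.2)) :=
  measurable_kr_comp hV (by fun_prop) (by fun_prop) (by fun_prop) (by fun_prop) (by fun_prop)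

lemma measurable_kr_out {V : ℝ → ℝ → ℝ} (hV : Measurable (Function.uncurry V)) :
    Measurable fun p : (ℝ × ℝ) × (ℝ × ℝ) =>
      kr V (p.1 + p.2).2 p.1.2 p.2.2 (modW p.1) (modW p.2) :=
  measurable_kr_comp hV (by fun_prop) (by fun_prop) (by fun_prop) (by fun_prop) (by fun_prop)

lemma measurable_KV {V : ℝ → ℝ → ℝ} (hV : Measurable (Function.uncurry V)) :
    Measurable (Function.uncurry (KV V)) := by
  have h1 := measurable_kr_one hV
  have h2 := measurable_kr_two hV
  have h3 := measurable_kr_out hV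
  unfold KV krSum
  simp only [Function.uncurry_def]
  fun_prop

lemma measurable_KD (k₁ k₂ : ℕ) : Measurable (Function.uncurry (KD k₁ k₂)) := by
  have hB : ∀ k, Measurable ((shellB k).indicator (1 : ℝ × ℝ → ℝ≥0∞)) := fun k =>
    measurable_one.indicator (measurableSet_shellB k)
  have h1 := hB k₁
  have h2 := hB k₂
  have h3 : Measurable fun p : (ℝ × ℝ) × (ℝ × ℝ) => dd p.1.2 p.2.2 :=
    measurable_dd.comp (measurable_fst.snd.prodMk measurable_snd.snd)
  unfold KD
  simp only [Function.uncurry_def]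
  fun_prop

/-- The constant in the bilinear bound for `KV V`. -/
def krC (B : ℝ≥0∞) : ℝ≥0∞ := 3 * (64 * decInt * decInt + 4 * decInt * B) ^ (1 / 2 : ℝ)

lemma krC_lt_top {B : ℝ≥0∞} (hB : B < ∞) : krC B < ∞ := by
  have := decInt_lt_top
  unfold krC
  refine ENNReal.mul_lt_top (by simp) (ENNReal.rpow_lt_top_of_nonneg (by norm_num) ?_)
  refine (ENNReal.add_lt_top.2 ⟨?_, ?_⟩).ne
  · exact ENNReal.mul_lt_top (ENNReal.mul_lt_top (by simp) this) this
  · exact ENNReal.mul_lt_top (ENNReal.mul_lt_top (by simp) this) hB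

variable {F G : ℝ × ℝ → ℝ≥0∞}

lemma bil_add {k k' : ℝ × ℝ → ℝ × ℝ → ℝ≥0∞} (hk : Measurable (Function.uncurry k))
    (hF : Measurable F) (hG : Measurable G) (z : ℝ × ℝ) :
    bil (fun z₁ z₂ => k z₁ z₂ + k' z₁ z₂) F G z = bil k F G z + bil k' F G z := by
  have h1 : Measurable fun z₁ => k z₁ (z - z₁) :=
    hk.comp (measurable_id.prodMk (measurable_const.sub measurable_id))
  unfold bil
  rw [← lintegral_add_left (by fun_prop)]
  congr 1; ext z₁; ring

lemma bil_mono {k k' : ℝ × ℝ → ℝ × ℝ → ℝ≥0∞} (h : ∀ z₁ z₂, k z₁ z₂ ≤ k' z₁ z₂) (z : ℝ × ℝ) :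
    bil k F G z ≤ bil k' F G z := by
  unfold bil
  refine lintegral_mono fun z₁ => ?_
  gcongr
  exact h _ _

/-- Subadditivity of the square root splits the kernel into three, each bounded with its own
variable frozen. The evenness of `V` serves the frozen output: replacing `z - z₁` by `z₁ - z` brings
the integral to the form of `lintegral_kr_le`. -/
theorem nl2_bil_KV_le {V : ℝ → ℝ → ℝ} (hV : Measurable (Function.uncurry V))
    (hV0 : ∀ x y, 0 ≤ V x y) (hVx : ∀ x y, V (-x) y = V x y) (hVy : ∀ x y, V x (-y) = V x y)
    {B : ℝ≥0∞} (hB : ∀ x, ∫⁻ y, ENNReal.ofReal (V x y) ≤ B) (hF : Measurable F)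
    (hG : Measurable G) :
    nl2 (bil (KV V) F G) volume ≤ krC B * nl2 F volume * nl2 G volume := by
  set k₁ : ℝ × ℝ → ℝ × ℝ → ℝ≥0∞ := fun z₁ z₂ =>
    ENNReal.ofReal (kr V z₁.2 z₂.2 (z₁ + z₂).2 (modW z₂) (modW (z₁ + z₂))) ^ (1 / 2 : ℝ) with hk₁
  set k₂ : ℝ × ℝ → ℝ × ℝ → ℝ≥0∞ := fun z₁ z₂ =>
    ENNReal.ofReal (kr V z₂.2 z₁.2 (z₁ + z₂).2 (modW z₁) (modW (z₁ + z₂))) ^ (1 / 2 : ℝ) with hk₂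
  set k₃ : ℝ × ℝ → ℝ × ℝ → ℝ≥0∞ := fun z₁ z₂ =>
    ENNReal.ofReal (kr V (z₁ + z₂).2 z₁.2 z₂.2 (modW z₁) (modW z₂)) ^ (1 / 2 : ℝ) with hk₃
  set A : ℝ≥0∞ := (64 * decInt * decInt + 4 * decInt * B) ^ (1 / 2 : ℝ) with hA
  have m₁ : Measurable (Function.uncurry k₁) :=
    ((measurable_kr_one hV).ennreal_ofReal).pow_const _
  have m₂ : Measurable (Function.uncurry k₂) :=
    ((measurable_kr_two hV).ennreal_ofReal).pow_const _
  have m₃ : Measurable (Function.uncurry k₃) :=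
    ((measurable_kr_out hV).ennreal_ofReal).pow_const _
  have b₁ : nl2 (bil k₁ F G) volume ≤ A * nl2 F volume * nl2 G volume := by
    apply nl2_bil_le_left m₁ hF hG
    intro z₁
    unfold nl2
    rw [hA]
    gcongr
    simp only [hk₁, rpow_half_two]
    refine le_trans (le_of_eq ?_) (lintegral_kr_le hV hV0 hB z₁)
    congr 1; ext z₂
    rw [add_comm z₁ z₂, Prod.snd_add]
  have b₂ : nl2 (bil k₂ F G) volume ≤ A * nl2 F volume * nl2 G volume := by
    apply nl2_bil_le_right m₂ hF hG
    intro z₂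
    unfold nl2
    rw [hA]
    gcongr
    simp only [hk₂, rpow_half_two]
    exact lintegral_kr_le hV hV0 hB z₂
  have b₃ : nl2 (bil k₃ F G) volume ≤ A * nl2 F volume * nl2 G volume := by
    apply nl2_bil_le_out m₃ hF hG
    intro z
    unfold nl2
    rw [hA]
    gcongr
    simp only [hk₃, rpow_half_two]
    refine le_trans (le_of_eq ?_) (lintegral_kr_le hV hV0 hB (-z))
    congr 1; ext z₁
    rw [add_sub_cancel, ← modW_neg (z - z₁), neg_sub, ← sub_eq_add_neg]
    unfold kr
    rw [Prod.snd_neg, hVx, hVx, ← sub_eq_add_neg, ← dd_neg_right, ← hVy z.2 (z - z₁).2]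
    simp only [Prod.snd_sub, neg_sub]
  have hle : ∀ z₁ z₂, KV V z₁ z₂ ≤ (k₁ z₁ z₂ + k₂ z₁ z₂) + k₃ z₁ z₂ := by
    intro z₁ z₂
    unfold KV krSum
    have e1 := kr_nonneg (x := z₁.2) (y := z₂.2) (w := (z₁ + z₂).2) hV0 (one_le_modW z₂)
      (one_le_modW (z₁ + z₂))
    have e2 := kr_nonneg (x := z₂.2) (y := z₁.2) (w := (z₁ + z₂).2) hV0 (one_le_modW z₁)
      (one_le_modW (z₁ + z₂))
    have e3 := kr_nonneg (x := (z₁ + z₂).2) (y := z₁.2) (w := z₂.2) hV0 (one_le_modW z₁)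
      (one_le_modW z₂)
    rw [ENNReal.ofReal_add (by positivity) e3, ENNReal.ofReal_add e1 e2]
    refine (ENNReal.rpow_add_le_add_rpow _ _ (by norm_num) (by norm_num)).trans ?_
    gcongr
    exact ENNReal.rpow_add_le_add_rpow _ _ (by norm_num) (by norm_num)
  calc nl2 (bil (KV V) F G) volume
      ≤ nl2 (fun z => (bil k₁ F G z + bil k₂ F G z) + bil k₃ F G z) volume := by
        apply nl2_mono
        intro z
        refine (bil_mono hle z).trans (le_of_eq ?_)
        rw [bil_add (k := fun z₁ z₂ => k₁ z₁ z₂ + k₂ z₁ z₂) (m₁.add m₂) hF hG, bil_add m₁ hF hG]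
    _ ≤ (nl2 (bil k₁ F G) volume + nl2 (bil k₂ F G) volume) + nl2 (bil k₃ F G) volume := by
        refine (nl2_add_le ((measurable_bil m₁ hF hG).add (measurable_bil m₂ hF hG))
          (measurable_bil m₃ hF hG)).trans ?_
        gcongr
        exact nl2_add_le (measurable_bil m₁ hF hG) (measurable_bil m₂ hF hG)
    _ ≤ (A * nl2 F volume * nl2 G volume + A * nl2 F volume * nl2 G volume) +
          A * nl2 F volume * nl2 G volume := by gcongr
    _ = _ := by unfold krC; rw [← hA]; ring

lemma mem_shellB_neg {k : ℕ} {z : ℝ × ℝ} : -z ∈ shellB k ↔ z ∈ shellB k := by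
  have := modW_neg z
  unfold modW at this
  simp only [shellB, Set.mem_ofPred_eq, this]

theorem nl2_bil_KD_le (k₁ k₂ : ℕ) (hF : Measurable F) (hG : Measurable G) :
    nl2 (bil (KD k₁ k₂) F G) volume ≤ 16 * nl2 F volume * nl2 G volume := by
  apply nl2_bil_le_out (measurable_KD k₁ k₂) hF hG
  intro z
  unfold nl2 KD
  simp only [rpow_half_two]
  have h := lintegral_dd_shell_le (-z) k₁ k₂
  have e : (16 : ℝ≥0∞) = (256 : ℝ≥0∞) ^ (1 / 2 : ℝ) := by
    rw [show (256 : ℝ≥0∞) = 16 ^ (2 : ℝ) by norm_num, rpow_two_half]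
  rw [e]
  gcongr
  refine le_trans (le_of_eq ?_) h
  congr 1; ext z₁
  have e1 : (shellB k₂).indicator (1 : ℝ × ℝ → ℝ≥0∞) (z - z₁) =
      (shellB k₂).indicator 1 (z₁ + -z) := by
    rw [← sub_eq_add_neg, ← neg_sub z z₁]
    by_cases hz : z - z₁ ∈ shellB k₂
    · rw [Set.indicator_of_mem hz, Set.indicator_of_mem (mem_shellB_neg.2 hz)]; rfl
    · rw [Set.indicator_of_notMem hz, Set.indicator_of_notMem (mt mem_shellB_neg.1 hz)]
  rw [e1, ← dd_neg_right]
  simp only [Prod.snd_sub, Prod.snd_neg, neg_sub, ← sub_eq_add_neg]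

lemma bump_neg (β y₀ y : ℝ) : bump β y₀ (-y) = bump β y₀ y := by unfold bump; rw [abs_neg]

lemma VV_neg_left (x y : ℝ) : VV (-x) y = VV x y := by unfold VV; rw [abs_neg]

lemma VV_neg_right (x y : ℝ) : VV x (-y) = VV x y := by unfold VV; simp only [bump_neg]

lemma measurable_shellBump (k : ℕ) : Measurable (Function.uncurry (shellBump k)) := by
  unfold shellBump bump; simp only [Function.uncurry_def]; fun_prop

lemma shellBump_neg_left (k : ℕ) (x y : ℝ) : shellBump k (-x) y = shellBump k x y := by
  unfold shellBump; rw [neg_sq]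

lemma shellBump_neg_right (k : ℕ) (x y : ℝ) : shellBump k x (-y) = shellBump k x y :=
  bump_neg _ _ _

/-- The constant in the bilinear bounds. -/
def bilC : ℝ≥0∞ := krC (10 * decInt)

lemma bilC_lt_top : bilC < ∞ := krC_lt_top (ENNReal.mul_lt_top (by simp) decInt_lt_top)

lemma nl2_bil_KV_VV_le (hF : Measurable F) (hG : Measurable G) :
    nl2 (bil (KV VV) F G) volume ≤ bilC * nl2 F volume * nl2 G volume :=
  nl2_bil_KV_le measurable_VV VV_nonneg VV_neg_left VV_neg_right lintegral_VV_le hF hG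

lemma nl2_bil_KV_shellBump_le (k : ℕ) (hF : Measurable F) (hG : Measurable G) :
    nl2 (bil (KV (shellBump k)) F G) volume ≤ bilC * nl2 F volume * nl2 G volume :=
  nl2_bil_KV_le (measurable_shellBump k) (shellBump_nonneg k) (shellBump_neg_left k)
    (shellBump_neg_right k) (fun x => (lintegral_bump_le (mul_nonneg (sq_nonneg x) (by positivity)) 0).trans
      (by gcongr; norm_num)) hF hG

end Kernels

/-! ### Localized pieces of the bilinear form. -/

section Parts

/-- A localized piece of the bilinear form. -/
def part (l : ℝ → ℝ) (O : Set (ℝ × ℝ)) (k : ℝ × ℝ → ℝ × ℝ → ℝ≥0∞) (F G : ℝ × ℝ → ℝ≥0∞)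
    (z : ℝ × ℝ) : ℝ≥0∞ := O.indicator 1 z * rhoW l z * bil k F G z

lemma measurable_rhoW {l : ℝ → ℝ} (hl : Measurable l) : Measurable (rhoW l) := by
  unfold rhoW rho; fun_prop

lemma measurable_part {l : ℝ → ℝ} (hl : Measurable l) {O : Set (ℝ × ℝ)} (hO : MeasurableSet O)
    {k : ℝ × ℝ → ℝ × ℝ → ℝ≥0∞} (hk : Measurable (Function.uncurry k)) {F G : ℝ × ℝ → ℝ≥0∞}
    (hF : Measurable F) (hG : Measurable G) : Measurable (part l O k F G) :=
  ((measurable_one.indicator hO).mul (measurable_rhoW hl)).mul (measurable_bil hk hF hG)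

lemma XYn_part_le {l : ℝ → ℝ} (hl : ∀ x, x ≠ 0 → 0 < l x) {O : Set (ℝ × ℝ)}
    {c : ℝ} (hc : 1 ≤ c) {m : ℕ → ℝ} (hm : ∀ j, 0 < m j)
    (hlm : ∀ j, ∀ z ∈ shellA j, z ∈ O → z ∉ regionD → l z.2 ≤ c * m j ∧ m j ≤ c * l z.2)
    {k : ℝ × ℝ → ℝ × ℝ → ℝ≥0∞} (hk : Measurable (Function.uncurry k)) {F G : ℝ × ℝ → ℝ≥0∞}
    (hF : Measurable F) (hG : Measurable G) :
    XYn (part l O k F G) ≤ locC c * nl2 (bil k F G) volume := by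
  apply XYn_le_of_localized (measurable_bil hk hF hG) hl (O := O) _ _ hc hm hlm
  · intro z hz; simp [part, hz]
  · intro z
    unfold part
    gcongr
    by_cases hz : z ∈ O <;> simp [hz]

end Parts

/-! ### The pointwise majorant of the multiplier. -/

section Multiplier

/-- The square of the bilinear multiplier on weighted densities. -/
def mult (z₁ z₂ : ℝ × ℝ) : ℝ :=
  freqW z₁.2 z₂.2 (z₁ + z₂).2 * ((modW (z₁ + z₂))⁻¹ * (modW z₁)⁻¹ * (modW z₂)⁻¹)

/-- The bilinear multiplier on weighted densities. -/
def multK (z₁ z₂ : ℝ × ℝ) : ℝ≥0∞ := ENNReal.ofReal (mult z₁ z₂) ^ (1 / 2 : ℝ)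

/-- The constant of the pointwise bounds. -/
def ptC : ℝ≥0∞ := ENNReal.ofReal 10000000 ^ (1 / 2 : ℝ)

lemma ptC_lt_top : ptC < ∞ :=
  ENNReal.rpow_lt_top_of_nonneg (by norm_num) ENNReal.ofReal_ne_top

/-- The integrand of `part`. -/
def pk (l : ℝ → ℝ) (O : Set (ℝ × ℝ)) (k : ℝ × ℝ → ℝ × ℝ → ℝ≥0∞) (F G : ℝ × ℝ → ℝ≥0∞)
    (z₁ z₂ : ℝ × ℝ) : ℝ≥0∞ :=
  O.indicator 1 (z₁ + z₂) * rhoW l (z₁ + z₂) * (k z₁ z₂ * F z₁ * G z₂)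

variable {F G : ℝ × ℝ → ℝ≥0∞}

lemma measurable_pk {l : ℝ → ℝ} {O : Set (ℝ × ℝ)} {k : ℝ × ℝ → ℝ × ℝ → ℝ≥0∞} (hk : Measurable (Function.uncurry k))
    (hF : Measurable F) (hG : Measurable G) (z : ℝ × ℝ) :
    Measurable fun z₁ => pk l O k F G z₁ (z - z₁) := by
  have h1 : Measurable fun z₁ => k z₁ (z - z₁) :=
    hk.comp (measurable_id.prodMk (measurable_const.sub measurable_id))
  unfold pk
  simp only [add_sub_cancel]
  fun_prop

lemma part_eq {l : ℝ → ℝ} {O : Set (ℝ × ℝ)} {k : ℝ × ℝ → ℝ × ℝ → ℝ≥0∞}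
    (hk : Measurable (Function.uncurry k)) (hF : Measurable F) (hG : Measurable G) (z : ℝ × ℝ) :
    part l O k F G z = ∫⁻ z₁, pk l O k F G z₁ (z - z₁) := by
  have h1 : Measurable fun z₁ => k z₁ (z - z₁) :=
    hk.comp (measurable_id.prodMk (measurable_const.sub measurable_id))
  unfold part pk bil
  simp only [add_sub_cancel]
  rw [lintegral_const_mul _ (by fun_prop)]

/-- After taking square roots in the bound of `mult * rho`, the factor `rho^(-1/2)` becomes the
output localization `rhoW`. -/
lemma multK_le_pk {l : ℝ → ℝ} {O : Set (ℝ × ℝ)} {k : ℝ × ℝ → ℝ × ℝ → ℝ≥0∞} {z₁ z₂ : ℝ × ℝ}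
    {κ : ℝ} (hl : 0 < l (z₁ + z₂).2)
    (h : mult z₁ z₂ * rho (modW (z₁ + z₂)) (l (z₁ + z₂).2) ≤ 10000000 * κ)
    (hk : k z₁ z₂ = ENNReal.ofReal κ ^ (1 / 2 : ℝ)) (hO : z₁ + z₂ ∈ O)
    {S₁ S₂ : Set (ℝ × ℝ)} (h₁ : z₁ ∈ S₁) (h₂ : z₂ ∈ S₂) :
    multK z₁ z₂ * F z₁ * G z₂ ≤ ptC * pk l O k (S₁.indicator F) (S₂.indicator G) z₁ z₂ := by
  have hρ := rho_pos (modW_pos (z₁ + z₂)) hl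
  have e : multK z₁ z₂ ≤ ptC * (rhoW l (z₁ + z₂) * k z₁ z₂) := by
    rw [← rpow_two_half (rhoW l (z₁ + z₂)), rhoW_sq hl, hk, ptC, multK,
      ← ENNReal.mul_rpow_of_nonneg _ _ (by norm_num), ← ENNReal.mul_rpow_of_nonneg _ _ (by norm_num),
      ← ENNReal.ofReal_mul (by positivity), ← ENNReal.ofReal_mul (by norm_num)]
    gcongr
    calc mult z₁ z₂ = (mult z₁ z₂ * rho (modW (z₁ + z₂)) (l (z₁ + z₂).2)) *
          (rho (modW (z₁ + z₂)) (l (z₁ + z₂).2))⁻¹ := by field_simp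
      _ ≤ (10000000 * κ) * (rho (modW (z₁ + z₂)) (l (z₁ + z₂).2))⁻¹ := by gcongr
      _ = _ := by ring
  unfold pk
  rw [Set.indicator_of_mem hO, Set.indicator_of_mem h₁, Set.indicator_of_mem h₂, Pi.one_apply,
    one_mul]
  calc multK z₁ z₂ * F z₁ * G z₂ ≤ ptC * (rhoW l (z₁ + z₂) * k z₁ z₂) * F z₁ * G z₂ := by gcongr
    _ = _ := by ring

/-- A part of the complement of `D`, split dyadically. -/
def cell (j k : ℕ) : Set (ℝ × ℝ) := regionDᶜ ∩ (shellA j ∩ shellB k)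

/-- The output region for the sharp high-high interaction. -/
def sharpOut : Set (ℝ × ℝ) := {z | z ∈ regionD ∨ 1 / 8 < |z.2|}

lemma measurableSet_sharpOut : MeasurableSet sharpOut := by
  have : Measurable fun z : ℝ × ℝ => |z.2| := by fun_prop
  exact measurableSet_regionD.union (measurableSet_lt measurable_const this)

/-- The pointwise majorant of the bilinear form for a dominant first frequency. -/
def majK (F G : ℝ × ℝ → ℝ≥0∞) (z₁ z₂ : ℝ × ℝ) : ℝ≥0∞ :=
  pk (fun _ => 1) Set.univ (KV VV) F G z₁ z₂ +
  (pk (fun x => jap x ^ 3) Set.univ (KV VV) F G z₁ z₂ +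
  (∑' k : ℕ, pk (fun _ => 1) Set.univ (KV (shellBump k)) F ((cell 0 k).indicator G) z₁ z₂ +
  (∑' p : ℕ × Fin 3, pk (fun _ => ((2 : ℝ) ^ (p.1 + p.2 : ℕ)) ^ (3 / 2 : ℝ)) Set.univ (KV VV)
    ((shellA (p.1 + p.2)).indicator F) ((shellA p.1).indicator G) z₁ z₂ +
  ∑' p : (ℕ × Fin 3) × ℕ × ℕ, pk (fun x => |x| * ((2 : ℝ) ^ (p.1.1 + p.1.2 : ℕ)) ^ 2) sharpOut
    (KD p.2.1 p.2.2) ((cell (p.1.1 + p.1.2) p.2.1).indicator F) ((cell p.1.1 p.2.2).indicator G)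
    z₁ z₂)))

/-- The majorant of the bilinear form for a dominant first frequency. -/
def maj (F G : ℝ × ℝ → ℝ≥0∞) (z : ℝ × ℝ) : ℝ≥0∞ :=
  part (fun _ => 1) Set.univ (KV VV) F G z +
  (part (fun x => jap x ^ 3) Set.univ (KV VV) F G z +
  (∑' k : ℕ, part (fun _ => 1) Set.univ (KV (shellBump k)) F ((cell 0 k).indicator G) z +
  (∑' p : ℕ × Fin 3, part (fun _ => ((2 : ℝ) ^ (p.1 + p.2 : ℕ)) ^ (3 / 2 : ℝ)) Set.univ (KV VV)
    ((shellA (p.1 + p.2)).indicator F) ((shellA p.1).indicator G) z +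
  ∑' p : (ℕ × Fin 3) × ℕ × ℕ, part (fun x => |x| * ((2 : ℝ) ^ (p.1.1 + p.1.2 : ℕ)) ^ 2) sharpOut
    (KD p.2.1 p.2.2) ((cell (p.1.1 + p.1.2) p.2.1).indicator F) ((cell p.1.1 p.2.2).indicator G)
    z)))

lemma maj_eq (hF : Measurable F) (hG : Measurable G) (z : ℝ × ℝ) :
    maj F G z = ∫⁻ z₁, majK F G z₁ (z - z₁) := by
  have hA : ∀ j, Measurable ((shellA j).indicator F) := fun j => hF.indicator (measurableSet_shellA j)
  have hA' : ∀ j, Measurable ((shellA j).indicator G) := fun j =>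
    hG.indicator (measurableSet_shellA j)
  have hE : ∀ j k, Measurable ((cell j k).indicator F) := fun j k =>
    hF.indicator (measurableSet_cell j k)
  have hE' : ∀ j k, Measurable ((cell j k).indicator G) := fun j k =>
    hG.indicator (measurableSet_cell j k)
  have hKS := fun k => measurable_KV (measurable_shellBump k)
  have hK := measurable_KV measurable_VV
  unfold maj majK
  rw [lintegral_add_left (measurable_pk hK hF hG z),
    lintegral_add_left (measurable_pk hK hF hG z),
    lintegral_add_left (Measurable.tsum fun k => measurable_pk (hKS k) hF
      (hE' 0 k) z),
    lintegral_add_left (Measurable.tsum fun p => measurable_pk hK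
      (hA _) (hA' _) z),
    lintegral_tsum fun k => (measurable_pk (hKS k) hF
      (hE' 0 k) z).aemeasurable,
    lintegral_tsum fun p => (measurable_pk hK
      (hA _) (hA' _) z).aemeasurable,
    lintegral_tsum fun p => (measurable_pk
      (measurable_KD _ _) (hE _ _) (hE' _ _) z).aemeasurable,
    part_eq hK hF hG, part_eq hK hF hG]
  congr 2
  congr 1
  · exact tsum_congr fun k => part_eq (hKS k) hF (hE' 0 k) z
  congr 1
  · exact tsum_congr fun p => part_eq hK (hA _) (hA' _) z
  · exact tsum_congr fun p => part_eq (measurable_KD _ _) (hE _ _) (hE' _ _) z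

/-- For `|ξ| ≤ 1/8` both `ξ³` and `1/ξ` are small against `|ξ|⁻³`, so lying outside `D` bounds the
modulation by a multiple of `|ξ|⁻³`. -/
lemma modW_mul_le_of_notMem {z : ℝ × ℝ} (h0 : z.2 ≠ 0) (h : |z.2| ≤ 1 / 8) (hD : z ∉ regionD) :
    modW z * |z.2| ^ 3 ≤ 2 := by
  have hx : 0 < |z.2| := abs_pos.2 h0
  have hτ : |z.1| < (|z.2| ^ 3)⁻¹ := by
    by_contra hc
    exact hD ⟨h, not_lt.1 hc⟩
  have h1 : |modulation z| ≤ |z.1| + |z.2| ^ 3 + 1 / |z.2| := by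
    unfold modulation
    refine (abs_add_le _ _).trans ?_
    rw [abs_div, abs_one]
    gcongr
    refine (abs_sub _ _).trans ?_
    rw [abs_pow]
  have h2 : modW z ≤ 1 + ((|z.2| ^ 3)⁻¹ + |z.2| ^ 3 + 1 / |z.2|) :=
    (jap_le_one_add_abs _).trans (by linarith)
  set x := |z.2|
  calc modW z * x ^ 3 ≤ (1 + ((x ^ 3)⁻¹ + x ^ 3 + 1 / x)) * x ^ 3 := by gcongr
    _ = x ^ 3 + 1 + x ^ 6 + x ^ 2 := by field_simp; ring
    _ ≤ (1 / 8) ^ 3 + 1 + (1 / 8) ^ 6 + (1 / 8) ^ 2 := by gcongr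
    _ ≤ 2 := by norm_num

/-- The reverse comparison. It shows that in `IsLowHigh` the low input lies outside `D`, where its
norm is `ℓ¹` in the modulation. -/
lemma one_le_of_mem_regionD {z : ℝ × ℝ} (h0 : z.2 ≠ 0) (hD : z ∈ regionD) :
    1 ≤ 2 * modW z * |z.2| ^ 3 := by
  have hx : 0 < |z.2| := abs_pos.2 h0
  obtain ⟨h, hτ⟩ := hD
  have h1 : |z.1| ≤ |modulation z| + |z.2| ^ 3 + 1 / |z.2| := by
    calc |z.1| = |modulation z + z.2 ^ 3 - 1 / z.2| := by unfold modulation; congr 1; ring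
      _ ≤ |modulation z + z.2 ^ 3| + |1 / z.2| := abs_sub _ _
      _ ≤ |modulation z| + |z.2 ^ 3| + |1 / z.2| := by gcongr; exact abs_add_le _ _
      _ = _ := by rw [abs_div, abs_one, abs_pow]
  have h2 : |modulation z| ≤ modW z := abs_le_jap _
  set x := |z.2|
  have h3 : (x ^ 3)⁻¹ * x ^ 3 = 1 := by field_simp
  have h4 : 1 ≤ (modW z + x ^ 3 + 1 / x) * x ^ 3 := by
    calc (1 : ℝ) = (x ^ 3)⁻¹ * x ^ 3 := h3.symm
      _ ≤ _ := by gcongr; linarith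
  have h5 : (modW z + x ^ 3 + 1 / x) * x ^ 3 = modW z * x ^ 3 + x ^ 6 + x ^ 2 := by field_simp
  have h6 : x ^ 6 ≤ (1 / 8) ^ 6 := by gcongr
  have h7 : x ^ 2 ≤ (1 / 8) ^ 2 := by gcongr
  norm_num at h6 h7
  linarith

lemma resonance_modW {z₁ z₂ : ℝ × ℝ} (h₁ : z₁.2 ≠ 0) (h₂ : z₂.2 ≠ 0) (h : (z₁ + z₂).2 ≠ 0)
    (A : ℝ) (hA : modW (z₁ + z₂) ≤ A) (hA₁ : modW z₁ ≤ A) (hA₂ : modW z₂ ≤ A) :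
    |(z₁ + z₂).2 * z₁.2 * z₂.2| ≤ A ∧ |z₁.2| ≤ A ∧ |z₂.2| ≤ A :=
  resonance (s₁ := modulation z₁) (s₂ := modulation z₂) (s := modulation (z₁ + z₂)) rfl h₁ h₂ h
    (by simp only [modulation, Prod.fst_add]; ring) ((abs_le_jap _).trans hA)
    ((abs_le_jap _).trans hA₁) ((abs_le_jap _).trans hA₂)

lemma notMem_regionD_of_one_le {z : ℝ × ℝ} (h : 1 ≤ |z.2|) : z ∉ regionD := by
  rintro ⟨h1, -⟩; linarith

/-- The brackets differ by a factor of at most 4, so their dyadic indices differ by at most 2: hence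
`Fin 3`. -/
lemma exists_shell_index {x₁ x₂ : ℝ} (h : |x₂| ≤ |x₁|) (h' : |x₁| / 4 ≤ |x₂|) :
    ∃ (j : ℕ) (i : Fin 3), (2 ^ j ≤ jap x₂ ∧ jap x₂ < 2 ^ (j + 1)) ∧
      (2 ^ (j + i : ℕ) ≤ jap x₁ ∧ jap x₁ < 2 ^ (j + i + 1 : ℕ)) := by
  obtain ⟨j, hj, hj'⟩ := exists_dyadic (one_le_jap x₂)
  obtain ⟨j₁, h1, h1'⟩ := exists_dyadic (one_le_jap x₁)
  have e1 : jap x₂ ≤ jap x₁ := jap_le_jap h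
  have e2 : jap x₁ ≤ 4 * jap x₂ := by
    have hp := jap_pos x₂
    refine abs_le_of_sq_le_sq' ?_ (by positivity) |>.2
    rw [mul_pow, jap_sq, jap_sq, ← sq_abs x₁, ← sq_abs x₂]
    nlinarith [abs_nonneg x₁, abs_nonneg x₂]
  have l1 : j < j₁ + 1 :=
    (pow_lt_pow_iff_right₀ (show (1 : ℝ) < 2 by norm_num)).1 ((hj.trans e1).trans_lt h1')
  have l2 : j₁ < j + 3 := by
    apply (pow_lt_pow_iff_right₀ (show (1 : ℝ) < 2 by norm_num)).1
    calc (2 : ℝ) ^ j₁ ≤ 4 * jap x₂ := h1.trans e2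
      _ < 4 * 2 ^ (j + 1) := by gcongr
      _ = 2 ^ (j + 3) := by ring
  refine ⟨j, ⟨j₁ - j, by omega⟩, ⟨hj, hj'⟩, ?_⟩
  rw [show j + (j₁ - j) = j₁ by omega]
  exact ⟨h1, h1'⟩

/-- Each regime is covered by one term of `majK`. In `IsHighHigh`, an output comparable with the
inputs is localized at `⟨ξ⟩³`; a smaller output at `|ξ| Q²` if it lies in `sharpOut`, and at
`Q^(3/2)` otherwise. `IsLowHigh` uses the shell bumps. The rest is generic, localized at modulation
one. -/
lemma multK_le_majK {z₁ z₂ : ℝ × ℝ} (h₁ : z₁.2 ≠ 0) (h₂ : z₂.2 ≠ 0) (h : (z₁ + z₂).2 ≠ 0)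
    (h21 : |z₂.2| ≤ |z₁.2|) :
    multK z₁ z₂ * F z₁ * G z₂ ≤ ptC * majK F G z₁ z₂ := by
  have hres := resonance_modW h₁ h₂ h
  have o := one_le_modW (z₁ + z₂)
  have o₁ := one_le_modW z₁
  have o₂ := one_le_modW z₂
  have hsum : (z₁ + z₂).2 = z₁.2 + z₂.2 := rfl
  by_cases hHH : IsHighHigh z₁.2 z₂.2 (modW z₁) (modW z₂) (modW (z₁ + z₂))
  · have r1 := (hres _ le_rfl hHH.2.2.2.1 hHH.2.2.2.2).1
    have hN := hHH.1
    rcases le_total (|z₁.2| / 4) |(z₁ + z₂).2| with hM | hM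
    · have := multK_le_pk (F := F) (G := G) (l := fun x => jap x ^ 3) (O := Set.univ)
        (k := KV VV) (S₁ := Set.univ) (S₂ := Set.univ) (pow_pos (jap_pos _) 3)
        (comparable_out_bound hsum o₁ o₂ r1 hHH hM) rfl trivial trivial trivial
      rw [Set.indicator_univ, Set.indicator_univ] at this
      refine this.trans ?_
      unfold majK
      gcongr
      exact le_self_add.trans le_add_self
    · obtain ⟨j, i, ⟨hj, hj'⟩, hi, hi'⟩ := exists_shell_index h21 hHH.2.2.1
      set Q : ℝ := 2 ^ (j + i : ℕ) with hQ
      have hQ0 : 0 < Q := by positivity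
      have hA₁ : z₁ ∈ shellA (j + i) := ⟨hi, hi'⟩
      have hA₂ : z₂ ∈ shellA j := ⟨hj, hj'⟩
      have q1 : |z₁.2| ≤ 2 * Q := by
        have := (abs_le_jap z₁.2).trans hi'.le
        rw [pow_succ] at this; linarith
      have q2 : Q ≤ 5 / 4 * |z₁.2| := hi.trans ((jap_le_one_add_abs _).trans (by linarith))
      by_cases hO : z₁ + z₂ ∈ sharpOut
      · obtain ⟨k₁, hk₁⟩ := exists_dyadic o₁
        obtain ⟨k₂, hk₂⟩ := exists_dyadic o₂
        have hb := high_high_sharp_bound (Q := Q) hsum o₁ o₂ h r1 hHH hM q1 (by linarith)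
        have hm₁ : z₁ ∈ cell (j + i) k₁ := ⟨notMem_regionD_of_one_le (by linarith), hA₁, hk₁⟩
        have hm₂ : z₂ ∈ cell j k₂ :=
          ⟨notMem_regionD_of_one_le (by have := hHH.2.2.1; linarith), hA₂, hk₂⟩
        have d0 := dd_nonneg z₁.2 z₂.2
        have := multK_le_pk (F := F) (G := G) (l := fun x => |x| * Q ^ 2) (O := sharpOut)
          (k := KD k₁ k₂) (κ := dd z₁.2 z₂.2 * ((2 ^ k₁)⁻¹ * (2 ^ k₂)⁻¹))
          (mul_pos (abs_pos.2 h) (by positivity))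
          (hb.trans (by
            have := hk₁.1
            have := hk₂.1
            gcongr))
          (by
            unfold KD
            rw [Set.indicator_of_mem (show z₁ ∈ shellB k₁ from hk₁),
              Set.indicator_of_mem (show z₂ ∈ shellB k₂ from hk₂), Pi.one_apply, Pi.one_apply,
              mul_one, mul_one, ENNReal.ofReal_mul d0]) hO hm₁ hm₂
        refine this.trans ?_
        unfold majK
        gcongr
        refine le_trans ?_ (le_add_self.trans (le_add_self.trans (le_add_self.trans le_add_self)))
        exact ENNReal.le_tsum (f := fun p : (ℕ × Fin 3) × ℕ × ℕ =>
          pk (fun x => |x| * ((2 : ℝ) ^ (p.1.1 + p.1.2 : ℕ)) ^ 2) sharpOut (KD p.2.1 p.2.2)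
            ((cell (p.1.1 + p.1.2) p.2.1).indicator F) ((cell p.1.1 p.2.2).indicator G)
            z₁ z₂) ((j, i), k₁, k₂)
      · have hx8 : |(z₁ + z₂).2| ≤ 1 / 8 := by
          by_contra hc
          exact hO (Or.inr (not_le.1 hc))
        have hnD : z₁ + z₂ ∉ regionD := fun hc => hO (Or.inl hc)
        have hN0 : 0 < |z₁.2| := by linarith
        have p1 : |z₁.2| ^ (3 / 2 : ℝ) ≤ 4 * Q ^ (3 / 2 : ℝ) := by
          calc |z₁.2| ^ (3 / 2 : ℝ) ≤ (2 * Q) ^ (3 / 2 : ℝ) := by gcongr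
            _ = 2 ^ (3 / 2 : ℝ) * Q ^ (3 / 2 : ℝ) := Real.mul_rpow (by norm_num) hQ0.le
            _ ≤ 2 ^ (2 : ℝ) * Q ^ (3 / 2 : ℝ) := by
                gcongr
                · norm_num
                · norm_num
            _ = _ := by norm_num
        have p2 : Q ^ (3 / 2 : ℝ) ≤ 4 * |z₁.2| ^ (3 / 2 : ℝ) := by
          calc Q ^ (3 / 2 : ℝ) ≤ (2 * |z₁.2|) ^ (3 / 2 : ℝ) := by gcongr; linarith
            _ = 2 ^ (3 / 2 : ℝ) * |z₁.2| ^ (3 / 2 : ℝ) := Real.mul_rpow (by norm_num) hN0.le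
            _ ≤ 2 ^ (2 : ℝ) * |z₁.2| ^ (3 / 2 : ℝ) := by
                gcongr
                · norm_num
                · norm_num
            _ = _ := by norm_num
        have := multK_le_pk (F := F) (G := G) (l := fun _ => Q ^ (3 / 2 : ℝ)) (O := Set.univ)
          (k := KV VV) (Real.rpow_pos_of_pos hQ0 _)
          (high_high_low_bound hsum o₁ o₂ h r1 hHH hM (modW_mul_le_of_notMem h hx8 hnD)
            (Real.rpow_pos_of_pos hQ0 _) p1 p2) rfl trivial hA₁ hA₂
        refine this.trans ?_
        unfold majK
        gcongr
        refine le_trans ?_ (le_self_add.trans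
          (le_add_self.trans (le_add_self.trans le_add_self)))
        exact ENNReal.le_tsum (f := fun p : ℕ × Fin 3 =>
          pk (fun _ => ((2 : ℝ) ^ (p.1 + p.2 : ℕ)) ^ (3 / 2 : ℝ)) Set.univ (KV VV)
            ((shellA (p.1 + p.2)).indicator F) ((shellA p.1).indicator G) z₁ z₂) (j, i)
  by_cases hLH : IsLowHigh z₁.2 z₂.2 (modW z₁) (modW z₂) (modW (z₁ + z₂))
  · have r1 := (hres _ hLH.2.2.2.1 hLH.2.2.1 le_rfl).1
    obtain ⟨k, hk, hk'⟩ := exists_dyadic o₂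
    have hm : z₂ ∈ cell 0 k := by
      refine ⟨fun hc => ?_, ⟨by simpa using one_le_jap z₂.2, ?_⟩, hk, hk'⟩
      · have := one_le_of_mem_regionD h₂ hc
        have := hLH.2.2.2.2
        linarith
      · have h1 := hLH.2.1
        have hp := jap_pos z₂.2
        have : jap z₂.2 ^ 2 ≤ 2 := by
          rw [jap_sq, ← sq_abs]; nlinarith [abs_nonneg z₂.2]
        norm_num
        nlinarith
    have := multK_le_pk (F := F) (G := G) (l := fun _ => 1) (O := Set.univ)
      (k := KV (shellBump k)) (S₁ := Set.univ) one_pos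
      (low_high_bound hsum o o₁ o₂ r1 hLH hk hk') rfl trivial trivial hm
    rw [Set.indicator_univ] at this
    refine this.trans ?_
    unfold majK
    gcongr
    refine le_trans ?_ (le_self_add.trans (le_add_self.trans le_add_self))
    exact ENNReal.le_tsum (f := fun k : ℕ =>
      pk (fun _ => 1) Set.univ (KV (shellBump k)) F ((cell 0 k).indicator G) z₁ z₂) k
  · have := multK_le_pk (F := F) (G := G) (l := fun _ => 1) (O := Set.univ)
      (k := KV VV) (S₁ := Set.univ) (S₂ := Set.univ) one_pos
      (generic_bound_rho o o₁ o₂ (generic_bound hsum h₁ h₂ h o o₁ o₂ h21 hres hHH hLH))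
      rfl trivial trivial trivial
    rw [Set.indicator_univ, Set.indicator_univ] at this
    refine this.trans ?_
    unfold majK
    gcongr
    exact le_self_add

/-- The multiplier restricted to a dominant first frequency. -/
def multK₁ (z₁ z₂ : ℝ × ℝ) : ℝ≥0∞ := {w : (ℝ × ℝ) × (ℝ × ℝ) | |w.2.2| ≤ |w.1.2|}.indicator
  (fun w => multK w.1 w.2) (z₁, z₂)

lemma multK_eq_zero {z₁ z₂ : ℝ × ℝ} (h : (z₁ + z₂).2 = 0) : multK z₁ z₂ = 0 := by
  unfold multK mult freqW
  rw [h]; norm_num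

lemma multK_comm (z₁ z₂ : ℝ × ℝ) : multK z₁ z₂ = multK z₂ z₁ := by
  unfold multK mult
  rw [freqW_comm, add_comm z₂ z₁]
  congr 2; ring

lemma measurable_multK : Measurable (Function.uncurry multK) := by
  unfold multK mult freqW
  simp only [Function.uncurry_def]
  fun_prop

lemma measurable_multK₁ : Measurable (Function.uncurry multK₁) := by
  have h1 : Measurable fun w : (ℝ × ℝ) × (ℝ × ℝ) => |w.2.2| := by fun_prop
  have h2 : Measurable fun w : (ℝ × ℝ) × (ℝ × ℝ) => |w.1.2| := by fun_prop
  exact measurable_multK.indicator (measurableSet_le h1 h2)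

lemma multK_le (z₁ z₂ : ℝ × ℝ) : multK z₁ z₂ ≤ multK₁ z₁ z₂ + multK₁ z₂ z₁ := by
  unfold multK₁
  rcases le_total |z₂.2| |z₁.2| with h | h
  · rw [Set.indicator_of_mem (show (z₁, z₂) ∈ {w : (ℝ × ℝ) × (ℝ × ℝ) | |w.2.2| ≤ |w.1.2|} from h)]
    exact le_self_add
  · rw [Set.indicator_of_mem (show (z₂, z₁) ∈ {w : (ℝ × ℝ) × (ℝ × ℝ) | |w.2.2| ≤ |w.1.2|} from h),
      multK_comm z₁ z₂]
    exact le_add_self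

lemma bil_multK₁_le (hF : Measurable F) (hG : Measurable G) (z : ℝ × ℝ) :
    bil multK₁ F G z ≤ ptC * maj F G z := by
  rw [maj_eq hF hG, ← lintegral_const_mul' _ _ ptC_lt_top.ne]
  unfold bil
  have a1 := ae_snd_ne_zero
  have a2 : ∀ᵐ z₁ : ℝ × ℝ, (z - z₁).2 ≠ 0 :=
    (quasiMeasurePreserving_sub_left volume z).ae ae_snd_ne_zero
  apply lintegral_mono_ae
  filter_upwards [a1, a2] with z₁ h1 h2
  by_cases h : (z₁ + (z - z₁)).2 = 0
  · have : multK₁ z₁ (z - z₁) = 0 := by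
      unfold multK₁
      rw [Set.indicator_apply_eq_zero]
      exact fun _ => multK_eq_zero h
    rw [this]; simp
  · by_cases h21 : |(z - z₁).2| ≤ |z₁.2|
    · have e : multK₁ z₁ (z - z₁) = multK z₁ (z - z₁) :=
        Set.indicator_of_mem (show (z₁, z - z₁) ∈
          {w : (ℝ × ℝ) × (ℝ × ℝ) | |w.2.2| ≤ |w.1.2|} from h21) _
      rw [e]
      exact multK_le_majK h1 h2 h h21
    · have e : multK₁ z₁ (z - z₁) = 0 :=
        Set.indicator_of_notMem (show (z₁, z - z₁) ∉
          {w : (ℝ × ℝ) × (ℝ × ℝ) | |w.2.2| ≤ |w.1.2|} from h21) _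
      rw [e]; simp

lemma bil_multK_le (hF : Measurable F) (hG : Measurable G) (z : ℝ × ℝ) :
    bil multK F G z ≤ ptC * maj F G z + ptC * maj G F z := by
  calc bil multK F G z ≤ bil (fun z₁ z₂ => multK₁ z₁ z₂ + multK₁ z₂ z₁) F G z := bil_mono multK_le z
    _ = bil multK₁ F G z + bil (fun z₁ z₂ => multK₁ z₂ z₁) F G z := bil_add measurable_multK₁ hF hG z
    _ = bil multK₁ F G z + bil multK₁ G F z := by rw [bil_swap (k := multK₁) (F := G)]
    _ ≤ _ := add_le_add (bil_multK₁_le hF hG z) (bil_multK₁_le hG hF z)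

end Multiplier

/-! ### Summation of the dyadic pieces. -/

section Summation

/-- Almost diagonal interaction: Cauchy–Schwarz in `j` for each of the three shifts. -/
lemma tsum_shift_mul_le (a b : ℕ → ℝ≥0∞) :
    ∑' p : ℕ × Fin 3, a (p.1 + p.2) * b p.1 ≤
      3 * ((∑' j, a j ^ (2 : ℝ)) ^ (1 / 2 : ℝ) * (∑' j, b j ^ (2 : ℝ)) ^ (1 / 2 : ℝ)) := by
  rw [ENNReal.tsum_prod', ENNReal.tsum_comm]
  calc ∑' i : Fin 3, ∑' j : ℕ, a (j + i) * b j
      ≤ ∑' _ : Fin 3, (∑' j, a j ^ (2 : ℝ)) ^ (1 / 2 : ℝ) * (∑' j, b j ^ (2 : ℝ)) ^ (1 / 2 : ℝ) := by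
        gcongr with i
        refine (tsum_mul_le_ell2 (fun j => a (j + i)) b).trans ?_
        gcongr ?_ ^ _ * _
        exact ENNReal.tsum_comp_le_tsum_of_injective (f := fun j : ℕ => j + (i : ℕ))
          (add_left_injective _) fun j => a j ^ (2 : ℝ)
    _ = _ := by simp [tsum_fintype]

lemma tsum_shellA_le (F : ℝ × ℝ → ℝ≥0∞) :
    (∑' j, nl2 ((shellA j).indicator F) volume ^ (2 : ℝ)) ^ (1 / 2 : ℝ) ≤ nl2 F volume := by
  rw [tsum_nl2_sq_le (measurableSet_shellA) (fun i j hij => Set.disjoint_left.2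
    fun z h1 h2 => hij (disjoint_dyadic h1.1 h1.2 h2.1 h2.2)), rpow_two_half]
  exact nl2_mono fun z => Set.indicator_le_self _ _ _

/-- The `ℓ¹` sum over the modulation shells at frequency `2 ^ j`. -/
def cellSum (F : ℝ × ℝ → ℝ≥0∞) (j : ℕ) : ℝ≥0∞ := ∑' k, nl2 ((cell j k).indicator F) volume

lemma ell2_cellSum_le (F : ℝ × ℝ → ℝ≥0∞) :
    (∑' j, cellSum F j ^ (2 : ℝ)) ^ (1 / 2 : ℝ) ≤ Xn F := le_self_add

lemma cellSum_le (F : ℝ × ℝ → ℝ≥0∞) (j : ℕ) : cellSum F j ≤ Xn F := by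
  rw [← rpow_two_half (cellSum F j)]
  refine le_trans ?_ (ell2_cellSum_le F)
  gcongr
  exact ENNReal.le_tsum j

variable {F G : ℝ × ℝ → ℝ≥0∞}

/-- The constant in the bound of the majorant. -/
def majC : ℝ≥0∞ :=
  locC 1 * bilC + (locC 8 * bilC + (locC 1 * bilC + (3 * (locC 1 * bilC) + 3 * (locC 9 * 16))))

lemma majC_lt_top : majC < ∞ := by
  have h := locC_lt_top
  have b := bilC_lt_top
  have e := fun c => ENNReal.mul_lt_top (h c) b
  unfold majC
  simp only [ENNReal.add_lt_top]
  exact ⟨e _, e _, e _, ENNReal.mul_lt_top (by simp) (e _),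
    ENNReal.mul_lt_top (by simp) (ENNReal.mul_lt_top (h _) (by simp))⟩

lemma XYn_maj_le (hF : Measurable F) (hG : Measurable G) :
    XYn (maj F G) ≤ majC * Xn F * Xn G := by
  have hA : ∀ j, Measurable ((shellA j).indicator F) := fun j => hF.indicator (measurableSet_shellA j)
  have hA' : ∀ j, Measurable ((shellA j).indicator G) := fun j =>
    hG.indicator (measurableSet_shellA j)
  have hE : ∀ j k, Measurable ((cell j k).indicator F) := fun j k =>
    hF.indicator (measurableSet_cell j k)
  have hE' : ∀ j k, Measurable ((cell j k).indicator G) := fun j k =>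
    hG.indicator (measurableSet_cell j k)
  have hKS := fun k => measurable_KV (measurable_shellBump k)
  have hK := measurable_KV measurable_VV
  have nF := nl2_le_Xn hF
  have nG := nl2_le_Xn hG
  have m1 : Measurable (part (fun _ => 1) Set.univ (KV VV) F G) :=
    measurable_part measurable_const .univ hK hF hG
  have m2 : Measurable (part (fun x => jap x ^ 3) Set.univ (KV VV) F G) :=
    measurable_part (by fun_prop) .univ hK hF hG
  have m3 : ∀ k, Measurable (part (fun _ => 1) Set.univ (KV (shellBump k)) F
      ((cell 0 k).indicator G)) := fun k =>
    measurable_part measurable_const .univ (hKS k) hF (hE' 0 k)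
  have m4 : ∀ p : ℕ × Fin 3, Measurable (part (fun _ => ((2 : ℝ) ^ (p.1 + p.2 : ℕ)) ^ (3 / 2 : ℝ))
      Set.univ (KV VV) ((shellA (p.1 + p.2)).indicator F) ((shellA p.1).indicator G)) := fun p =>
    measurable_part measurable_const .univ hK (hA _) (hA' _)
  have m5 : ∀ p : (ℕ × Fin 3) × ℕ × ℕ, Measurable (part
      (fun x => |x| * ((2 : ℝ) ^ (p.1.1 + p.1.2 : ℕ)) ^ 2) sharpOut
      (KD p.2.1 p.2.2) ((cell (p.1.1 + p.1.2) p.2.1).indicator F)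
      ((cell p.1.1 p.2.2).indicator G)) := fun p =>
    measurable_part (by fun_prop) measurableSet_sharpOut (measurable_KD _ _) (hE _ _) (hE' _ _)
  have b1 : XYn (part (fun _ => 1) Set.univ (KV VV) F G) ≤ locC 1 * bilC * (Xn F * Xn G) := by
    refine (XYn_part_le (fun _ _ => one_pos) (c := 1) le_rfl (m := fun _ => 1) (fun _ => one_pos)
      (fun _ _ _ _ _ => by norm_num) hK hF hG).trans ?_
    rw [mul_assoc]
    gcongr
    refine (nl2_bil_KV_VV_le hF hG).trans ?_
    rw [mul_assoc]
    gcongr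
  have b2 : XYn (part (fun x => jap x ^ 3) Set.univ (KV VV) F G) ≤
      locC 8 * bilC * (Xn F * Xn G) := by
    refine (XYn_part_le (fun x _ => pow_pos (jap_pos x) 3) (c := 8) (by norm_num)
      (m := fun j => ((2 : ℝ) ^ j) ^ 3) (fun _ => by positivity) ?_ hK hF hG).trans ?_
    · rintro j z ⟨h1, h2⟩ - -
      have p := jap_pos z.2
      constructor
      · calc jap z.2 ^ 3 ≤ (2 ^ (j + 1)) ^ 3 := by gcongr
          _ = _ := by ring
      · calc ((2 : ℝ) ^ j) ^ 3 ≤ jap z.2 ^ 3 := by gcongr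
          _ ≤ _ := by
            have : 0 < jap z.2 ^ 3 := by positivity
            linarith
    · rw [mul_assoc]
      gcongr
      refine (nl2_bil_KV_VV_le hF hG).trans ?_
      rw [mul_assoc]
      gcongr
  -- The kernel varies with `k`, so the pieces are added by the triangle inequality; the `ℓ¹` sum of
  -- `Xn` over the cells in `A_0` pays for it.
  have b3 : XYn (fun z => ∑' k : ℕ, part (fun _ => 1) Set.univ (KV (shellBump k)) F
      ((cell 0 k).indicator G) z) ≤ locC 1 * bilC * (Xn F * Xn G) := by
    refine (XYn_tsum_le m3).trans ?_
    calc _ ≤ ∑' k, locC 1 * bilC * (nl2 F volume * nl2 ((cell 0 k).indicator G) volume) := by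
          gcongr with k
          refine (XYn_part_le (fun _ _ => one_pos) (c := 1) le_rfl (m := fun _ => 1)
            (fun _ => one_pos) (fun _ _ _ _ _ => by norm_num) (hKS k) hF (hE' 0 k)).trans ?_
          rw [mul_assoc (locC 1)]
          gcongr
          refine (nl2_bil_KV_shellBump_le k hF (hE' 0 k)).trans (le_of_eq (by ring))
      _ = locC 1 * bilC * (nl2 F volume * cellSum G 0) := by
          rw [ENNReal.tsum_mul_left, ENNReal.tsum_mul_left]; rfl
      _ ≤ _ := by gcongr; exact cellSum_le G 0
  -- The reference modulation is constant in each piece, and both inputs lie in nearby frequency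
  -- shells, so orthogonality of these shells gives the sum.
  have b4 : XYn (fun z => ∑' p : ℕ × Fin 3, part
      (fun _ => ((2 : ℝ) ^ (p.1 + p.2 : ℕ)) ^ (3 / 2 : ℝ)) Set.univ (KV VV)
      ((shellA (p.1 + p.2)).indicator F) ((shellA p.1).indicator G) z) ≤
      3 * (locC 1 * bilC) * (Xn F * Xn G) := by
    refine (XYn_tsum_le m4).trans ?_
    calc _ ≤ ∑' p : ℕ × Fin 3, locC 1 * bilC * (nl2 ((shellA (p.1 + p.2)).indicator F) volume *
            nl2 ((shellA p.1).indicator G) volume) := by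
          gcongr with p
          have hp : (0 : ℝ) < ((2 : ℝ) ^ (p.1 + p.2 : ℕ)) ^ (3 / 2 : ℝ) := by positivity
          refine (XYn_part_le (fun _ _ => hp) (c := 1) le_rfl
            (m := fun _ => ((2 : ℝ) ^ (p.1 + p.2 : ℕ)) ^ (3 / 2 : ℝ))
            (fun _ => hp) (fun _ _ _ _ _ => by norm_num) hK (hA _) (hA' _)).trans ?_
          rw [mul_assoc (locC 1)]
          gcongr
          refine (nl2_bil_KV_VV_le (hA _) (hA' _)).trans (le_of_eq (by ring))
      _ = locC 1 * bilC * ∑' p : ℕ × Fin 3, (nl2 ((shellA (p.1 + p.2)).indicator F) volume *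
            nl2 ((shellA p.1).indicator G) volume) := ENNReal.tsum_mul_left
      _ ≤ locC 1 * bilC * (3 * (nl2 F volume * nl2 G volume)) := by
          gcongr
          refine (tsum_shift_mul_le (fun j => nl2 ((shellA j).indicator F) volume)
            (fun j => nl2 ((shellA j).indicator G) volume)).trans ?_
          gcongr
          · exact tsum_shellA_le F
          · exact tsum_shellA_le G
      _ ≤ locC 1 * bilC * (3 * (Xn F * Xn G)) := by gcongr
      _ = _ := by ring
  -- `KD` fixes the modulation shells of both inputs: the `ℓ¹` sums of both `Xn` norms are spent,
  -- then Cauchy–Schwarz in `j`.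
  have b5 : XYn (fun z => ∑' p : (ℕ × Fin 3) × ℕ × ℕ, part
      (fun x => |x| * ((2 : ℝ) ^ (p.1.1 + p.1.2 : ℕ)) ^ 2) sharpOut
      (KD p.2.1 p.2.2) ((cell (p.1.1 + p.1.2) p.2.1).indicator F)
      ((cell p.1.1 p.2.2).indicator G) z) ≤ 3 * (locC 9 * 16) * (Xn F * Xn G) := by
    refine (XYn_tsum_le m5).trans ?_
    calc _ ≤ ∑' p : (ℕ × Fin 3) × ℕ × ℕ, locC 9 * 16 *
            (nl2 ((cell (p.1.1 + p.1.2) p.2.1).indicator F) volume *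
              nl2 ((cell p.1.1 p.2.2).indicator G) volume) := by
          gcongr with p
          have hp : (0 : ℝ) < ((2 : ℝ) ^ (p.1.1 + p.1.2 : ℕ)) ^ 2 := by positivity
          refine (XYn_part_le (fun x hx => mul_pos (abs_pos.2 hx) hp) (c := 9) (by norm_num)
            (m := fun j => 2 ^ j * ((2 : ℝ) ^ (p.1.1 + p.1.2 : ℕ)) ^ 2)
            (fun _ => by positivity) ?_ (measurable_KD _ _) (hE _ _) (hE' _ _)).trans ?_
          · rintro j z ⟨h1, h2⟩ hO hD
            -- In `sharpOut` but outside `D` one has `|ξ| > 1/8`, hence `⟨ξ⟩ ≤ 9 |ξ|`, and the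
            -- reference value is comparable with a constant on each frequency shell.
            have h8 : 1 / 8 < |z.2| := hO.resolve_left hD
            have hj : jap z.2 ≤ 9 * |z.2| := (jap_le_one_add_abs _).trans (by linarith)
            have ha := abs_le_jap z.2
            rw [pow_succ] at h2
            simp only [← mul_assoc]
            constructor
            · gcongr
              have : (0 : ℝ) < 2 ^ j := by positivity
              linarith
            · gcongr
              linarith
          · rw [mul_assoc (locC 9)]
            gcongr
            refine (nl2_bil_KD_le _ _ (hE _ _) (hE' _ _)).trans (le_of_eq (by ring))
      _ = locC 9 * 16 * ∑' p : ℕ × Fin 3, cellSum F (p.1 + p.2) * cellSum G p.1 := by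
          rw [ENNReal.tsum_mul_left, ENNReal.tsum_prod']
          congr 1
          refine tsum_congr fun p => ?_
          rw [ENNReal.tsum_prod']
          unfold cellSum
          simp only [ENNReal.tsum_mul_left, ENNReal.tsum_mul_right]
      _ ≤ locC 9 * 16 * (3 * (Xn F * Xn G)) := by
          gcongr
          refine (tsum_shift_mul_le _ _).trans ?_
          gcongr
          · exact ell2_cellSum_le F
          · exact ell2_cellSum_le G
      _ = _ := by ring
  have M3 : Measurable fun z => ∑' k : ℕ, part (fun _ => 1) Set.univ (KV (shellBump k)) F
      ((cell 0 k).indicator G) z := .tsum m3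
  have M4 : Measurable fun z => ∑' p : ℕ × Fin 3, part
      (fun _ => ((2 : ℝ) ^ (p.1 + p.2 : ℕ)) ^ (3 / 2 : ℝ)) Set.univ (KV VV)
      ((shellA (p.1 + p.2)).indicator F) ((shellA p.1).indicator G) z := .tsum m4
  have M5 : Measurable fun z => ∑' p : (ℕ × Fin 3) × ℕ × ℕ, part
      (fun x => |x| * ((2 : ℝ) ^ (p.1.1 + p.1.2 : ℕ)) ^ 2) sharpOut
      (KD p.2.1 p.2.2) ((cell (p.1.1 + p.1.2) p.2.1).indicator F)
      ((cell p.1.1 p.2.2).indicator G) z := .tsum m5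
  unfold maj
  refine (XYn_add_le m1 (m2.add (M3.add (M4.add M5)))).trans ?_
  refine (add_le_add b1 ((XYn_add_le m2 (M3.add (M4.add M5))).trans
    (add_le_add b2 ((XYn_add_le M3 (M4.add M5)).trans
      (add_le_add b3 ((XYn_add_le M4 M5).trans (add_le_add b4 b5))))))).trans (le_of_eq ?_)
  unfold majC
  ring

/-- The constant in the bilinear estimate. -/
def mainC : ℝ≥0∞ := 2 * (ptC * majC)

lemma mainC_lt_top : mainC < ∞ :=
  ENNReal.mul_lt_top (by simp) (ENNReal.mul_lt_top ptC_lt_top majC_lt_top)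

lemma measurable_maj (hF : Measurable F) (hG : Measurable G) : Measurable (maj F G) := by
  unfold maj
  refine (measurable_part measurable_const .univ (measurable_KV measurable_VV) hF hG).add
    ((measurable_part (by fun_prop) .univ (measurable_KV measurable_VV) hF hG).add
    ((Measurable.tsum fun k => measurable_part measurable_const .univ
      (measurable_KV (measurable_shellBump k)) hF (hG.indicator (measurableSet_cell 0 k))).add
    ((Measurable.tsum fun p => measurable_part measurable_const .univ
      (measurable_KV measurable_VV) (hF.indicator (measurableSet_shellA _))
      (hG.indicator (measurableSet_shellA _))).add
    (Measurable.tsum fun p => measurable_part (by fun_prop) measurableSet_sharpOut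
      (measurable_KD _ _) (hF.indicator (measurableSet_cell _ _))
      (hG.indicator (measurableSet_cell _ _))))))

lemma XYn_const_mul {H : ℝ × ℝ → ℝ≥0∞} (hH : Measurable H) (c : ℝ≥0∞) :
    XYn (fun z => c * H z) = c * XYn H := by
  have hi : ∀ s : Set (ℝ × ℝ), s.indicator (fun z => c * H z) = fun z => c * s.indicator H z := by
    intro s; ext z; by_cases hz : z ∈ s <;> simp [hz]
  unfold XYn Xn Yn
  rw [mul_add, mul_add]
  congr 1
  · congr 1
    · simp_rw [hi, nl2_const_mul (hH.indicator (measurableSet_cell _ _)), ENNReal.tsum_mul_left,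
        ENNReal.mul_rpow_of_nonneg _ _ (show (0 : ℝ) ≤ 2 by norm_num)]
      rw [ENNReal.tsum_mul_left, ENNReal.mul_rpow_of_nonneg _ _ (by norm_num), rpow_two_half]
    · rw [hi, nl2_const_mul (hH.indicator measurableSet_regionD)]
  · have hm : Measurable fun w : ℝ × ℝ =>
        ENNReal.ofReal (modW (w.2, w.1) ^ (-(1 / 2) : ℝ)) * H (w.2, w.1) := by
      have := measurable_modW
      fun_prop
    rw [← nl2_const_mul hm.lintegral_prod_right']
    congr 1; ext ξ
    have hξ : Measurable fun τ : ℝ => ENNReal.ofReal (modW (τ, ξ) ^ (-(1 / 2) : ℝ)) * H (τ, ξ) := by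
      have := measurable_modW
      fun_prop
    rw [← lintegral_const_mul _ hξ]
    congr 1; ext τ
    ring

/-- The bilinear estimate on weighted densities. -/
theorem XYn_bil_multK_le (hF : Measurable F) (hG : Measurable G) :
    XYn (bil multK F G) ≤ mainC * Xn F * Xn G := by
  have m1 := measurable_maj hF hG
  have m2 := measurable_maj hG hF
  calc XYn (bil multK F G) ≤ XYn (fun z => ptC * maj F G z + ptC * maj G F z) :=
        XYn_mono (bil_multK_le hF hG)
    _ ≤ XYn (fun z => ptC * maj F G z) + XYn (fun z => ptC * maj G F z) :=
        XYn_add_le (m1.const_mul _) (m2.const_mul _)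
    _ = ptC * XYn (maj F G) + ptC * XYn (maj G F) := by rw [XYn_const_mul m1, XYn_const_mul m2]
    _ ≤ ptC * (majC * Xn F * Xn G) + ptC * (majC * Xn G * Xn F) := by
        gcongr
        · exact XYn_maj_le hF hG
        · exact XYn_maj_le hG hF
    _ = _ := by unfold mainC; ring

end Summation

/-! ### Convergence of the convolution integral. -/

section Existence

/-- The weight of the `X` norm. -/
def wt (z : ℝ × ℝ) : ℝ := jap z.2 ^ (-3 / 4 : ℝ) * modW z ^ (1 / 2 : ℝ)

lemma wt_pos (z : ℝ × ℝ) : 0 < wt z :=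
  mul_pos (Real.rpow_pos_of_pos (jap_pos _) _) (Real.rpow_pos_of_pos (modW_pos _) _)

lemma measurable_wt : Measurable wt := by unfold wt; fun_prop

lemma wt_sq (z : ℝ × ℝ) : wt z ^ 2 = (jap z.2 ^ (3 / 2 : ℝ))⁻¹ * modW z := by
  unfold wt
  rw [mul_pow, ← Real.rpow_natCast, ← Real.rpow_mul (jap_pos _).le, ← Real.rpow_natCast,
    ← Real.rpow_mul (modW_pos _).le, ← Real.rpow_neg (jap_pos _).le]
  norm_num

/-- The weighted density. -/
def wtd (a : ℝ × ℝ → ℝ≥0∞) (z : ℝ × ℝ) : ℝ≥0∞ := ENNReal.ofReal (wt z) * a z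

lemma measurable_wtd {a : ℝ × ℝ → ℝ≥0∞} (ha : Measurable a) : Measurable (wtd a) := by
  have := measurable_wt
  unfold wtd; fun_prop

/-- The convolution of nonnegative functions. -/
def cv (a b : ℝ × ℝ → ℝ≥0∞) (z : ℝ × ℝ) : ℝ≥0∞ := ∫⁻ z₁, a z₁ * b (z - z₁)

lemma measurable_cv {a b : ℝ × ℝ → ℝ≥0∞} (ha : Measurable a) (hb : Measurable b) :
    Measurable (cv a b) :=
  Measurable.lintegral_prod_right' (f := fun w : (ℝ × ℝ) × (ℝ × ℝ) => a w.2 * b (w.1 - w.2))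
    (by fun_prop)

variable {a b : ℝ × ℝ → ℝ≥0∞}

/-- The input weights combine with the square root of `Q` into a function of the output alone, which
leaves the integral. -/
lemma bil_sqrt_wtd (ha : Measurable a) (hb : Measurable b) {Q : ℝ × ℝ → ℝ × ℝ → ℝ} {c : ℝ × ℝ → ℝ}
    (hc : ∀ z, 0 ≤ c z) (z : ℝ × ℝ)
    (h : ∀ z₁ z₂, Q z₁ z₂ * (wt z₁ ^ 2 * wt z₂ ^ 2) = c (z₁ + z₂) ^ 2) :
    bil (fun z₁ z₂ => ENNReal.ofReal (Q z₁ z₂) ^ (1 / 2 : ℝ)) (wtd a) (wtd b) z =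
      ENNReal.ofReal (c z) * cv a b z := by
  unfold bil cv wtd
  rw [← lintegral_const_mul _ (by fun_prop)]
  congr 1; ext z₁
  have h1 := h z₁ (z - z₁)
  rw [add_sub_cancel] at h1
  have w1 := wt_pos z₁
  have w2 := wt_pos (z - z₁)
  have e : ENNReal.ofReal (Q z₁ (z - z₁)) ^ (1 / 2 : ℝ) *
      (ENNReal.ofReal (wt z₁) * ENNReal.ofReal (wt (z - z₁))) = ENNReal.ofReal (c z) := by
    rw [← ENNReal.ofReal_mul w1.le, ← rpow_two_half (ENNReal.ofReal (wt z₁ * wt (z - z₁))),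
      ← ENNReal.mul_rpow_of_nonneg _ _ (by norm_num), ENNReal.rpow_two,
      ← ENNReal.ofReal_pow (by positivity), ← ENNReal.ofReal_mul' (by positivity), mul_pow, h1,
      ENNReal.ofReal_pow (hc z), ← ENNReal.rpow_two, rpow_two_half]
  rw [← e]; ring

/-- The weight of the output in the bilinear estimate. -/
def outW (z : ℝ × ℝ) : ℝ := |z.2| * (modW z)⁻¹ * wt z

lemma outW_nonneg (z : ℝ × ℝ) : 0 ≤ outW z :=
  mul_nonneg (mul_nonneg (abs_nonneg _) (inv_nonneg.2 (modW_pos z).le)) (wt_pos z).le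

/-- The weights cancel exactly: `mult` is the squared output weight divided by the squared input
weights. -/
lemma bil_multK_wtd (ha : Measurable a) (hb : Measurable b) (z : ℝ × ℝ) :
    bil multK (wtd a) (wtd b) z = ENNReal.ofReal (outW z) * cv a b z := by
  refine bil_sqrt_wtd ha hb outW_nonneg z fun z₁ z₂ => ?_
  have l1 := modW_pos z₁
  have l2 := modW_pos z₂
  have l := modW_pos (z₁ + z₂)
  have j1 := Real.rpow_pos_of_pos (jap_pos z₁.2) (3 / 2)
  have j2 := Real.rpow_pos_of_pos (jap_pos z₂.2) (3 / 2)
  unfold outW mult freqW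
  rw [mul_pow, mul_pow, wt_sq, wt_sq, wt_sq, sq_abs, Real.rpow_neg (jap_pos _).le]
  field_simp

/-- The bilinear multiplier for low output frequencies. -/
def lowQ (z₁ z₂ : ℝ × ℝ) : ℝ :=
  |(z₁ + z₂).2| ^ (3 / 4 : ℝ) * (jap z₁.2 ^ (3 / 2 : ℝ) * jap z₂.2 ^ (3 / 2 : ℝ)) *
    ((modW z₁)⁻¹ * (modW z₂)⁻¹) * (jap (z₁ + z₂).1 ^ 3)⁻¹

/-- The comparison kernel for two high frequencies and a low output frequency. -/
def lowK (z₁ z₂ : ℝ × ℝ) : ℝ := z₂.2 ^ 2 * dec (modW z₂) * dec (jap (z₁ + z₂).1)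

lemma lowK_nonneg (z₁ z₂ : ℝ × ℝ) : 0 ≤ lowK z₁ z₂ :=
  mul_nonneg (mul_nonneg (sq_nonneg _) (dec_nonneg (modW_pos _).le)) (dec_nonneg (jap_pos _).le)

lemma lowQ_comm (z₁ z₂ : ℝ × ℝ) : lowQ z₁ z₂ = lowQ z₂ z₁ := by
  unfold lowQ
  rw [add_comm z₂ z₁]; ring

/-- Near `ξ = 0` the output modulation contains the singular `1/ξ`, so the resonance is written with
`τ` instead: `3 ξ ξ₁ ξ₂ = σ₁ + σ₂ - τ + ξ³ - ξ/(ξ₁ ξ₂)`. This gives `|ξ| N² ≲ ⟨τ⟩ ⟨σ₁⟩`, and the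
weight `⟨τ⟩⁻³` absorbs the factor `⟨τ⟩`. -/
lemma lowQ_le_of_max {z₁ z₂ : ℝ × ℝ} (hx : |(z₁ + z₂).2| ≤ 1) (hN₁ : 2 ≤ |z₁.2|)
    (hN : 2 ≤ |z₂.2|) (hmax : modW z₂ ≤ modW z₁) : lowQ z₁ z₂ ≤ 10000 * lowK z₁ z₂ := by
  have hA1 := one_le_modW z₁
  have hb1 := one_le_modW z₂
  have hT1 := one_le_jap (z₁ + z₂).1
  have hs₁ : |modulation z₁| ≤ modW z₁ := abs_le_jap _
  have hs₂ : |modulation z₂| ≤ modW z₂ := abs_le_jap _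
  have hτ := abs_le_jap (z₁ + z₂).1
  set A := modW z₁
  set b := modW z₂
  set T := jap (z₁ + z₂).1
  set N := |z₂.2| with hNd
  set M := |(z₁ + z₂).2| with hMd
  have hM0 : 0 ≤ M := abs_nonneg _
  have e1 : |z₁.2| ≤ 3 / 2 * N := by
    have : |z₁.2| ≤ M + N := by
      rw [show z₁.2 = (z₁ + z₂).2 - z₂.2 by simp]; exact abs_sub _ _
    linarith
  have e2 : N / 2 ≤ |z₁.2| := by
    have : N ≤ M + |z₁.2| := by
      rw [hNd, show z₂.2 = (z₁ + z₂).2 - z₁.2 by simp]; exact abs_sub _ _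
    linarith
  have n1 : z₁.2 ≠ 0 := abs_pos.1 (by linarith)
  have n2 : z₂.2 ≠ 0 := abs_pos.1 (by linarith)
  have hq : M * N ^ 2 ≤ 4 * T * A := by
    have id : 3 * ((z₁ + z₂).2 * z₁.2 * z₂.2) = modulation z₁ + modulation z₂ - (z₁ + z₂).1 +
        (z₁ + z₂).2 ^ 3 - (z₁ + z₂).2 / (z₁.2 * z₂.2) := by
      simp only [modulation, Prod.snd_add, Prod.fst_add]
      field_simp
      ring
    have h1 : |3 * ((z₁ + z₂).2 * z₁.2 * z₂.2)| ≤ A + b + T + 1 + 1 := by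
      rw [id]
      have t1 : |(z₁ + z₂).2 ^ 3| ≤ 1 := by rw [abs_pow]; exact pow_le_one₀ hM0 hx
      have t2 : |(z₁ + z₂).2 / (z₁.2 * z₂.2)| ≤ 1 := by
        rw [abs_div, abs_mul]
        exact div_le_one_of_le₀ (by nlinarith) (by positivity)
      have u1 := abs_sub (modulation z₁ + modulation z₂ - (z₁ + z₂).1 +
        (z₁ + z₂).2 ^ 3) ((z₁ + z₂).2 / (z₁.2 * z₂.2))
      have u2 := abs_add_le (modulation z₁ + modulation z₂ - (z₁ + z₂).1) ((z₁ + z₂).2 ^ 3)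
      have u3 := abs_sub (modulation z₁ + modulation z₂) (z₁ + z₂).1
      have u4 := abs_add_le (modulation z₁) (modulation z₂)
      linarith
    rw [abs_mul, abs_mul, abs_mul, abs_of_pos (show (0 : ℝ) < 3 by norm_num)] at h1
    have h2 : M * (N / 2) * N ≤ M * |z₁.2| * N := by gcongr
    have h3 : A ≤ T * A := by nlinarith
    have h4 : T ≤ T * A := by nlinarith
    nlinarith
  have hJ : jap z₁.2 ^ (3 / 2 : ℝ) * jap z₂.2 ^ (3 / 2 : ℝ) ≤ 8 * N ^ 3 := by
    have j1 := jap_pos z₁.2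
    have j2 := jap_pos z₂.2
    have k1 : jap z₁.2 ≤ 2 * N := (jap_le_one_add_abs _).trans (by linarith)
    have k2 : jap z₂.2 ≤ 2 * N := (jap_le_one_add_abs _).trans (by linarith)
    calc _ ≤ (2 * N) ^ (3 / 2 : ℝ) * (2 * N) ^ (3 / 2 : ℝ) := by gcongr
      _ = (2 * N) ^ 3 := rpow_three_halves_sq (by linarith)
      _ = _ := by ring
  have hN0 : 0 < N := by linarith
  have hA0 : 0 < A := by linarith
  have hb0 : 0 < b := by linarith
  have hT0 : 0 < T := by linarith
  -- The resonance is used to the power `3/4`, matching `|ξ|^(3/4)`. It removes `N^(3/2)` from `N³`,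
  -- and the other half is at most the `N²` of `lowK`.
  have hMN : M ^ (3 / 4 : ℝ) * N ^ 3 ≤ 4 * T * A ^ (3 / 4 : ℝ) * N ^ 2 := by
    have f1 : N ^ 3 = (N ^ 2) ^ (3 / 4 : ℝ) * N ^ (3 / 2 : ℝ) := by
      rw [← Real.rpow_natCast, ← Real.rpow_natCast, ← Real.rpow_mul hN0.le, ← Real.rpow_add hN0]
      norm_num
    have f2 : N ^ (3 / 2 : ℝ) ≤ N ^ 2 := by
      rw [← Real.rpow_natCast]
      exact Real.rpow_le_rpow_of_exponent_le (by linarith) (by norm_num)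
    have f3 : (4 * T) ^ (3 / 4 : ℝ) ≤ 4 * T := by
      calc _ ≤ (4 * T) ^ (1 : ℝ) :=
            Real.rpow_le_rpow_of_exponent_le (by linarith) (by norm_num)
        _ = _ := Real.rpow_one _
    calc M ^ (3 / 4 : ℝ) * N ^ 3 = (M * N ^ 2) ^ (3 / 4 : ℝ) * N ^ (3 / 2 : ℝ) := by
          rw [f1, Real.mul_rpow hM0 (by positivity)]; ring
      _ ≤ (4 * T * A) ^ (3 / 4 : ℝ) * N ^ 2 := by gcongr
      _ = (4 * T) ^ (3 / 4 : ℝ) * A ^ (3 / 4 : ℝ) * N ^ 2 := by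
          rw [Real.mul_rpow (by positivity) hA0.le]
      _ ≤ _ := by gcongr
  have hdec : A ^ (3 / 4 : ℝ) * (A⁻¹ * b⁻¹) ≤ dec b := by
    have g1 : A ^ (3 / 4 : ℝ) * A⁻¹ = A ^ (-(1 / 4) : ℝ) := by
      rw [← Real.rpow_neg_one, ← Real.rpow_add hA0]; norm_num
    have g2 : A ^ (-(1 / 4) : ℝ) ≤ b ^ (-(1 / 4) : ℝ) :=
      Real.rpow_le_rpow_of_nonpos hb0 hmax (by norm_num)
    calc A ^ (3 / 4 : ℝ) * (A⁻¹ * b⁻¹) = A ^ (-(1 / 4) : ℝ) * b⁻¹ := by rw [← mul_assoc, g1]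
      _ ≤ b ^ (-(1 / 4) : ℝ) * b⁻¹ := by gcongr
      _ = b ^ (-(5 / 4) : ℝ) := by
          rw [← Real.rpow_neg_one, ← Real.rpow_add hb0]; norm_num
      _ ≤ dec b := Real.rpow_le_rpow_of_exponent_le hb1 (by norm_num)
  have hT : T * (T ^ 3)⁻¹ ≤ dec T := by
    calc T * (T ^ 3)⁻¹ = T ^ (-2 : ℝ) := by
          rw [Real.rpow_neg hT0.le, Real.rpow_two]; field_simp
      _ ≤ dec T := Real.rpow_le_rpow_of_exponent_le hT1 (by norm_num)
  have hd := dec_nonneg hb0.le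
  unfold lowQ lowK
  rw [← sq_abs]
  have i0 : 0 ≤ A⁻¹ * b⁻¹ := by positivity
  have m0 : 0 ≤ M ^ (3 / 4 : ℝ) := Real.rpow_nonneg hM0 _
  calc M ^ (3 / 4 : ℝ) * (jap z₁.2 ^ (3 / 2 : ℝ) * jap z₂.2 ^ (3 / 2 : ℝ)) * (A⁻¹ * b⁻¹) *
        (T ^ 3)⁻¹ ≤ M ^ (3 / 4 : ℝ) * (8 * N ^ 3) * (A⁻¹ * b⁻¹) * (T ^ 3)⁻¹ := by gcongr
    _ = 8 * (M ^ (3 / 4 : ℝ) * N ^ 3) * (A⁻¹ * b⁻¹) * (T ^ 3)⁻¹ := by ring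
    _ ≤ 8 * (4 * T * A ^ (3 / 4 : ℝ) * N ^ 2) * (A⁻¹ * b⁻¹) * (T ^ 3)⁻¹ := by gcongr
    _ = 32 * (N ^ 2 * (A ^ (3 / 4 : ℝ) * (A⁻¹ * b⁻¹)) * (T * (T ^ 3)⁻¹)) := by ring
    _ ≤ 32 * (N ^ 2 * dec b * dec T) := by gcongr
    _ ≤ _ := by
      have : 0 ≤ N ^ 2 * dec b * dec T :=
        mul_nonneg (mul_nonneg (by positivity) hd) (dec_nonneg hT0.le)
      linarith

/-- As `|ξ| ≤ 1`, either both inputs are at most 4 and the unit bump suffices, or both are at least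
2. -/
lemma lowQ_le {z₁ z₂ : ℝ × ℝ} (hx : |(z₁ + z₂).2| ≤ 1) :
    lowQ z₁ z₂ ≤ 10000 * (krSum VV z₁.2 z₂.2 (z₁ + z₂).2 (modW z₁) (modW z₂) (modW (z₁ + z₂)) +
      (lowK z₁ z₂ + lowK z₂ z₁)) := by
  have o := one_le_modW (z₁ + z₂)
  have o₁ := one_le_modW z₁
  have o₂ := one_le_modW z₂
  obtain ⟨k0, -, -, k3⟩ := krSum_ge (x₁ := z₁.2) (x₂ := z₂.2) (x := (z₁ + z₂).2) VV_nonneg o o₁ o₂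
  have l1 := lowK_nonneg z₁ z₂
  have l2 := lowK_nonneg z₂ z₁
  have e1 : |z₁.2| ≤ |(z₁ + z₂).2| + |z₂.2| := by
    rw [show z₁.2 = (z₁ + z₂).2 - z₂.2 by simp]; exact abs_sub _ _
  have e2 : |z₂.2| ≤ |(z₁ + z₂).2| + |z₁.2| := by
    rw [show z₂.2 = (z₁ + z₂).2 - z₁.2 by simp]; exact abs_sub _ _
  by_cases hlow : |z₁.2| ≤ 4 ∧ |z₂.2| ≤ 4
  · obtain ⟨h1, h2⟩ := hlow
    have e : (4 : ℝ) ^ (3 / 2 : ℝ) = 8 := by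
      rw [rpow_three_halves (by norm_num), show (4 : ℝ) = 2 ^ 2 by norm_num,
        Real.sqrt_sq (by norm_num)]; norm_num
    have j1 := jap_rpow_le_of_four_le le_rfl h1
    have j2 := jap_rpow_le_of_four_le le_rfl h2
    rw [e] at j1 j2
    have b := le_bump (β := 1) (y₀ := 0) (y := z₁.2) zero_le_one (by
      rw [one_mul, sub_zero, abs_abs]; linarith)
    have hV : 1 ≤ 36 * VV (z₁ + z₂).2 z₁.2 := by
      have := (le_VV (z₁ + z₂).2 z₁.2).2.1
      linarith
    have hd := bump_dec_le_kr (x := (z₁ + z₂).2) (y := z₁.2) (w := z₂.2) VV_nonneg o₁ o₂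
    have hP := (inv_mul_le_rpow o₁ o₂).trans (rpow_le_dec_add o₁ o₂)
    have m1 : |(z₁ + z₂).2| ^ (3 / 4 : ℝ) ≤ 1 := Real.rpow_le_one (abs_nonneg _) hx (by norm_num)
    have t1 : (jap (z₁ + z₂).1 ^ 3)⁻¹ ≤ 1 := inv_le_one_of_one_le₀ (one_le_pow₀ (one_le_jap _))
    have p1 := jap_pos z₁.2
    have p2 := jap_pos z₂.2
    have p3 := jap_pos (z₁ + z₂).1
    have i1 : 0 ≤ (modW z₁)⁻¹ * (modW z₂)⁻¹ := by positivity
    have dn : 0 ≤ dec (modW z₁) + dec (modW z₂) :=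
      add_nonneg (dec_nonneg (by linarith)) (dec_nonneg (by linarith))
    unfold lowQ
    calc _ ≤ 1 * ((2 * 8) * (2 * 8)) * (dec (modW z₁) + dec (modW z₂)) * 1 := by gcongr
      _ = 256 * (1 * (dec (modW z₁) + dec (modW z₂))) := by ring
      _ ≤ 256 * (36 * VV (z₁ + z₂).2 z₁.2 * (dec (modW z₁) + dec (modW z₂))) := by gcongr
      _ ≤ _ := by linarith
  · have h12 : 2 ≤ |z₁.2| ∧ 2 ≤ |z₂.2| := by
      by_contra hc
      apply hlow
      rw [not_and_or, not_le, not_le] at hc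
      constructor <;> rcases hc with hc | hc <;> linarith
    rcases le_total (modW z₂) (modW z₁) with hm | hm
    · have := lowQ_le_of_max hx h12.1 h12.2 hm
      linarith
    · rw [lowQ_comm]
      rw [add_comm] at hx
      have := lowQ_le_of_max hx h12.2 h12.1 hm
      linarith

/-- The square root of `lowK`, as a bilinear kernel. -/
def lowKK (z₁ z₂ : ℝ × ℝ) : ℝ≥0∞ := ENNReal.ofReal (lowK z₁ z₂) ^ (1 / 2 : ℝ)

lemma measurable_lowKK : Measurable (Function.uncurry lowKK) := by
  unfold lowKK lowK
  simp only [Function.uncurry_def]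
  fun_prop

lemma lintegral_lowK_le (z₁ : ℝ × ℝ) :
    ∫⁻ z₂, ENNReal.ofReal (lowK z₁ z₂) ≤ 2 * decInt * decInt := by
  refine le_trans (lintegral_mono fun z₂ => ENNReal.ofReal_le_ofReal ?_)
    (lintegral_sq_dec_le z₁ 0)
  have e : z₂ + (0, 0) = z₂ := by simp
  have h := lowK_nonneg z₁ z₂
  rw [e]
  unfold lowK at *
  rw [Prod.fst_add, add_comm z₁.1] at *
  rw [add_zero]
  linarith

variable {F G : ℝ × ℝ → ℝ≥0∞}

lemma nl2_bil_lowKK_lt_top (hF : Measurable F) (hG : Measurable G) (hF' : nl2 F volume < ∞)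
    (hG' : nl2 G volume < ∞) : nl2 (bil lowKK F G) volume < ∞ := by
  have hd := decInt_lt_top
  refine (nl2_bil_le_left measurable_lowKK hF hG (A := (2 * decInt * decInt) ^ (1 / 2 : ℝ))
    fun z₁ => ?_).trans_lt ?_
  · unfold nl2 lowKK
    simp only [rpow_half_two]
    gcongr
    exact lintegral_lowK_le z₁
  · refine ENNReal.mul_lt_top (ENNReal.mul_lt_top (ENNReal.rpow_lt_top_of_nonneg (by norm_num) ?_)
      hF') hG'
    exact (ENNReal.mul_lt_top (ENNReal.mul_lt_top (by simp) hd) hd).ne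

/-- The majorant for low output frequencies. -/
def lowMaj (F G : ℝ × ℝ → ℝ≥0∞) (z : ℝ × ℝ) : ℝ≥0∞ :=
  bil (KV VV) F G z + (bil lowKK F G z + bil lowKK G F z)

lemma measurable_lowMaj (hF : Measurable F) (hG : Measurable G) : Measurable (lowMaj F G) :=
  (measurable_bil (measurable_KV measurable_VV) hF hG).add
    ((measurable_bil measurable_lowKK hF hG).add (measurable_bil measurable_lowKK hG hF))

lemma nl2_lowMaj_lt_top (hF : Measurable F) (hG : Measurable G) (hF' : nl2 F volume < ∞)
    (hG' : nl2 G volume < ∞) : nl2 (lowMaj F G) volume < ∞ := by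
  have m1 := measurable_bil (measurable_KV measurable_VV) hF hG
  have m2 := measurable_bil measurable_lowKK hF hG
  have m3 := measurable_bil measurable_lowKK hG hF
  refine (nl2_add_le m1 (m2.add m3)).trans_lt (ENNReal.add_lt_top.2 ⟨?_, ?_⟩)
  · exact (nl2_bil_KV_VV_le hF hG).trans_lt
      (ENNReal.mul_lt_top (ENNReal.mul_lt_top bilC_lt_top hF') hG')
  · exact (nl2_add_le m2 m3).trans_lt (ENNReal.add_lt_top.2
      ⟨nl2_bil_lowKK_lt_top hF hG hF' hG', nl2_bil_lowKK_lt_top hG hF hG' hF'⟩)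

lemma lowMaj_eq (hF : Measurable F) (hG : Measurable G) (z : ℝ × ℝ) :
    lowMaj F G z =
      bil (fun z₁ z₂ => KV VV z₁ z₂ + (lowKK z₁ z₂ + lowKK z₂ z₁)) F G z := by
  have h1 : bil lowKK G F z = bil (fun z₁ z₂ => lowKK z₂ z₁) F G z := bil_swap z
  have h2 := bil_add (k := lowKK) (k' := fun z₁ z₂ => lowKK z₂ z₁) measurable_lowKK hF hG z
  have h3 := bil_add (k := KV VV) (k' := fun z₁ z₂ => lowKK z₁ z₂ + lowKK z₂ z₁)
    (measurable_KV measurable_VV) hF hG z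
  rw [h3, h2, ← h1, lowMaj]

/-- The weight of the output for low frequencies. -/
def lowW (z : ℝ × ℝ) : ℝ := (|z.2| ^ (3 / 4 : ℝ) * (jap z.1 ^ 3)⁻¹) ^ (1 / 2 : ℝ)

lemma lowW_mul_cv_le (ha : Measurable a) (hb : Measurable b) {z : ℝ × ℝ} (hz : |z.2| ≤ 1) :
    ENNReal.ofReal (lowW z) * cv a b z ≤
      ENNReal.ofReal 10000 ^ (1 / 2 : ℝ) * lowMaj (wtd a) (wtd b) z := by
  have hF := measurable_wtd ha
  have hG := measurable_wtd hb
  have hmw := measurable_wt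
  have hn : ∀ z : ℝ × ℝ, 0 ≤ |z.2| ^ (3 / 4 : ℝ) * (jap z.1 ^ 3)⁻¹ := fun z =>
    mul_nonneg (Real.rpow_nonneg (abs_nonneg _) _) (inv_nonneg.2 (pow_nonneg (jap_pos _).le _))
  rw [← bil_sqrt_wtd (Q := lowQ) (c := lowW) ha hb (fun z => Real.rpow_nonneg (hn z) _) z]
  · rw [lowMaj_eq hF hG]
    unfold bil
    rw [← lintegral_const_mul' _ _ (ENNReal.rpow_ne_top_of_nonneg (by norm_num) (by simp))]
    refine lintegral_mono fun z₁ => ?_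
    simp only [← mul_assoc]
    gcongr
    have o := one_le_modW (z₁ + (z - z₁))
    have o₁ := one_le_modW z₁
    have o₂ := one_le_modW (z - z₁)
    have k0 := (krSum_ge (x₁ := z₁.2) (x₂ := (z - z₁).2) (x := (z₁ + (z - z₁)).2) VV_nonneg o o₁
      o₂).1
    have l1 := lowK_nonneg z₁ (z - z₁)
    have l2 := lowK_nonneg (z - z₁) z₁
    have h := lowQ_le (z₁ := z₁) (z₂ := z - z₁) (by rwa [add_sub_cancel])
    calc ENNReal.ofReal (lowQ z₁ (z - z₁)) ^ (1 / 2 : ℝ) ≤ _ :=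
          ENNReal.rpow_le_rpow (ENNReal.ofReal_le_ofReal h) (by norm_num)
      _ ≤ _ := by
          rw [ENNReal.ofReal_mul (by norm_num), ENNReal.mul_rpow_of_nonneg _ _ (by norm_num),
            ENNReal.ofReal_add k0 (by positivity), ENNReal.ofReal_add l1 l2]
          gcongr
          refine (ENNReal.rpow_add_le_add_rpow _ _ (by norm_num) (by norm_num)).trans ?_
          unfold KV lowKK
          gcongr
          exact ENNReal.rpow_add_le_add_rpow _ _ (by norm_num) (by norm_num)
  · intro z₁ z₂
    have l1 := modW_pos z₁
    have l2 := modW_pos z₂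
    have j1 := Real.rpow_pos_of_pos (jap_pos z₁.2) (3 / 2)
    have j2 := Real.rpow_pos_of_pos (jap_pos z₂.2) (3 / 2)
    unfold lowW lowQ
    rw [wt_sq, wt_sq, ← Real.rpow_natCast _ 2, ← Real.rpow_mul (hn _)]
    norm_num
    field_simp

/-- The weight against which convolutions are integrable. -/
def testW (z : ℝ × ℝ) : ℝ := (jap z.1 ^ 3)⁻¹ * (jap z.2 ^ 4)⁻¹

lemma testW_pos (z : ℝ × ℝ) : 0 < testW z := by
  have := jap_pos z.1
  have := jap_pos z.2
  unfold testW; positivity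

lemma measurable_testW : Measurable testW := by unfold testW; fun_prop

lemma inv_sq_le_dec {u : ℝ} (hu : 1 ≤ u) {n : ℕ} (hn : 2 ≤ n) : (u ^ n)⁻¹ ≤ dec u := by
  unfold dec
  rw [← Real.rpow_natCast, ← Real.rpow_neg (by linarith)]
  have : (2 : ℝ) ≤ n := by exact_mod_cast hn
  exact Real.rpow_le_rpow_of_exponent_le hu (by linarith)

lemma lintegral_dec_mul_dec :
    ∫⁻ z : ℝ × ℝ, ENNReal.ofReal (dec (jap z.1)) * ENNReal.ofReal (dec (jap z.2)) =
      decInt * decInt := by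
  have hm : Measurable fun t : ℝ => ENNReal.ofReal (dec (jap t)) := by fun_prop
  rw [Measure.volume_eq_prod]
  exact lintegral_prod_mul hm.aemeasurable hm.aemeasurable

lemma lintegral_rpow_lt_top : ∫⁻ x : ℝ, Set.indicator (Set.Icc (-1) 1)
    (fun x => ENNReal.ofReal (|x| ^ (-(3 / 4) : ℝ))) x < ∞ := by
  have h := integrableOn_ball_of_norm_le_rpow (E := ℝ) (μ := volume) (by simp)
    (f := fun x : ℝ => |x| ^ (-(3 / 4) : ℝ)) (C := 1) (α := 3 / 4) (r := 2) (by norm_num)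
    (ae_of_all _ fun x => by
      rw [one_mul, Real.norm_eq_abs, Real.norm_eq_abs,
        abs_of_nonneg (Real.rpow_nonneg (abs_nonneg _) _)])
    (show Measurable fun x : ℝ => |x| ^ (-(3 / 4) : ℝ) by fun_prop).aestronglyMeasurable
  have h2 : IntegrableOn (fun x : ℝ => |x| ^ (-(3 / 4) : ℝ)) (Set.Icc (-1) 1) :=
    h.mono_set fun x hx => by
      rw [mem_ball_zero_iff, Real.norm_eq_abs, abs_lt]
      constructor <;> linarith [hx.1, hx.2]
  rw [lintegral_indicator measurableSet_Icc]
  exact h2.lintegral_lt_top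

/-- Cauchy–Schwarz with the weight `|ξ|^(-3/8) ⟨τ⟩^(-3/2)`, which is square integrable for `|ξ| ≤ 1`
and whose product with `lowW` is `⟨τ⟩⁻³`. -/
lemma lintegral_low_lt_top (ha : Measurable a) (hb : Measurable b)
    (hF : nl2 (wtd a) volume < ∞) (hG : nl2 (wtd b) volume < ∞) :
    ∫⁻ z in {z : ℝ × ℝ | |z.2| ≤ 1}, ENNReal.ofReal (testW z) * cv a b z < ∞ := by
  have hS : MeasurableSet {z : ℝ × ℝ | |z.2| ≤ 1} := by
    have : Measurable fun z : ℝ × ℝ => |z.2| := by fun_prop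
    exact measurableSet_le this measurable_const
  set S := {z : ℝ × ℝ | |z.2| ≤ 1} with hSd
  set w : ℝ × ℝ → ℝ≥0∞ := fun z => ENNReal.ofReal (|z.2| ^ (-(3 / 8) : ℝ) *
    (jap z.1 ^ 3)⁻¹ ^ (1 / 2 : ℝ)) with hw
  have hwm : Measurable w := by rw [hw]; fun_prop
  set c : ℝ≥0∞ := ENNReal.ofReal 10000 ^ (1 / 2 : ℝ) with hc
  have hmaj := measurable_lowMaj (measurable_wtd ha) (measurable_wtd hb)
  have h1 : ∀ᵐ z ∂(volume.restrict S), ENNReal.ofReal (testW z) * cv a b z ≤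
      w z * (c * lowMaj (wtd a) (wtd b) z) := by
    filter_upwards [ae_restrict_mem hS, ae_restrict_of_ae ae_snd_ne_zero] with z hz hz0
    refine le_trans ?_ (mul_le_mul_right (lowW_mul_cv_le ha hb hz) (w z))
    rw [← mul_assoc, hw, ← ENNReal.ofReal_mul
      (mul_nonneg (Real.rpow_nonneg (abs_nonneg _) _) (Real.rpow_nonneg
        (inv_nonneg.2 (pow_nonneg (jap_pos _).le _)) _))]
    gcongr
    have hx : 0 < |z.2| := abs_pos.2 hz0
    have hT : 0 < (jap z.1 ^ 3)⁻¹ := inv_pos.2 (pow_pos (jap_pos _) _)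
    have e : |z.2| ^ (-(3 / 8) : ℝ) * (jap z.1 ^ 3)⁻¹ ^ (1 / 2 : ℝ) * lowW z =
        (jap z.1 ^ 3)⁻¹ := by
      unfold lowW
      rw [Real.mul_rpow (by positivity) hT.le, ← Real.rpow_mul hx.le]
      calc _ = (|z.2| ^ (-(3 / 8) : ℝ) * |z.2| ^ (3 / 4 * (1 / 2) : ℝ)) *
            ((jap z.1 ^ 3)⁻¹ ^ (1 / 2 : ℝ) * (jap z.1 ^ 3)⁻¹ ^ (1 / 2 : ℝ)) := by ring
        _ = _ := by
          rw [← Real.rpow_add hx, ← Real.rpow_add hT]; norm_num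
    rw [e]
    unfold testW
    have : (jap z.2 ^ 4)⁻¹ ≤ 1 := inv_le_one_of_one_le₀ (one_le_pow₀ (one_le_jap _))
    nlinarith
  refine (lintegral_mono_ae h1).trans_lt ((lintegral_mul_le_nl2 hwm.aemeasurable
    (by fun_prop)).trans_lt (ENNReal.mul_lt_top ?_ ?_))
  · rw [nl2_restrict hS]
    unfold nl2
    refine ENNReal.rpow_lt_top_of_nonneg (by norm_num) (ne_of_lt ?_)
    have hle : ∀ z, S.indicator w z ^ (2 : ℝ) ≤ ENNReal.ofReal (dec (jap z.1)) *
        Set.indicator (Set.Icc (-1) 1) (fun x => ENNReal.ofReal (|x| ^ (-(3 / 4) : ℝ))) z.2 := by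
      intro z
      by_cases hz : z ∈ S
      · rw [Set.indicator_of_mem hz, Set.indicator_of_mem (show z.2 ∈ Set.Icc (-1) 1 from abs_le.1 hz), hw,
          ← ENNReal.ofReal_mul (dec_nonneg (jap_pos _).le),
          ENNReal.ofReal_rpow_of_nonneg (mul_nonneg (Real.rpow_nonneg (abs_nonneg _) _)
            (Real.rpow_nonneg (inv_nonneg.2 (pow_nonneg (jap_pos _).le _)) _)) (by norm_num)]
        gcongr
        have hT : 0 < (jap z.1 ^ 3)⁻¹ := inv_pos.2 (pow_pos (jap_pos _) _)
        rw [Real.mul_rpow (Real.rpow_nonneg (abs_nonneg _) _) (Real.rpow_nonneg hT.le _),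
          ← Real.rpow_mul (abs_nonneg _), ← Real.rpow_mul hT.le, mul_comm]
        have := inv_sq_le_dec (one_le_jap z.1) (show 2 ≤ 3 by norm_num)
        norm_num
        gcongr
      · rw [Set.indicator_of_notMem hz]; simp
    refine (lintegral_mono hle).trans_lt ?_
    have m1 : Measurable fun t : ℝ => ENNReal.ofReal (dec (jap t)) := by fun_prop
    have m2 : Measurable (Set.indicator (Set.Icc (-1) 1)
        fun x : ℝ => ENNReal.ofReal (|x| ^ (-(3 / 4) : ℝ))) :=
      Measurable.indicator (by fun_prop) measurableSet_Icc
    have hp := lintegral_prod_mul (μ := volume) (ν := volume) m1.aemeasurable m2.aemeasurable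
    rw [Measure.volume_eq_prod, hp]
    exact ENNReal.mul_lt_top decInt_lt_top lintegral_rpow_lt_top
  · have h3 : nl2 (fun z => c * lowMaj (wtd a) (wtd b) z) (volume.restrict S) ≤
        nl2 (fun z => c * lowMaj (wtd a) (wtd b) z) volume := by
      rw [nl2_restrict hS]
      exact nl2_mono fun z => Set.indicator_le_self _ _ _
    refine h3.trans_lt ?_
    rw [nl2_const_mul hmaj]
    exact ENNReal.mul_lt_top (ENNReal.rpow_lt_top_of_nonneg (by norm_num) (by simp))
      (nl2_lowMaj_lt_top (measurable_wtd ha) (measurable_wtd hb) hF hG)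

lemma modW_le_of_one_le {z : ℝ × ℝ} (hz : 1 ≤ |z.2|) :
    modW z ≤ 4 * (jap z.1 * jap z.2 ^ 3) := by
  have h1 : |modulation z| ≤ |z.1| + |z.2| ^ 3 + 1 / |z.2| := by
    unfold modulation
    refine (abs_add_le _ _).trans ?_
    rw [abs_div, abs_one]
    gcongr
    refine (abs_sub _ _).trans ?_
    rw [abs_pow]
  have h2 : 1 / |z.2| ≤ 1 := div_le_one_of_le₀ hz (abs_nonneg _)
  have h3 : |z.2| ^ 3 ≤ jap z.2 ^ 3 := by gcongr; exact abs_le_jap _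
  have h4 := abs_le_jap z.1
  have h5 : modW z ≤ 1 + |modulation z| := jap_le_one_add_abs _
  have h6 := one_le_jap z.1
  have h7 : 1 ≤ jap z.2 ^ 3 := one_le_pow₀ (one_le_jap _)
  nlinarith

/-- Away from `ξ = 0` the derivative loses nothing, so the bilinear estimate itself controls the
convolution; `testW` is `outW` times a square integrable function at most. -/
lemma lintegral_high_lt_top (ha : Measurable a) (hb : Measurable b)
    (hF : Xn (wtd a) < ∞) (hG : Xn (wtd b) < ∞) :
    ∫⁻ z in {z : ℝ × ℝ | 1 ≤ |z.2|}, ENNReal.ofReal (testW z) * cv a b z < ∞ := by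
  have hS : MeasurableSet {z : ℝ × ℝ | 1 ≤ |z.2|} := by
    have : Measurable fun z : ℝ × ℝ => |z.2| := by fun_prop
    exact measurableSet_le measurable_const this
  set S := {z : ℝ × ℝ | 1 ≤ |z.2|} with hSd
  set w : ℝ × ℝ → ℝ≥0∞ := fun z => ENNReal.ofReal (2 * ((jap z.1)⁻¹ * (jap z.2)⁻¹)) with hw
  have hwm : Measurable w := by rw [hw]; fun_prop
  have hbm := measurable_bil measurable_multK (measurable_wtd ha) (measurable_wtd hb)
  have h1 : ∀ᵐ z ∂(volume.restrict S), ENNReal.ofReal (testW z) * cv a b z ≤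
      w z * bil multK (wtd a) (wtd b) z := by
    filter_upwards [ae_restrict_mem hS] with z hz
    have hT := one_le_jap z.1
    have hx := one_le_jap z.2
    rw [bil_multK_wtd ha hb, ← mul_assoc, hw, ← ENNReal.ofReal_mul (by positivity)]
    gcongr
    have hz' : 1 ≤ |z.2| := hz
    have hL := modW_le_of_one_le hz'
    have hL0 := modW_pos z
    set T := jap z.1
    set J := jap z.2
    set L := modW z
    have hs : Real.sqrt L ≤ 2 * T * J ^ 2 := by
      rw [Real.sqrt_le_left (by positivity)]
      refine hL.trans ?_
      have q1 : T * J ^ 3 ≤ T ^ 2 * J ^ 4 := by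
        calc T * J ^ 3 = T ^ 1 * J ^ 3 := by rw [pow_one]
          _ ≤ T ^ 2 * J ^ 4 := by gcongr <;> first | exact hT | exact hx | norm_num
      calc 4 * (T * J ^ 3) ≤ 4 * (T ^ 2 * J ^ 4) := by gcongr
        _ = _ := by ring
    have hs0 : 0 < Real.sqrt L := Real.sqrt_pos.2 hL0
    have hss : Real.sqrt L * Real.sqrt L = L := Real.mul_self_sqrt hL0.le
    have hi : (Real.sqrt L)⁻¹ = L⁻¹ * Real.sqrt L := by
      apply inv_eq_of_mul_eq_one_right
      rw [mul_left_comm, hss, inv_mul_cancel₀ hL0.ne']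
    have hJ : J⁻¹ ≤ J ^ (-3 / 4 : ℝ) := by
      rw [← Real.rpow_neg_one]
      exact Real.rpow_le_rpow_of_exponent_le hx (by norm_num)
    have ho : (2 * T * J ^ 2)⁻¹ * J⁻¹ ≤ outW z := by
      unfold outW wt
      rw [← Real.sqrt_eq_rpow]
      calc (2 * T * J ^ 2)⁻¹ * J⁻¹ ≤ (Real.sqrt L)⁻¹ * J ^ (-3 / 4 : ℝ) := by gcongr
        _ = 1 * L⁻¹ * (J ^ (-3 / 4 : ℝ) * Real.sqrt L) := by rw [hi]; ring
        _ ≤ _ := by gcongr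
    calc testW z = (T ^ 3)⁻¹ * (J ^ 4)⁻¹ := rfl
      _ ≤ (T ^ 2)⁻¹ * (J ^ 4)⁻¹ := by
          gcongr
          norm_num
      _ = 2 * (T⁻¹ * J⁻¹) * ((2 * T * J ^ 2)⁻¹ * J⁻¹) := by field_simp
      _ ≤ _ := by gcongr
  refine (lintegral_mono_ae h1).trans_lt ((lintegral_mul_le_nl2 hwm.aemeasurable
    (by fun_prop)).trans_lt (ENNReal.mul_lt_top ?_ ?_))
  · rw [nl2_restrict hS]
    refine (nl2_mono (fun z => Set.indicator_le_self _ _ _)).trans_lt ?_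
    unfold nl2
    refine ENNReal.rpow_lt_top_of_nonneg (by norm_num) (ne_of_lt ?_)
    have hle : ∀ z, w z ^ (2 : ℝ) ≤
        4 * (ENNReal.ofReal (dec (jap z.1)) * ENNReal.ofReal (dec (jap z.2))) := by
      intro z
      have hT := inv_sq_le_dec (one_le_jap z.1) le_rfl
      have hx := inv_sq_le_dec (one_le_jap z.2) le_rfl
      have j1 := jap_pos z.1
      have j2 := jap_pos z.2
      have d1 := dec_nonneg j1.le
      rw [hw, show (4 : ℝ≥0∞) = ENNReal.ofReal 4 by norm_num, ← ENNReal.ofReal_mul d1,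
        ← ENNReal.ofReal_mul (by norm_num), ENNReal.rpow_two, ← ENNReal.ofReal_pow (by positivity)]
      gcongr
      calc (2 * ((jap z.1)⁻¹ * (jap z.2)⁻¹)) ^ 2 = 4 * ((jap z.1 ^ 2)⁻¹ * (jap z.2 ^ 2)⁻¹) := by
            field_simp; norm_num
        _ ≤ _ := by gcongr
    refine (lintegral_mono hle).trans_lt ?_
    rw [lintegral_const_mul _ (by fun_prop), lintegral_dec_mul_dec]
    exact ENNReal.mul_lt_top (by simp) (ENNReal.mul_lt_top decInt_lt_top decInt_lt_top)
  · have h3 : nl2 (bil multK (wtd a) (wtd b)) (volume.restrict S) ≤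
        Xn (bil multK (wtd a) (wtd b)) := by
      rw [nl2_restrict hS]
      exact (nl2_mono fun z => Set.indicator_le_self _ _ _).trans (nl2_le_Xn hbm)
    refine h3.trans_lt (lt_of_le_of_lt (le_trans le_self_add
      (XYn_bil_multK_le (measurable_wtd ha) (measurable_wtd hb))) ?_)
    exact ENNReal.mul_lt_top (ENNReal.mul_lt_top mainC_lt_top hF) hG

/-- Convolutions of functions with finite `X` norm are integrable against a decaying weight. -/
theorem lintegral_testW_cv_lt_top (ha : Measurable a) (hb : Measurable b)
    (hF : Xn (wtd a) < ∞) (hG : Xn (wtd b) < ∞) :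
    ∫⁻ z, ENNReal.ofReal (testW z) * cv a b z < ∞ := by
  have h1 := lintegral_low_lt_top ha hb ((nl2_le_Xn (measurable_wtd ha)).trans_lt hF)
    ((nl2_le_Xn (measurable_wtd hb)).trans_lt hG)
  have h2 := lintegral_high_lt_top ha hb hF hG
  rw [← setLIntegral_univ]
  have hU : (Set.univ : Set (ℝ × ℝ)) = {z | |z.2| ≤ 1} ∪ {z | 1 ≤ |z.2|} := by
    ext z; simpa using le_total _ _
  rw [hU]
  exact (lintegral_union_le _ _ _).trans_lt (ENNReal.add_lt_top.2 ⟨h1, h2⟩)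

end Existence

/-! ### Fourier densities of tempered distributions. -/

/-- The dilation by `2π`, as a measurable equivalence onto the frequency plane. -/
def dil : Plane ≃ᵐ ℝ × ℝ :=
  ((MeasurableEquiv.toLp 2 (Fin 2 → ℝ)).symm.trans MeasurableEquiv.finTwoArrow).trans
    (MeasurableEquiv.smul₀ (2 * Real.pi) (by positivity))

lemma dil_apply (y : Plane) : dil y = (2 * Real.pi * y 0, 2 * Real.pi * y 1) := rfl

/-- Only null sets and finiteness of integrals are transported, so the value of the constant is
immaterial. -/
lemma map_dil_volume :
    ∃ c : ℝ≥0∞, c ≠ 0 ∧ c ≠ ∞ ∧ Measure.map dil volume = c • (volume : Measure (ℝ × ℝ)) := by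
  have h2 : (2 * Real.pi : ℝ) ≠ 0 := by positivity
  refine ⟨ENNReal.ofReal |((2 * Real.pi) ^ Module.finrank ℝ (ℝ × ℝ))⁻¹|, ?_, by simp, ?_⟩
  · simp [Real.pi_ne_zero]
  · have h1 : MeasurePreserving ((MeasurableEquiv.toLp 2 (Fin 2 → ℝ)).symm.trans
        MeasurableEquiv.finTwoArrow) (volume : Measure Plane) (volume : Measure (ℝ × ℝ)) :=
      (volume_preserving_finTwoArrow ℝ).comp
        (EuclideanSpace.volume_preserving_symm_measurableEquiv_toLp (Fin 2))
    rw [← Measure.map_addHaar_smul volume h2, ← h1.map_eq,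
      Measure.map_map (by fun_prop) h1.measurable]
    rfl

lemma ae_dil {P : ℝ × ℝ → Prop} : (∀ᵐ y : Plane, P (dil y)) ↔ ∀ᵐ z, P z := by
  obtain ⟨c, h0, -, h⟩ := map_dil_volume
  rw [← dil.measurableEmbedding.ae_map_iff, h, Measure.ae_ennreal_smul_measure_eq h0]

lemma lintegral_dil_lt_top {F : ℝ × ℝ → ℝ≥0∞} (h : ∫⁻ z, F z < ∞) :
    ∫⁻ y : Plane, F (dil y) < ∞ := by
  obtain ⟨c, -, hc, hm⟩ := map_dil_volume
  rw [← lintegral_map_equiv, hm, lintegral_smul_measure]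
  exact ENNReal.mul_lt_top hc.lt_top h

lemma aestronglyMeasurable_dil {f : ℝ × ℝ → ℂ} (hf : AEStronglyMeasurable f volume) :
    AEStronglyMeasurable (fun y : Plane => f (dil y)) volume := by
  obtain ⟨c, -, -, hm⟩ := map_dil_volume
  refine AEStronglyMeasurable.comp_measurable (f := dil) ?_ dil.measurable
  rw [hm]
  exact hf.mono_ac Measure.smul_absolutelyContinuous

/-- A Schwartz function times `(1 + ‖y‖)^n` is bounded by a Schwartz seminorm, which makes the
pairing convergent and continuous. -/
lemma exists_temperedDistribution_of_density {Q : Plane → ℂ} (n : ℕ)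
    (hQ : AEStronglyMeasurable Q volume)
    (hi : Integrable (fun y => ((1 + ‖y‖) ^ n)⁻¹ * ‖Q y‖) volume) :
    ∃ T : 𝓢'(Plane, ℂ), ∀ φ : 𝓢(Plane, ℂ),
      Integrable (fun y => Q y * φ y) volume ∧ T φ = ∫ y, Q y * φ y := by
  set N : 𝓢(Plane, ℂ) → ℝ := fun φ =>
    (Finset.Iic (n, 0)).sup (fun m => SchwartzMap.seminorm ℂ m.1 m.2) φ with hN
  have hb : ∀ (φ : 𝓢(Plane, ℂ)) y, ‖Q y * φ y‖ ≤ (((1 + ‖y‖) ^ n)⁻¹ * ‖Q y‖) * (2 ^ n * N φ) := by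
    intro φ y
    have h := SchwartzMap.one_add_le_sup_seminorm_apply (𝕜 := ℂ) (m := (n, 0)) (k := n) (n := 0)
      le_rfl le_rfl φ y
    rw [norm_iteratedFDeriv_zero] at h
    have hp : 0 < (1 + ‖y‖) ^ n := by positivity
    rw [norm_mul]
    calc ‖Q y‖ * ‖φ y‖ = (((1 + ‖y‖) ^ n)⁻¹ * ‖Q y‖) * ((1 + ‖y‖) ^ n * ‖φ y‖) := by field_simp
      _ ≤ _ := by gcongr
  have hI : ∀ φ : 𝓢(Plane, ℂ), Integrable (fun y => Q y * φ y) volume := fun φ =>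
    (hi.mul_const (2 ^ n * N φ)).mono' (hQ.mul φ.continuous.aestronglyMeasurable)
      (Filter.Eventually.of_forall (hb φ))
  have hbound : ∃ (s : Finset (ℕ × ℕ)) (C : ℝ), 0 ≤ C ∧ ∀ f : 𝓢(Plane, ℂ),
      ‖∫ y, Q y * f y‖ ≤ C * s.sup (schwartzSeminormFamily ℂ Plane ℂ) f := by
    refine ⟨Finset.Iic (n, 0), (∫ y, ((1 + ‖y‖) ^ n)⁻¹ * ‖Q y‖) * 2 ^ n,
      mul_nonneg (integral_nonneg fun y => by positivity) (by positivity), fun f => ?_⟩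
    refine (norm_integral_le_integral_norm _).trans ?_
    refine (integral_mono (hI f).norm (hi.mul_const _) (hb f)).trans ?_
    rw [integral_mul_const, mul_assoc]
    rfl
  refine ⟨ContinuousLinearMap.toPointwiseConvergenceCLM _ _ _ _ (SchwartzMap.mkCLMtoNormedSpace
    (fun φ : 𝓢(Plane, ℂ) => ∫ y, Q y * φ y) (fun f g => ?_) (fun a f => ?_) hbound), fun φ =>
      ⟨hI φ, rfl⟩⟩
  · simp only [add_apply, mul_add]
    exact integral_add (hI f) (hI g)
  · simp only [smul_apply, smul_eq_mul, RingHom.id_apply, ← integral_const_mul]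
    congr 1
    ext y
    ring

lemma HasFourierDensity.congr {u : 𝓢'(Plane, ℂ)} {f g : ℝ × ℝ → ℂ} (h : HasFourierDensity u f)
    (hfg : f =ᵐ[volume] g) : HasFourierDensity u g := by
  have h' : ∀ φ : 𝓢(Plane, ℂ), (fun y : Plane => f (dil y) * φ y) =ᵐ[volume]
      fun y => g (dil y) * φ y := fun φ => by
    filter_upwards [ae_dil.2 hfg] with y hy
    rw [hy]
  exact ⟨h.1.congr hfg, fun φ => ⟨(h.2 φ).1.congr (h' φ),
    (h.2 φ).2.trans (integral_congr_ae (h' φ))⟩⟩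

/-- Uniqueness by the fundamental lemma of the calculus of variations. -/
lemma HasFourierDensity.ae_eq {u : 𝓢'(Plane, ℂ)} {f g : ℝ × ℝ → ℂ} (hf : HasFourierDensity u f)
    (hg : HasFourierDensity u g) : f =ᵐ[volume] g := by
  have hint : ∀ φ : 𝓢(Plane, ℂ), Integrable (fun y => (f (dil y) - g (dil y)) * φ y) volume := by
    intro φ
    refine ((hf.2 φ).1.sub (hg.2 φ).1).congr (Filter.Eventually.of_forall fun y => ?_)
    simp [dil_apply, sub_mul]
  have hzero : ∀ φ : 𝓢(Plane, ℂ), ∫ y, (f (dil y) - g (dil y)) * φ y = 0 := by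
    intro φ
    simp only [sub_mul]
    refine (integral_sub (hf.2 φ).1 (hg.2 φ).1).trans ?_
    rw [← (hf.2 φ).2, ← (hg.2 φ).2, sub_self]
  -- A smooth cut-off equal to one on `K` is a Schwartz function, and integrability against it gives
  -- integrability on `K`.
  have hloc : LocallyIntegrable (fun y => f (dil y) - g (dil y)) volume := by
    rw [locallyIntegrable_iff]
    intro K hK
    obtain ⟨b, hb1, hb2, hb3⟩ : ∃ b : Plane → ℝ, ContDiff ℝ ((⊤ : ℕ∞) : WithTop ℕ∞) b ∧ HasCompactSupport b ∧
        ∀ y ∈ K, b y = 1 := by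
      obtain ⟨R, hR⟩ := hK.isBounded.subset_closedBall (0 : Plane)
      have hR' : (0 : ℝ) < max R 1 := by positivity
      let b : ContDiffBump (0 : Plane) := ⟨max R 1, max R 1 + 1, hR', by linarith⟩
      exact ⟨b, b.contDiff, b.hasCompactSupport, fun y hy =>
        b.one_of_mem_closedBall (Metric.closedBall_subset_closedBall (le_max_left _ _) (hR hy))⟩
    have hg₁ : HasCompactSupport (Complex.ofRealCLM ∘ b) := hb2.comp_left rfl
    have hg₂ : ContDiff ℝ ((⊤ : ℕ∞) : WithTop ℕ∞) (Complex.ofRealCLM ∘ b) :=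
        Complex.ofRealCLM.contDiff.comp hb1
    refine (hint (hg₁.toSchwartzMap hg₂)).integrableOn.congr_fun (fun y hy => ?_) hK.measurableSet
    simp [hb3 y hy]
  have h0 := ae_eq_zero_of_integral_contDiff_smul_eq_zero hloc fun b b_smooth b_cpt => by
    have hg₁ : HasCompactSupport (Complex.ofRealCLM ∘ b) := b_cpt.comp_left rfl
    have hg₂ : ContDiff ℝ ((⊤ : ℕ∞) : WithTop ℕ∞) (Complex.ofRealCLM ∘ b) :=
      Complex.ofRealCLM.contDiff.comp b_smooth
    rw [← hzero (hg₁.toSchwartzMap hg₂)]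
    congr 1
    ext y
    simp [mul_comm]
  have h1 : ∀ᵐ z : ℝ × ℝ, f z - g z = 0 := ae_dil.1 h0
  filter_upwards [h1] with z hz using sub_eq_zero.1 hz

lemma jap_dil_le (y : Plane) (i : Fin 2) : jap (2 * Real.pi * y i) ≤ 7 * (1 + ‖y‖) := by
  have h1 : |y i| ≤ ‖y‖ := by simpa using PiLp.norm_apply_le y i
  have h2 := abs_nonneg (y i)
  have h3 := Real.pi_lt_d2
  have h4 : |2 * Real.pi * y i| ≤ 6.3 * ‖y‖ := by
    rw [abs_mul, abs_of_pos (by positivity)]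
    have := Real.pi_pos
    nlinarith
  refine Real.sqrt_le_iff.2 ⟨by positivity, ?_⟩
  rw [← sq_abs]
  have h5 := abs_nonneg (2 * Real.pi * y i)
  nlinarith

/-- The total degree is `3 + 5 = 8`: one more power of `⟨ξ⟩` than in `testW`, to allow for the
derivative. -/
lemma inv_pow_mul_jap_le (y : Plane) :
    ((1 + ‖y‖) ^ 8)⁻¹ * jap (dil y).2 ≤ 7 ^ 8 * testW (dil y) := by
  have h0 : jap (dil y).1 ≤ 7 * (1 + ‖y‖) := jap_dil_le y 0
  have h1 : jap (dil y).2 ≤ 7 * (1 + ‖y‖) := jap_dil_le y 1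
  have p0 := jap_pos (dil y).1
  have p1 := jap_pos (dil y).2
  have hy : 0 < 1 + ‖y‖ := by positivity
  have h2 : jap (dil y).1 ^ 3 * jap (dil y).2 ^ 5 ≤ 7 ^ 8 * (1 + ‖y‖) ^ 8 := by
    calc jap (dil y).1 ^ 3 * jap (dil y).2 ^ 5 ≤ (7 * (1 + ‖y‖)) ^ 3 * (7 * (1 + ‖y‖)) ^ 5 := by
          gcongr
      _ = _ := by ring
  unfold testW
  rw [inv_mul_eq_div, ← mul_inv, ← div_eq_mul_inv, div_le_div_iff₀ (by positivity) (by positivity)]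
  calc jap (dil y).2 * (jap (dil y).1 ^ 3 * jap (dil y).2 ^ 4)
      = jap (dil y).1 ^ 3 * jap (dil y).2 ^ 5 := by ring
    _ ≤ _ := h2

/-- A function dominated by a tame convolution is the Fourier transform of a tempered
distribution. -/
lemma exists_hasFourierDensity {a b : ℝ × ℝ → ℝ≥0∞} {q : ℝ × ℝ → ℂ}
    (hab : ∫⁻ z, ENNReal.ofReal (testW z) * cv a b z < ∞)
    (hq : AEStronglyMeasurable q volume)
    (hle : ∀ z, ‖q z‖ₑ ≤ ENNReal.ofReal (jap z.2) * cv a b z) :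
    ∃ p : 𝓢'(Plane, ℂ), HasFourierDensity p q := by
  have hQ := aestronglyMeasurable_dil hq
  obtain ⟨T, hT⟩ := exists_temperedDistribution_of_density 8 hQ (by
    have hm : AEStronglyMeasurable (fun y : Plane => ((1 + ‖y‖) ^ 8)⁻¹ * ‖q (dil y)‖) volume := by
      refine AEStronglyMeasurable.mul ?_ hQ.norm
      exact Measurable.aestronglyMeasurable (by fun_prop)
    refine ⟨hm, ?_⟩
    rw [HasFiniteIntegral]
    refine lt_of_le_of_lt (lintegral_mono (g := fun y : Plane =>
      ENNReal.ofReal (7 ^ 8) * (ENNReal.ofReal (testW (dil y)) * cv a b (dil y))) fun y => ?_) ?_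
    · have h0 : 0 ≤ ((1 + ‖y‖) ^ 8)⁻¹ := by positivity
      rw [enorm_mul, enorm_norm, Real.enorm_of_nonneg h0]
      beta_reduce
      rw [← mul_assoc, ← ENNReal.ofReal_mul (by norm_num)]
      calc ENNReal.ofReal ((1 + ‖y‖) ^ 8)⁻¹ * ‖q (dil y)‖ₑ
          ≤ ENNReal.ofReal ((1 + ‖y‖) ^ 8)⁻¹ *
            (ENNReal.ofReal (jap (dil y).2) * cv a b (dil y)) := by gcongr; exact hle _
        _ = ENNReal.ofReal (((1 + ‖y‖) ^ 8)⁻¹ * jap (dil y).2) * cv a b (dil y) := by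
            rw [← mul_assoc, ← ENNReal.ofReal_mul h0]
        _ ≤ _ := by exact mul_le_mul_left (ENNReal.ofReal_le_ofReal (inv_pow_mul_jap_le y)) _
    · rw [lintegral_const_mul' _ _ (by simp)]
      exact ENNReal.mul_lt_top (by simp)
        (lintegral_dil_lt_top (F := fun z => ENNReal.ofReal (testW z) * cv a b z) hab))
  refine ⟨𝓕⁻ T, hq, fun φ => ⟨(hT φ).1, ?_⟩⟩
  rw [FourierTransform.fourier_fourierInv_eq]
  exact (hT φ).2

lemma enorm_ofReal_complex {x : ℝ} (hx : 0 ≤ x) : ‖(x : ℂ)‖ₑ = ENNReal.ofReal x := by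
  rw [← ofReal_norm, Complex.norm_of_nonneg hx]

lemma enorm_weighted (f : ℝ × ℝ → ℂ) (z : ℝ × ℝ) :
    ‖weighted (-3 / 4) (1 / 2) f z‖ₑ = wtd (fun z => ‖f z‖ₑ) z := by
  unfold weighted wtd
  rw [enorm_mul, ← modW, ← wt, enorm_ofReal_complex (wt_pos z).le]

lemma eLpNorm_weighted_indicator (f : ℝ × ℝ → ℂ) (s : Set (ℝ × ℝ)) (μ : Measure (ℝ × ℝ)) :
    eLpNorm (weighted (-3 / 4) (1 / 2) (s.indicator f)) 2 μ =
      nl2 (s.indicator (wtd fun z => ‖f z‖ₑ)) μ := by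
  rw [eLpNorm_eq_lintegral_rpow_enorm_toReal (by norm_num) (by norm_num)]
  unfold nl2
  congr 1
  refine lintegral_congr fun z => ?_
  rw [enorm_weighted]
  by_cases h : z ∈ s <;> simp [h, wtd]

lemma hatNormX_eq (f : ℝ × ℝ → ℂ) : hatNormX f = Xn (wtd fun z => ‖f z‖ₑ) := by
  unfold hatNormX Xn hatNormXsb1 hatNormXsb
  simp only [eLpNorm_weighted_indicator]
  have h : ∀ j k, nl2 (regionDᶜ.indicator (wtd fun z => ‖f z‖ₑ))
      (volume.restrict (shellA j ∩ shellB k)) =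
      nl2 ((regionDᶜ ∩ (shellA j ∩ shellB k)).indicator (wtd fun z => ‖f z‖ₑ)) volume :=
    fun j k => by
      rw [nl2_restrict ((measurableSet_shellA j).inter (measurableSet_shellB k)), Set.indicator_indicator, Set.inter_comm]
  simp only [h]

lemma hatNormY_eq (f : ℝ × ℝ → ℂ) : hatNormY f = Yn (wtd fun z => ‖f z‖ₑ) := by
  unfold hatNormY Yn nl2
  congr 1
  refine lintegral_congr fun ξ => ?_
  congr 1
  refine lintegral_congr fun τ => ?_
  have h1 : 0 < modW (τ, ξ) := modW_pos _
  have h2 : 0 < jap ξ := jap_pos _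
  unfold wtd wt
  rw [enorm_mul, enorm_ofReal_complex (by positivity), ← mul_assoc,
    ← ENNReal.ofReal_mul (by positivity)]
  congr 2
  rw [mul_left_comm, ← Real.rpow_add h1]
  norm_num

lemma nl2_congr_ae {α : Type*} {_ : MeasurableSpace α} {μ : Measure α} {F G : α → ℝ≥0∞}
    (h : F =ᵐ[μ] G) : nl2 F μ = nl2 G μ :=
  le_antisymm (nl2_mono_ae (h.mono fun _ hx => hx.le)) (nl2_mono_ae (h.mono fun _ hx => hx.ge))

lemma Xn_congr_ae {F G : ℝ × ℝ → ℝ≥0∞} (h : F =ᵐ[volume] G) : Xn F = Xn G := by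
  have h' : ∀ s : Set (ℝ × ℝ), nl2 (s.indicator F) volume = nl2 (s.indicator G) volume :=
    fun s => nl2_congr_ae (h.mono fun z hz => by by_cases hs : z ∈ s <;> simp [hs, hz])
  unfold Xn
  simp only [h']

lemma hatNormX_congr {f g : ℝ × ℝ → ℂ} (h : f =ᵐ[volume] g) : hatNormX f = hatNormX g := by
  rw [hatNormX_eq, hatNormX_eq]
  exact Xn_congr_ae (h.mono fun z hz => by simp [wtd, hz])

/-- Densities agree almost everywhere and `hatNormX` ignores null sets, so the infimum is attained
at every density. -/
lemma HasFourierDensity.normX_eq {u : 𝓢'(Plane, ℂ)} {f : ℝ × ℝ → ℂ}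
    (hf : HasFourierDensity u f) : normX u = hatNormX f :=
  le_antisymm (iInf₂_le f hf)
    (le_iInf₂ fun _ hg => (hatNormX_congr (hf.ae_eq hg)).le)

lemma HasFourierDensity.normY_le {u : 𝓢'(Plane, ℂ)} {f : ℝ × ℝ → ℂ}
    (hf : HasFourierDensity u f) : normY u ≤ hatNormY f := iInf₂_le f hf

/-- An element of `X` has a strongly measurable Fourier density. -/
lemma exists_stronglyMeasurable_density {u : 𝓢'(Plane, ℂ)} (hu : u ∈ spaceX) :
    ∃ f, StronglyMeasurable f ∧ HasFourierDensity u f := by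
  obtain ⟨f, hf⟩ : ∃ f, HasFourierDensity u f := by
    by_contra! h
    have h' : normX u < ∞ := hu
    simp [normX, h] at h'
  exact ⟨hf.1.mk f, hf.1.stronglyMeasurable_mk, hf.congr hf.1.ae_eq_mk⟩

/-- The Fourier density of the distributional derivative. -/
lemma HasFourierDensity.dx {p : 𝓢'(Plane, ℂ)} {q₀ : ℝ × ℝ → ℂ} (hp : HasFourierDensity p q₀) :
    HasFourierDensity (dx p) fun z => Complex.I * (z.2 : ℂ) * q₀ z := by
  have hs : AEStronglyMeasurable (fun z : ℝ × ℝ => Complex.I * (z.2 : ℂ)) volume :=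
    Measurable.aestronglyMeasurable (by fun_prop)
  refine ⟨hs.mul hp.1, fun φ => ?_⟩
  set e : Plane := EuclideanSpace.single (1 : Fin 2) (1 : ℝ) with he
  set L : Plane → ℂ := fun y => ((inner ℝ y e : ℝ) : ℂ) with hL
  have hT : L.HasTemperateGrowth := by rw [hL]; fun_prop
  have hLv : ∀ y : Plane, L y = (y 1 : ℂ) := fun y => by
    rw [hL, he]; simp [EuclideanSpace.inner_single_right]
  -- The derivative acts as multiplication by `2πi y₁`; the dilation by `2π` in `HasFourierDensity`
  -- turns this into the symbol `iξ`.
  set ψ : 𝓢(Plane, ℂ) := (2 * Real.pi * Complex.I) • SchwartzMap.smulLeftCLM ℂ L φ with hψ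
  have hψv : ∀ y, ψ y = 2 * Real.pi * Complex.I * (y 1 : ℂ) * φ y := fun y => by
    rw [hψ, smul_apply, SchwartzMap.smulLeftCLM_apply_apply hT, hLv]
    simp [mul_assoc]
  have hfun : (fun y : Plane => Complex.I * ((2 * Real.pi * y 1 : ℝ) : ℂ) *
      q₀ (2 * Real.pi * y 0, 2 * Real.pi * y 1) * φ y) =
      fun y : Plane => q₀ (2 * Real.pi * y 0, 2 * Real.pi * y 1) * ψ y := by
    ext y
    rw [hψv]
    push_cast
    ring
  simp only [hfun]
  refine ⟨(hp.2 ψ).1, ?_⟩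
  rw [← (hp.2 ψ).2, Ostrovsky.dx, TemperedDistribution.fourier_lineDerivOp_eq, hψ, map_smul]
  simp [hL, he]

/-! ### The product and the final estimate. -/

section Product

variable {f g : ℝ × ℝ → ℂ}

lemma enorm_convolution_le (f g : ℝ × ℝ → ℂ) (z : ℝ × ℝ) :
    ‖convolution f g (ContinuousLinearMap.mul ℝ ℂ) volume z‖ₑ ≤
      cv (fun z => ‖f z‖ₑ) (fun z => ‖g z‖ₑ) z := by
  refine (enorm_integral_le_lintegral_enorm _).trans_eq ?_
  unfold cv
  simp [enorm_mul]

lemma stronglyMeasurable_convolution (hf : StronglyMeasurable f) (hg : StronglyMeasurable g) :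
    StronglyMeasurable (convolution f g (ContinuousLinearMap.mul ℝ ℂ) volume) := by
  unfold convolution
  refine StronglyMeasurable.integral_prod_right (f := fun z w => ContinuousLinearMap.mul ℝ ℂ (f w)
    (g (z - w))) ?_
  exact (hf.comp_measurable measurable_snd).mul
    (hg.comp_measurable (measurable_fst.sub measurable_snd))

/-- Since `testW` is positive, the finite weighted integral forces `cv` to be finite almost
everywhere. -/
lemma ae_convolutionExistsAt (hf : StronglyMeasurable f) (hg : StronglyMeasurable g)
    (h : ∫⁻ z, ENNReal.ofReal (testW z) * cv (fun z => ‖f z‖ₑ) (fun z => ‖g z‖ₑ) z < ∞) :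
    ∀ᵐ z : ℝ × ℝ, ConvolutionExistsAt f g z (ContinuousLinearMap.mul ℝ ℂ) volume := by
  have hc := measurable_cv (a := fun z => ‖f z‖ₑ) (b := fun z => ‖g z‖ₑ)
    hf.measurable.enorm hg.measurable.enorm
  have ht := measurable_testW
  filter_upwards [ae_lt_top (by fun_prop) h.ne] with z hz
  have h1 : cv (fun z => ‖f z‖ₑ) (fun z => ‖g z‖ₑ) z < ∞ := by
    by_contra h2
    rw [not_lt_top_iff.1 h2, ENNReal.mul_top (by simpa using testW_pos z)] at hz
    exact lt_irrefl _ hz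
  refine ⟨(hf.mul (hg.comp_measurable (measurable_const.sub measurable_id))).aestronglyMeasurable,
    ?_⟩
  rw [HasFiniteIntegral]
  refine lt_of_eq_of_lt ?_ h1
  unfold cv
  simp [enorm_mul]

end Product

/-- The bilinear estimate for tempered distributions. -/
theorem exists_product_estimate {u v : 𝓢'(Plane, ℂ)} (hu : u ∈ spaceX) (hv : v ∈ spaceX) :
    ∃ p w : 𝓢'(Plane, ℂ), IsProduct u v p ∧ IsInverseModulation (dx p) w ∧
      normX w + normY w ≤ mainC * normX u * normX v := by
  obtain ⟨f, hfm, hf⟩ := exists_stronglyMeasurable_density hu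
  obtain ⟨g, hgm, hg⟩ := exists_stronglyMeasurable_density hv
  set a : ℝ × ℝ → ℝ≥0∞ := fun z => ‖f z‖ₑ with ha
  set b : ℝ × ℝ → ℝ≥0∞ := fun z => ‖g z‖ₑ with hb
  have ham : Measurable a := hfm.measurable.enorm
  have hbm : Measurable b := hgm.measurable.enorm
  have hu' : normX u = Xn (wtd a) := hf.normX_eq.trans (hatNormX_eq f)
  have hv' : normX v = Xn (wtd b) := hg.normX_eq.trans (hatNormX_eq g)
  have hfin : ∫⁻ z, ENNReal.ofReal (testW z) * cv a b z < ∞ :=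
    lintegral_testW_cv_lt_top ham hbm (hu' ▸ hu) (hv' ▸ hv)
  set q₀ : ℝ × ℝ → ℂ := fun z => ((2 * Real.pi : ℝ) : ℂ)⁻¹ ^ 2 *
    convolution f g (ContinuousLinearMap.mul ℝ ℂ) volume z with hq₀
  set q : ℝ × ℝ → ℂ := fun z => Complex.I * (z.2 : ℂ) * q₀ z with hq
  set W : ℝ × ℝ → ℂ := fun z => ((jap (modulation z) : ℝ) : ℂ)⁻¹ * q z with hW
  have hq₀m : StronglyMeasurable q₀ := (stronglyMeasurable_convolution hfm hgm).const_mul _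
  have hWm : StronglyMeasurable W := by
    have h1 : Measurable fun z : ℝ × ℝ => ((jap (modulation z) : ℝ) : ℂ)⁻¹ :=
      (Complex.measurable_ofReal.comp measurable_modW).inv
    have h2 : Measurable fun z : ℝ × ℝ => Complex.I * (z.2 : ℂ) := by fun_prop
    exact h1.stronglyMeasurable.mul (h2.stronglyMeasurable.mul hq₀m)
  have hq₀le : ∀ z, ‖q₀ z‖ₑ ≤ cv a b z := by
    intro z
    have h1 : ((2 * Real.pi : ℝ) : ℂ)⁻¹ ^ 2 = (((2 * Real.pi)⁻¹ ^ 2 : ℝ) : ℂ) := by push_cast; rfl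
    have h2 : ENNReal.ofReal ((2 * Real.pi)⁻¹ ^ 2) ≤ 1 := by
      rw [ENNReal.ofReal_le_one]
      have := Real.pi_gt_three
      exact pow_le_one₀ (by positivity) (inv_le_one_of_one_le₀ (by linarith))
    rw [hq₀]
    beta_reduce
    rw [enorm_mul, h1, enorm_ofReal_complex (by positivity)]
    exact (mul_le_mul' h2 (enorm_convolution_le f g z)).trans_eq (one_mul _)
  have hqle : ∀ z, ‖q z‖ₑ ≤ ENNReal.ofReal |z.2| * cv a b z := by
    intro z
    rw [hq]
    beta_reduce
    rw [enorm_mul, enorm_mul, ← ofReal_norm Complex.I, Complex.norm_I, ← ofReal_norm (z.2 : ℂ),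
      Complex.norm_real, ENNReal.ofReal_one, one_mul]
    exact mul_le_mul_right (hq₀le z) _
  have hWle : ∀ z, ‖W z‖ₑ ≤ ENNReal.ofReal (|z.2| * (modW z)⁻¹) * cv a b z := by
    intro z
    rw [hW]
    beta_reduce
    rw [enorm_mul, ← modW, ← Complex.ofReal_inv,
      enorm_ofReal_complex (inv_nonneg.2 (modW_pos z).le), mul_comm |z.2|,
      ENNReal.ofReal_mul (inv_nonneg.2 (modW_pos z).le), mul_assoc]
    exact mul_le_mul_right (hqle z) _
  obtain ⟨p, hp⟩ := exists_hasFourierDensity hfin hq₀m.aestronglyMeasurable fun z =>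
    (hq₀le z).trans (le_mul_of_one_le_left bot_le (by simpa using one_le_jap z.2))
  -- The symbol `|ξ| ⟨σ⟩⁻¹` is at most `⟨ξ⟩`, the growth that `exists_hasFourierDensity` permits.
  obtain ⟨w, hw⟩ := exists_hasFourierDensity hfin hWm.aestronglyMeasurable fun z =>
    (hWle z).trans (mul_le_mul_left (ENNReal.ofReal_le_ofReal
      ((mul_le_of_le_one_right (abs_nonneg _) (inv_le_one_of_one_le₀ (one_le_jap _))).trans
        (abs_le_jap z.2))) _)
  refine ⟨p, w, ⟨f, g, hf, hg, ae_convolutionExistsAt hfm hgm hfin, hp⟩, ⟨q, hp.dx, hw⟩, ?_⟩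
  have hmono : ∀ z, wtd (fun z => ‖W z‖ₑ) z ≤ bil multK (wtd a) (wtd b) z := by
    intro z
    rw [bil_multK_wtd ham hbm]
    unfold wtd outW
    rw [mul_comm (|z.2| * (modW z)⁻¹), ENNReal.ofReal_mul (wt_pos z).le, mul_assoc]
    exact mul_le_mul_right (hWle z) _
  calc normX w + normY w ≤ XYn (wtd fun z => ‖W z‖ₑ) := by
        rw [hw.normX_eq, hatNormX_eq]
        unfold XYn
        gcongr
        exact hw.normY_le.trans_eq (hatNormY_eq W)
    _ ≤ XYn (bil multK (wtd a) (wtd b)) := XYn_mono hmono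
    _ ≤ mainC * Xn (wtd a) * Xn (wtd b) :=
        XYn_bil_multK_le (measurable_wtd ham) (measurable_wtd hbm)
    _ = mainC * normX u * normX v := by rw [hu', hv']

end Ostrovsky

end

theorem lemma3p2 :
    ∃ C : ℝ≥0, ∀ u ∈ Ostrovsky.spaceX, ∀ v ∈ Ostrovsky.spaceX,
      ∃ p w : 𝓢'(Ostrovsky.Plane, ℂ),
        Ostrovsky.IsProduct u v p ∧
        Ostrovsky.IsInverseModulation (Ostrovsky.dx p) w ∧
        Ostrovsky.normX w + Ostrovsky.normY w
          ≤ (C : ℝ≥0∞) * Ostrovsky.normX u * Ostrovsky.normX v := by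
  refine ⟨Ostrovsky.mainC.toNNReal, fun u hu v hv => ?_⟩
  rw [ENNReal.coe_toNNReal Ostrovsky.mainC_lt_top.ne]
  exact Ostrovsky.exists_product_estimate hu hv
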